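/- **Theorem 7.3.** Let $\mathfrak A$ be a $\mathbb Q$-linear additive category with finite limits and finite colimits, equipped with a symmetric monoidal structure $\otimes$ (unit $k$) that is additive and preserves all cokernels in each variable. Let $\mathfrak I$ be a class of objects of $\mathfrak A$ (the *basic* objects). A map $i:U\to V$ in $\mathfrak A$ is a *cofibration* if $\hom(V,I)\to\hom(U,I)$ is onto for all $I\in\mathfrak I$, and an object $F$ is *relatively injective* if $\hom(-,F)$ sends cofibrations to surjections. Assume that every object of $\mathfrak A$ is relatively injective (equivalently, all cofibrations are split monomorphisms). *Pro-objects* of a category are inverse systems $\{P_m\}_{m\ge1}$, with transfer maps $P_{m+1}\to P_m$. A map $f:P\to P'$ of pro-objects of $\mathfrak A$ is a *cofibration* if $\operatorname{colim}_m\hom(P'_m,V)\to\operatorname{colim}_m\hom(P_m,V)$ is onto for every relatively injective $V\in\mathfrak A$. A *supercomplex* is a $\mathbb Z/2$-graded object with a square-zero differential of degree $1$, and $\operatorname{Hom}_{\mathbb Z/2}(X,Y)$ is the supercomplex of abelian groups of homogeneous maps, with differential $f\mapsto \partial f-(-1)^{|f|}f\partial$. A map $X\to X'$ of pro-supercomplexes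 is a *weak equivalence* if $$\operatorname{colim}_n\operatorname{Hom}_{\mathbb Z/2}(X'_n,Y)\to\operatorname{colim}_n\operatorname{Hom}_{\mathbb Z/2}(X_n,Y)$$ is a quasi-isomorphism for every supercomplex $Y$ in $\mathfrak A$ with relatively injective terms. An *algebra* is an object $A$ of $\mathfrak A$ with an associative multiplication $A\otimes A\to A$ (a unit is not required). Its mixed complex $(\Omega A,b,B)$ is given by $\Omega^0A=A$ and $$\Omega^nA=(A\oplus k)\otimes A^{\otimes n}=A^{\otimes n+1}\oplus A^{\otimes n}\qquad(n\ge1).$$ Write $b=\sum_{i=0}^{n}(-1)^i\mu_i$ and $b'=\sum_{i=0}^{n-1}(-1)^i\mu_i$ for the usual maps $A^{\otimes n+1}\to A^{\otimes n}$, where $\mu_i$ multiplies the neighbouring factors number $i$ and $i+1$ for $i<n$, and $\mu_n$ multiplies the last factor with the first one; and let $t$ be $(-1)^n$ times the cyclic permutation of $A^{\otimes n+1}$ that moves the last factor to the front. The operator $b:\Omega^nA\to\Omega^{n-1}A$ is $b$ on $A^{\otimes n+1}$; on $A^{\otimes n}$ it is $(1-t,-b')$ if $n\ge2$, and $0$ if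 $n=1$. The operator $B:\Omega^nA\to\Omega^{n+1}A$ is $\sum_{i=0}^nt^i$ from $A^{\otimes n+1}$ to the summand $A^{\otimes n+1}$ of $\Omega^{n+1}A$, and $0$ on the summand $A^{\otimes n}$. For a mixed complex $M$ put $$X^nM=\frac{M_n}{bM_{n+1}}\oplus\bigoplus_{i=0}^{n-1}M_i ,$$ a supercomplex with the even-odd grading and the differential induced by $b+B$. For a pro-algebra $A=\{A_m\}_{m\ge1}$ let $X^\infty(A)=\{X^n(\Omega A_n)\}_{n\ge1}$. Let $A=\{A_m\}_{m\ge1}$ be a pro-algebra in $\mathfrak A$, with filtrations by subobjects $$A_m=\mathcal F_0A_m\supset\mathcal F_1A_m\supset\mathcal F_2A_m\supset\cdots\qquad(m\ge1)$$ that are multiplicative ($\mathcal F_iA_m\cdot\mathcal F_jA_m\subset\mathcal F_{i+j}A_m$) and compatible with the transfer maps ($\mathcal F_iA_{m+1}$ is mapped into $\mathcal F_iA_m$). Assume that for every $i\ge0$ the inclusion of pro-objects $\{\mathcal F_{i+1}A_m\}_m\to\{\mathcal F_iA_m\}_m$ is a cofibration, and that for each $m$ there is an $n_m$ with $\mathcal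 F_{n_m}A_m=0$. Let $A/\mathcal F_1A=\{A_m/\mathcal F_1A_m\}_m$ be the quotient pro-algebra. Then the map induced by the projection, $$X^\infty(A)\longrightarrow X^\infty(A/\mathcal F_1A),$$ is a weak equivalence of pro-supercomplexes. -/

import Mathlib

open CategoryTheory CategoryTheory.Limits MonoidalCategory Opposite

set_option linter.unusedSectionVars false

noncomputable section

namespace ProCyclic

universe v u

section Algebras

variable (C : Type u) [Category.{v} C] [MonoidalCategory C]

/-- A (not necessarily unital) algebra in a monoidal category. -/
structure Alg where
  X : C
  mul : X ⊗ X ⟶ X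
  mul_assoc : mul ▷ X ≫ mul = (α_ X X X).hom ≫ X ◁ mul ≫ mul

variable {C}

/-- Homomorphisms of (not necessarily unital) algebras. -/
@[ext]
structure Alg.Hom (A B : Alg C) where
  hom : A.X ⟶ B.X
  map_mul : A.mul ≫ hom = (hom ⊗ₘ hom) ≫ B.mul

instance : Category (Alg C) where
  Hom A B := Alg.Hom A B
  id A := ⟨𝟙 A.X, by simp⟩
  comp f g := ⟨f.hom ≫ g.hom, by
    rw [← Category.assoc, f.map_mul, Category.assoc, g.map_mul, ← tensorHom_comp_tensorHom,
      Category.assoc]⟩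
  id_comp f := Alg.Hom.ext (Category.id_comp _)
  comp_id f := Alg.Hom.ext (Category.comp_id _)
  assoc f g h := Alg.Hom.ext (Category.assoc _ _ _)

@[ext]
theorem Alg.hom_ext {A B : Alg C} (f g : A ⟶ B) (h : f.hom = g.hom) : f = g := Alg.Hom.ext h

@[simp] theorem Alg.id_hom (A : Alg C) : Alg.Hom.hom (𝟙 A) = 𝟙 A.X := rfl

@[simp] theorem Alg.comp_hom {A B D : Alg C} (f : A ⟶ B) (g : B ⟶ D) :
    Alg.Hom.hom (f ≫ g) = f.hom ≫ g.hom := rfl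

variable (C) in
/-- The forgetful functor from algebras to the underlying category. -/
@[simps] def Alg.forget : Alg C ⥤ C where
  obj A := A.X
  map f := f.hom

/-- `tpow X n` is the tensor power `X ⊗ (X ⊗ ⋯)` with `n + 1` factors. -/
def tpow (X : C) : ℕ → C
  | 0 => X
  | n + 1 => X ⊗ tpow X n

def tpowMap {X Y : C} (f : X ⟶ Y) : ∀ n, tpow X n ⟶ tpow Y n
  | 0 => f
  | n + 1 => f ⊗ₘ tpowMap f n

/-- Tensoring a map between tensor powers of `X` with `X` on the left. -/
def wl (X : C) {n m : ℕ} (f : tpow X n ⟶ tpow X m) : tpow X (n + 1) ⟶ tpow X (m + 1) := X ◁ f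

theorem wl_comp (X : C) {n m k : ℕ} (f : tpow X n ⟶ tpow X m) (g : tpow X m ⟶ tpow X k) :
    wl X (f ≫ g) = wl X f ≫ wl X g := MonoidalCategory.whiskerLeft_comp _ _ _

theorem wl_comp_assoc (X : C) {n m k : ℕ} (f : tpow X n ⟶ tpow X m) (g : tpow X m ⟶ tpow X k)
    {Z : C} (h : tpow X (k + 1) ⟶ Z) : wl X (f ≫ g) ≫ h = wl X f ≫ wl X g ≫ h := by
  rw [wl_comp, Category.assoc]

theorem wl_id (X : C) (n : ℕ) : wl X (𝟙 (tpow X n)) = 𝟙 (tpow X (n + 1)) :=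
  MonoidalCategory.whiskerLeft_id _ _

/-- Multiplication of the first two factors of `A^{⊗(n+2)}`. -/
def mulHead (A : Alg C) : ∀ n, tpow A.X (n + 1) ⟶ tpow A.X n
  | 0 => A.mul
  | n + 1 => (α_ A.X A.X (tpow A.X n)).inv ≫ A.mul ▷ tpow A.X n

/-- `face A n i` multiplies the factors number `i` and `i + 1` of `A^{⊗(n+2)}` for `i ≤ n`
(the value for `i > n` is irrelevant). -/
def face (A : Alg C) : ∀ n (_ : ℕ), tpow A.X (n + 1) ⟶ tpow A.X n
  | n, 0 => mulHead A n
  | 0, _ + 1 => mulHead A 0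
  | n + 1, i + 1 => wl A.X (face A n i)

theorem mulG_nat (A : Alg C) {P Q : C} (f : P ⟶ Q) :
    A.X ◁ (A.X ◁ f) ≫ (α_ A.X A.X Q).inv ≫ A.mul ▷ Q =
      ((α_ A.X A.X P).inv ≫ A.mul ▷ P) ≫ A.X ◁ f := by
  rw [Category.assoc, ← whisker_exchange, associator_inv_naturality_right_assoc]

theorem mulHead_nat (A : Alg C) {n m : ℕ} (f : tpow A.X n ⟶ tpow A.X m) :
    wl A.X (wl A.X f) ≫ mulHead A (m + 1) = mulHead A (n + 1) ≫ wl A.X f := mulG_nat A f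

theorem mulG_assoc (A : Alg C) (P : C) :
    A.X ◁ ((α_ A.X A.X P).inv ≫ A.mul ▷ P) ≫ (α_ A.X A.X P).inv ≫ A.mul ▷ P =
      ((α_ A.X A.X (A.X ⊗ P)).inv ≫ A.mul ▷ (A.X ⊗ P)) ≫ (α_ A.X A.X P).inv ≫ A.mul ▷ P := by
  have h : A.X ◁ A.mul ≫ A.mul = (α_ A.X A.X A.X).inv ≫ A.mul ▷ A.X ≫ A.mul := by
    rw [A.mul_assoc, Iso.inv_hom_id_assoc]
  have h2 := congrArg (fun f => f ▷ P) h
  simp only [comp_whiskerRight] at h2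
  simp only [MonoidalCategory.whiskerLeft_comp, Category.assoc]
  rw [associator_inv_naturality_middle_assoc, h2]
  simp

theorem mulHead_assoc (A : Alg C) : ∀ n : ℕ,
    wl A.X (mulHead A n) ≫ mulHead A n = mulHead A (n + 1) ≫ mulHead A n
  | 0 => by
    change A.X ◁ A.mul ≫ A.mul = ((α_ A.X A.X A.X).inv ≫ A.mul ▷ A.X) ≫ A.mul
    rw [Category.assoc, A.mul_assoc, Iso.inv_hom_id_assoc]
  | n + 1 => mulG_assoc A (tpow A.X n)

/-- The inner simplicial identities. -/
theorem face_face (A : Alg C) : ∀ (n i j : ℕ), i ≤ j → j ≤ n →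
    face A (n + 1) (j + 1) ≫ face A n i = face A (n + 1) i ≫ face A n j
  | n, 0, 0, _, _ => by
    simp only [face]
    exact mulHead_assoc A n
  | n + 1, 0, j + 1, _, _ => by
    simp only [face]
    exact mulHead_nat A (face A n j)
  | n + 1, i + 1, j + 1, h1, h2 => by
    have := congrArg (fun f => wl A.X f) (face_face A n i j (by omega) (by omega))
    simp only [face]
    exact ((wl_comp _ _ _).symm.trans this).trans
      (wl_comp _ _ _)
  | 0, _, j + 1, _, h2 => by omega

variable [SymmetricCategory C]

/-- The exchange of the first two factors of `X^{⊗(n+2)}`. -/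
def swapHead (X : C) : ∀ n, tpow X (n + 1) ⟶ tpow X (n + 1)
  | 0 => (β_ X X).hom
  | n + 1 => (α_ X X (tpow X n)).inv ≫ (β_ X X).hom ▷ tpow X n ≫ (α_ X X (tpow X n)).hom

/-- The cyclic permutation of `X^{⊗(n+1)}` that moves the last factor to the front. -/
def cyc (X : C) : ∀ n, tpow X n ⟶ tpow X n
  | 0 => 𝟙 X
  | n + 1 => wl X (cyc X n) ≫ swapHead X n

theorem swapG_nat (X : C) {P Q : C} (f : P ⟶ Q) :
    X ◁ (X ◁ f) ≫ (α_ X X Q).inv ≫ (β_ X X).hom ▷ Q ≫ (α_ X X Q).hom =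
      ((α_ X X P).inv ≫ (β_ X X).hom ▷ P ≫ (α_ X X P).hom) ≫ X ◁ (X ◁ f) := by
  simp only [Category.assoc]
  rw [← associator_naturality_right, ← whisker_exchange_assoc,
    associator_inv_naturality_right_assoc]

theorem swapHead_nat (X : C) {n m : ℕ} (f : tpow X n ⟶ tpow X m) :
    wl X (wl X f) ≫ swapHead X (m + 1) = swapHead X (n + 1) ≫ wl X (wl X f) := swapG_nat X f

theorem swapHead_sq (X : C) : ∀ n : ℕ, swapHead X n ≫ swapHead X n = 𝟙 _
  | 0 => SymmetricCategory.symmetry X X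
  | n + 1 => by
    change ((α_ X X (tpow X n)).inv ≫ (β_ X X).hom ▷ tpow X n ≫ (α_ X X (tpow X n)).hom) ≫
      ((α_ X X (tpow X n)).inv ≫ (β_ X X).hom ▷ tpow X n ≫ (α_ X X (tpow X n)).hom) = 𝟙 _
    simp only [Category.assoc, Iso.hom_inv_id_assoc]
    rw [← comp_whiskerRight_assoc, SymmetricCategory.symmetry]
    simp

theorem swapG_braid0 (X : C) :
    ((α_ X X X).inv ≫ (β_ X X).hom ▷ X ≫ (α_ X X X).hom) ≫ X ◁ (β_ X X).hom ≫
      (α_ X X X).inv ≫ (β_ X X).hom ▷ X ≫ (α_ X X X).hom =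
    X ◁ (β_ X X).hom ≫ ((α_ X X X).inv ≫ (β_ X X).hom ▷ X ≫ (α_ X X X).hom) ≫
      X ◁ (β_ X X).hom := by
  simpa only [Category.assoc] using BraidedCategory.yang_baxter X X X

theorem swapG_braid (X P : C) :
    ((α_ X X (X ⊗ P)).inv ≫ (β_ X X).hom ▷ (X ⊗ P) ≫ (α_ X X (X ⊗ P)).hom) ≫
      X ◁ ((α_ X X P).inv ≫ (β_ X X).hom ▷ P ≫ (α_ X X P).hom) ≫
      (α_ X X (X ⊗ P)).inv ≫ (β_ X X).hom ▷ (X ⊗ P) ≫ (α_ X X (X ⊗ P)).hom =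
    X ◁ ((α_ X X P).inv ≫ (β_ X X).hom ▷ P ≫ (α_ X X P).hom) ≫
      ((α_ X X (X ⊗ P)).inv ≫ (β_ X X).hom ▷ (X ⊗ P) ≫ (α_ X X (X ⊗ P)).hom) ≫
      X ◁ ((α_ X X P).inv ≫ (β_ X X).hom ▷ P ≫ (α_ X X P).hom) := by
  have h := congrArg (fun f : X ⊗ X ⊗ X ⟶ X ⊗ X ⊗ X =>
    (α_ X X (X ⊗ P)).inv ≫ (α_ (X ⊗ X) X P).inv ≫ (α_ X X X).hom ▷ P ≫ f ▷ P ≫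
    (α_ X (X ⊗ X) P).hom ≫ X ◁ (α_ X X P).hom) (BraidedCategory.yang_baxter X X X)
  convert h using 1
  · monoidal
  · monoidal

theorem swapHead_braid (X : C) : ∀ n : ℕ,
    swapHead X (n + 1) ≫ wl X (swapHead X n) ≫ swapHead X (n + 1) =
      wl X (swapHead X n) ≫ swapHead X (n + 1) ≫ wl X (swapHead X n)
  | 0 => swapG_braid0 X
  | n + 1 => swapG_braid X (tpow X n)

theorem swapG_mul0 (A : Alg C) :
    ((α_ A.X A.X A.X).inv ≫ (β_ A.X A.X).hom ▷ A.X ≫ (α_ A.X A.X A.X).hom) ≫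
      A.X ◁ (β_ A.X A.X).hom ≫ (α_ A.X A.X A.X).inv ≫ A.mul ▷ A.X =
    A.X ◁ A.mul ≫ (β_ A.X A.X).hom := by
  rw [BraidedCategory.braiding_naturality_right, BraidedCategory.braiding_tensor_right_hom]
  simp only [Category.assoc]

theorem swapG_mul (A : Alg C) (P : C) :
    ((α_ A.X A.X (A.X ⊗ P)).inv ≫ (β_ A.X A.X).hom ▷ (A.X ⊗ P) ≫ (α_ A.X A.X (A.X ⊗ P)).hom) ≫
      A.X ◁ ((α_ A.X A.X P).inv ≫ (β_ A.X A.X).hom ▷ P ≫ (α_ A.X A.X P).hom) ≫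
        (α_ A.X A.X (A.X ⊗ P)).inv ≫ A.mul ▷ (A.X ⊗ P) =
    A.X ◁ ((α_ A.X A.X P).inv ≫ A.mul ▷ P) ≫
      (α_ A.X A.X P).inv ≫ (β_ A.X A.X).hom ▷ P ≫ (α_ A.X A.X P).hom := by
  have h := congrArg (fun f : A.X ⊗ A.X ⊗ A.X ⟶ A.X ⊗ A.X =>
    (α_ A.X A.X (A.X ⊗ P)).inv ≫ (α_ (A.X ⊗ A.X) A.X P).inv ≫ (α_ A.X A.X A.X).hom ▷ P ≫ f ▷ P ≫
    (α_ A.X A.X P).hom) (swapG_mul0 A)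
  convert h using 1
  · monoidal
  · monoidal

theorem swapHead_mul (A : Alg C) : ∀ n : ℕ,
    swapHead A.X (n + 1) ≫ wl A.X (swapHead A.X n) ≫ mulHead A (n + 1) =
      wl A.X (mulHead A n) ≫ swapHead A.X n
  | 0 => swapG_mul0 A
  | n + 1 => swapG_mul A (tpow A.X n)

theorem whisker_swapHead_sq (X : C) (n : ℕ) {Z : C} (f : tpow X (n + 2) ⟶ Z) :
    wl X (swapHead X n) ≫ wl X (swapHead X n) ≫ f = f := by
  rw [← wl_comp_assoc, swapHead_sq, wl_id,
    Category.id_comp]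

theorem swapHead_sq_assoc' (X : C) (n : ℕ) {Z : C} (f : tpow X (n + 1) ⟶ Z) :
    swapHead X n ≫ swapHead X n ≫ f = f := by
  rw [← Category.assoc, swapHead_sq, Category.id_comp]

theorem swapHead_mul' (A : Alg C) (n : ℕ) :
    wl A.X (swapHead A.X n) ≫ swapHead A.X (n + 1) ≫ wl A.X (mulHead A n) =
      mulHead A (n + 1) ≫ swapHead A.X n := by
  have h := swapHead_mul A n
  have h2 : wl A.X (mulHead A n) =
      (swapHead A.X (n + 1) ≫ wl A.X (swapHead A.X n) ≫ mulHead A (n + 1)) ≫ swapHead A.X n := by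
    rw [h]
    exact ((Category.assoc _ _ _).trans
      ((congrArg _ (swapHead_sq A.X n)).trans (Category.comp_id _))).symm
  rw [h2]
  simp only [Category.assoc]
  exact (congrArg (wl A.X (swapHead A.X n) ≫ ·) (swapHead_sq_assoc' A.X (n + 1) _)).trans
    (whisker_swapHead_sq _ _ _)

theorem swapHead_mul'' (A : Alg C) (n : ℕ) :
    swapHead A.X (n + 1) ≫ wl A.X (swapHead A.X n) ≫ swapHead A.X (n + 1) ≫ mulHead A (n + 1) =
      wl A.X (swapHead A.X n) ≫ wl A.X (mulHead A n) ≫ swapHead A.X n := by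
  have h := congrArg (fun f => f ≫ mulHead A (n + 1)) (swapHead_braid A.X n)
  refine Eq.trans ?_ (h.trans ?_)
  · simp only [Category.assoc]
  · refine (Category.assoc _ _ _).trans (congrArg (wl A.X (swapHead A.X n) ≫ ·) ?_)
    exact (Category.assoc _ _ _).trans (swapHead_mul A n)

theorem cyc_face (A : Alg C) : ∀ n i : ℕ, i + 1 ≤ n →
    cyc A.X (n + 1) ≫ face A n (i + 1) = face A n i ≫ cyc A.X n
  | 0, _, h => by omega
  | n + 1, 0, _ => by
    simp only [face, cyc]
    calc (wl A.X (wl A.X (cyc A.X n) ≫ swapHead A.X n) ≫ swapHead A.X (n + 1)) ≫ wl A.X (mulHead A n)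
      _ = wl A.X (wl A.X (cyc A.X n)) ≫
          wl A.X (swapHead A.X n) ≫ swapHead A.X (n + 1) ≫ wl A.X (mulHead A n) := by
        simp only [wl_comp, Category.assoc]
      _ = wl A.X (wl A.X (cyc A.X n)) ≫ mulHead A (n + 1) ≫ swapHead A.X n :=
        congrArg _ (swapHead_mul' A n)
      _ = (mulHead A (n + 1) ≫ wl A.X (cyc A.X n)) ≫ swapHead A.X n := by
        rw [← mulHead_nat, Category.assoc]
      _ = _ := Category.assoc _ _ _
  | n + 2, i + 1, h => by
    have ih := congrArg (fun f => wl A.X f) (cyc_face A (n + 1) i (by omega))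
    calc cyc A.X (n + 3) ≫ face A (n + 2) (i + 2)
      _ = wl A.X (cyc A.X (n + 2)) ≫ swapHead A.X (n + 2) ≫ wl A.X (wl A.X (face A n i)) :=
        Category.assoc _ _ _
      _ = wl A.X (cyc A.X (n + 2)) ≫ wl A.X (wl A.X (face A n i)) ≫ swapHead A.X (n + 1) :=
        congrArg _ (swapHead_nat A.X (face A n i)).symm
      _ = wl A.X (cyc A.X (n + 2) ≫ face A (n + 1) (i + 1)) ≫ swapHead A.X (n + 1) := by
        rw [wl_comp, Category.assoc]; rfl
      _ = wl A.X (face A (n + 1) i ≫ cyc A.X (n + 1)) ≫ swapHead A.X (n + 1) :=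
        congrArg (· ≫ swapHead A.X (n + 1)) ih
      _ = _ := by
        rw [wl_comp, Category.assoc]; rfl

theorem cyc_cyc_mulHead (A : Alg C) : ∀ n : ℕ,
    cyc A.X (n + 1) ≫ cyc A.X (n + 1) ≫ mulHead A n = face A n n ≫ cyc A.X n
  | 0 => by
    have h : A.X ◁ 𝟙 A.X ≫ (β_ A.X A.X).hom = (β_ A.X A.X).hom := by simp
    change (A.X ◁ 𝟙 A.X ≫ (β_ A.X A.X).hom) ≫ (A.X ◁ 𝟙 A.X ≫ (β_ A.X A.X).hom) ≫ A.mul =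
      A.mul ≫ 𝟙 A.X
    rw [h, SymmetricCategory.symmetry_assoc, Category.comp_id]
  | n + 1 => by
    have ih := congrArg (fun f => wl A.X f) (cyc_cyc_mulHead A n)
    have e : wl A.X (cyc A.X (n + 1)) = wl A.X (wl A.X (cyc A.X n)) ≫ wl A.X (swapHead A.X n) :=
      wl_comp _ _ _
    calc cyc A.X (n + 2) ≫ cyc A.X (n + 2) ≫ mulHead A (n + 1)
      _ = wl A.X (cyc A.X (n + 1)) ≫ (swapHead A.X (n + 1) ≫ wl A.X (wl A.X (cyc A.X n))) ≫
            wl A.X (swapHead A.X n) ≫ swapHead A.X (n + 1) ≫ mulHead A (n + 1) := by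
        change (wl A.X (cyc A.X (n + 1)) ≫ swapHead A.X (n + 1)) ≫
          (wl A.X (cyc A.X (n + 1)) ≫ swapHead A.X (n + 1)) ≫ mulHead A (n + 1) = _
        rw [e]
        simp only [Category.assoc]
      _ = wl A.X (cyc A.X (n + 1)) ≫ wl A.X (wl A.X (cyc A.X n)) ≫
            swapHead A.X (n + 1) ≫ wl A.X (swapHead A.X n) ≫ swapHead A.X (n + 1) ≫
              mulHead A (n + 1) := by
        rw [← swapHead_nat]
        simp only [Category.assoc]
      _ = wl A.X (cyc A.X (n + 1)) ≫ wl A.X (wl A.X (cyc A.X n)) ≫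
            wl A.X (swapHead A.X n) ≫ wl A.X (mulHead A n) ≫ swapHead A.X n := by
        rw [swapHead_mul'']
      _ = wl A.X (cyc A.X (n + 1) ≫ cyc A.X (n + 1) ≫ mulHead A n) ≫ swapHead A.X n := by
        rw [wl_comp, wl_comp]
        conv_rhs => rw [Category.assoc, Category.assoc]
        refine congrArg (wl A.X (cyc A.X (n + 1)) ≫ ·) ?_
        refine Eq.trans ?_ (congrArg (· ≫ wl A.X (mulHead A n) ≫ swapHead A.X n) e.symm)
        exact (Category.assoc _ _ _).symm
      _ = wl A.X (face A n n ≫ cyc A.X n) ≫ swapHead A.X n :=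
        congrArg (· ≫ swapHead A.X n) ih
      _ = _ := by
        rw [wl_comp, Category.assoc]; rfl

/-- Iterates of an endomorphism. -/
def ipow {X : C} (f : X ⟶ X) : ℕ → (X ⟶ X)
  | 0 => 𝟙 X
  | k + 1 => ipow f k ≫ f

/-- Exchange of the factors number `i` and `i + 1` of `X^{⊗(n+2)}`, `i ≤ n`. -/
def swp (X : C) : ∀ n (_ : ℕ), tpow X (n + 1) ⟶ tpow X (n + 1)
  | n, 0 => swapHead X n
  | 0, _ + 1 => swapHead X 0
  | n + 1, i + 1 => wl X (swp X n i)

theorem cyc_swp (X : C) : ∀ n i : ℕ, i + 1 ≤ n →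
    cyc X (n + 1) ≫ swp X n (i + 1) = swp X n i ≫ cyc X (n + 1)
  | 0, _, h => by omega
  | n + 1, 0, _ => by
    have e : wl X (cyc X (n + 1)) = wl X (wl X (cyc X n)) ≫ wl X (swapHead X n) :=
      wl_comp _ _ _
    simp only [swp]
    calc cyc X (n + 2) ≫ wl X (swapHead X n)
      _ = wl X (wl X (cyc X n)) ≫ wl X (swapHead X n) ≫ swapHead X (n + 1) ≫ wl X (swapHead X n) := by
        change (wl X (cyc X (n + 1)) ≫ swapHead X (n + 1)) ≫ wl X (swapHead X n) = _
        rw [e]; simp only [Category.assoc]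
      _ = (wl X (wl X (cyc X n)) ≫ swapHead X (n + 1)) ≫ wl X (swapHead X n) ≫ swapHead X (n + 1) := by
        rw [← swapHead_braid, Category.assoc]
      _ = swapHead X (n + 1) ≫ (wl X (wl X (cyc X n)) ≫ wl X (swapHead X n)) ≫ swapHead X (n + 1) := by
        rw [swapHead_nat]; simp only [Category.assoc]
      _ = _ := by rw [← e]; rfl
  | n + 2, i + 1, h => by
    have ih := congrArg (fun f => wl X f) (cyc_swp X (n + 1) i (by omega))
    calc cyc X (n + 3) ≫ swp X (n + 2) (i + 2)
      _ = wl X (cyc X (n + 2)) ≫ swapHead X (n + 2) ≫ wl X (wl X (swp X n i)) :=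
        Category.assoc _ _ _
      _ = wl X (cyc X (n + 2)) ≫ wl X (wl X (swp X n i)) ≫ swapHead X (n + 2) :=
        congrArg _ (swapHead_nat X (swp X n i)).symm
      _ = wl X (cyc X (n + 2) ≫ swp X (n + 1) (i + 1)) ≫ swapHead X (n + 2) := by
        rw [wl_comp, Category.assoc]; rfl
      _ = wl X (swp X (n + 1) i ≫ cyc X (n + 2)) ≫ swapHead X (n + 2) :=
        congrArg (· ≫ swapHead X (n + 2)) ih
      _ = _ := by
        rw [wl_comp, Category.assoc]; rfl

/-- The composite of `k` consecutive exchanges, starting with number `m`. -/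
def swpRun (X : C) (n : ℕ) : ∀ (_ _ : ℕ), tpow X (n + 1) ⟶ tpow X (n + 1)
  | _, 0 => 𝟙 _
  | m, k + 1 => swp X n m ≫ swpRun X n (m + 1) k

theorem swpRun_cyc (X : C) (n : ℕ) : ∀ k m : ℕ, m + k ≤ n →
    swpRun X n m k ≫ cyc X (n + 1) = cyc X (n + 1) ≫ swpRun X n (m + 1) k
  | 0, m, _ => by simp [swpRun]
  | k + 1, m, h => by
    simp only [swpRun, Category.assoc]
    rw [swpRun_cyc X n k (m + 1) (by omega), ← Category.assoc, ← cyc_swp X n m (by omega),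
      Category.assoc]

theorem ipow_cyc_succ (X : C) (n : ℕ) : ∀ k : ℕ, k ≤ n + 1 →
    ipow (cyc X (n + 1)) k = wl X (ipow (cyc X n) k) ≫ swpRun X n 0 k
  | 0, _ => by
    simp only [ipow, swpRun]
    exact ((Category.comp_id _).trans (wl_id _ _)).symm
  | k + 1, h => by
    simp only [ipow]
    rw [ipow_cyc_succ X n k (by omega), Category.assoc, swpRun_cyc X n k 0 (by omega),
      wl_comp, Category.assoc]
    refine congrArg (wl X (ipow (cyc X n) k) ≫ ·) ?_
    simp only [swpRun]
    have : swp X n 0 = swapHead X n := by cases n <;> rfl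
    rw [this]
    exact Category.assoc _ _ _

theorem swpRun_whisker (X : C) (n : ℕ) : ∀ k m : ℕ,
    swpRun X (n + 1) (m + 1) k = wl X (swpRun X n m k)
  | 0, m => (wl_id _ _).symm
  | k + 1, m => by
    simp only [swpRun]
    rw [swpRun_whisker X n k (m + 1), wl_comp]
    rfl

theorem cyc_swpRun (X : C) : ∀ n : ℕ, cyc X (n + 1) ≫ swpRun X n 0 (n + 1) = 𝟙 _
  | 0 => by
    have h : X ◁ 𝟙 X ≫ (β_ X X).hom = (β_ X X).hom := by simp
    change (X ◁ 𝟙 X ≫ (β_ X X).hom) ≫ (β_ X X).hom ≫ 𝟙 (X ⊗ X) = 𝟙 (X ⊗ X)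
    rw [h, Category.comp_id, SymmetricCategory.symmetry]
  | n + 1 => by
    calc cyc X (n + 2) ≫ swpRun X (n + 1) 0 (n + 2)
      _ = wl X (cyc X (n + 1)) ≫ swapHead X (n + 1) ≫ swapHead X (n + 1) ≫
            swpRun X (n + 1) 1 (n + 1) := Category.assoc _ _ _
      _ = wl X (cyc X (n + 1)) ≫ wl X (swpRun X n 0 (n + 1)) := by
        rw [swpRun_whisker]
        exact congrArg (wl X (cyc X (n + 1)) ≫ ·) (swapHead_sq_assoc' X (n + 1) _)
      _ = wl X (cyc X (n + 1) ≫ swpRun X n 0 (n + 1)) :=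
        (wl_comp _ _ _).symm
      _ = wl X (𝟙 _) := congrArg _ (cyc_swpRun X n)
      _ = 𝟙 _ := wl_id _ _

theorem ipow_succ' {X : C} (f : X ⟶ X) : ∀ k, ipow f (k + 1) = f ≫ ipow f k
  | 0 => by simp [ipow]
  | k + 1 => by
    rw [ipow, ipow_succ' f k, Category.assoc, ← ipow_succ' f k]; rfl

theorem ipow_cyc (X : C) : ∀ n : ℕ, ipow (cyc X n) (n + 1) = 𝟙 _
  | 0 => Category.id_comp _
  | n + 1 => by
    have h := ipow_cyc_succ X n (n + 1) le_rfl
    rw [ipow_cyc X n] at h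
    have h1 : ipow (cyc X (n + 1)) (n + 1) = swpRun X n 0 (n + 1) :=
      h.trans ((congrArg (· ≫ _) (wl_id _ _)).trans (Category.id_comp _))
    rw [ipow_succ', h1, cyc_swpRun]


theorem mulHead_map {A B : Alg C} (f : A ⟶ B) : ∀ n : ℕ,
    mulHead A n ≫ tpowMap f.hom n = tpowMap f.hom (n + 1) ≫ mulHead B n
  | 0 => f.map_mul
  | n + 1 => by
    change ((α_ A.X A.X (tpow A.X n)).inv ≫ A.mul ▷ tpow A.X n) ≫ (f.hom ⊗ₘ tpowMap f.hom n) =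
      (f.hom ⊗ₘ f.hom ⊗ₘ tpowMap f.hom n) ≫
        (α_ B.X B.X (tpow B.X n)).inv ≫ B.mul ▷ tpow B.X n
    rw [associator_inv_naturality_assoc, Category.assoc, tensorHom_def (f.hom ⊗ₘ f.hom),
      Category.assoc, whisker_exchange, tensorHom_def f.hom (tpowMap f.hom n),
      ← comp_whiskerRight_assoc, ← comp_whiskerRight_assoc, f.map_mul]

theorem swapHead_map {X Y : C} (f : X ⟶ Y) : ∀ n : ℕ,
    swapHead X n ≫ tpowMap f (n + 1) = tpowMap f (n + 1) ≫ swapHead Y n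
  | 0 => (BraidedCategory.braiding_naturality f f).symm
  | n + 1 => by
    change ((α_ X X (tpow X n)).inv ≫ (β_ X X).hom ▷ tpow X n ≫ (α_ X X (tpow X n)).hom) ≫
        (f ⊗ₘ f ⊗ₘ tpowMap f n) = (f ⊗ₘ f ⊗ₘ tpowMap f n) ≫
      (α_ Y Y (tpow Y n)).inv ≫ (β_ Y Y).hom ▷ tpow Y n ≫ (α_ Y Y (tpow Y n)).hom
    rw [associator_inv_naturality_assoc, Category.assoc, Category.assoc,
      ← associator_naturality, tensorHom_def (f ⊗ₘ f), Category.assoc, Category.assoc,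
      whisker_exchange_assoc, ← comp_whiskerRight_assoc, ← comp_whiskerRight_assoc,
      BraidedCategory.braiding_naturality]

theorem wl_map {X Y : C} (f : X ⟶ Y) {n m : ℕ} (g : tpow X n ⟶ tpow X m)
    (g' : tpow Y n ⟶ tpow Y m) (h : g ≫ tpowMap f m = tpowMap f n ≫ g') :
    wl X g ≫ tpowMap f (m + 1) = tpowMap f (n + 1) ≫ wl Y g' := by
  change X ◁ g ≫ (f ⊗ₘ tpowMap f m) = (f ⊗ₘ tpowMap f n) ≫ Y ◁ g'
  rw [tensorHom_def', tensorHom_def', Category.assoc, ← whisker_exchange,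
    ← MonoidalCategory.whiskerLeft_comp_assoc, h, MonoidalCategory.whiskerLeft_comp_assoc]

theorem face_map {A B : Alg C} (f : A ⟶ B) : ∀ n i : ℕ,
    face A n i ≫ tpowMap f.hom n = tpowMap f.hom (n + 1) ≫ face B n i
  | 0, 0 => mulHead_map f 0
  | n + 1, 0 => mulHead_map f (n + 1)
  | 0, _ + 1 => mulHead_map f 0
  | n + 1, i + 1 => wl_map _ _ _ (face_map f n i)

theorem cyc_map {X Y : C} (f : X ⟶ Y) : ∀ n : ℕ,
    cyc X n ≫ tpowMap f n = tpowMap f n ≫ cyc Y n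
  | 0 => (Category.id_comp _).trans (Category.comp_id _).symm
  | n + 1 => by
    simp only [cyc]
    rw [Category.assoc, swapHead_map, ← Category.assoc, wl_map f _ _ (cyc_map f n), Category.assoc]

theorem tpowMap_id (X : C) : ∀ n : ℕ, tpowMap (𝟙 X) n = 𝟙 (tpow X n)
  | 0 => rfl
  | n + 1 => by
    change 𝟙 X ⊗ₘ tpowMap (𝟙 X) n = 𝟙 (X ⊗ tpow X n)
    rw [tpowMap_id X n]; simp

theorem tpowMap_comp {X Y Z : C} (f : X ⟶ Y) (g : Y ⟶ Z) : ∀ n : ℕ,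
    tpowMap (f ≫ g) n = tpowMap f n ≫ tpowMap g n
  | 0 => rfl
  | n + 1 => by
    change (f ≫ g) ⊗ₘ tpowMap (f ≫ g) n = (f ⊗ₘ tpowMap f n) ≫ (g ⊗ₘ tpowMap g n)
    rw [tpowMap_comp f g n]; simp

end Algebras

section Cyclic

variable {C : Type u} [Category.{v} C] [MonoidalCategory C] [SymmetricCategory C]
  [Preadditive C]

/-- The signed cyclic operator `t = (-1)^n (cyclic permutation)` on `A^{⊗(n+1)}`. -/
def tt (X : C) (n : ℕ) : tpow X n ⟶ tpow X n := (-1 : ℤ) ^ n • cyc X n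

/-- The signed Hochschild faces `A^{⊗(n+2)} ⟶ A^{⊗(n+1)}`: for `i ≤ n` multiply the factors number
`i` and `i + 1`, for `i = n + 1` multiply the last factor with the first one. -/
def sface (A : Alg C) (n i : ℕ) : tpow A.X (n + 1) ⟶ tpow A.X n :=
  (-1 : ℤ) ^ i • (if i ≤ n then face A n i else cyc A.X (n + 1) ≫ mulHead A n)

/-- The differential `b'` of the bar complex. -/
def bp (A : Alg C) (n : ℕ) : tpow A.X (n + 1) ⟶ tpow A.X n :=
  ∑ i ∈ Finset.range (n + 1), sface A n i

/-- The Hochschild differential `b`. -/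
def hb (A : Alg C) (n : ℕ) : tpow A.X (n + 1) ⟶ tpow A.X n :=
  ∑ i ∈ Finset.range (n + 2), sface A n i

/-- The norm operator `1 + t + ⋯ + t^n` on `A^{⊗(n+1)}`. -/
def nm (X : C) (n : ℕ) : tpow X n ⟶ tpow X n :=
  ∑ k ∈ Finset.range (n + 1), ipow (tt X n) k

theorem tt_sface_zero (A : Alg C) (n : ℕ) :
    tt A.X (n + 1) ≫ sface A n 0 = sface A n (n + 1) := by
  have : face A n 0 = mulHead A n := by cases n <;> rfl
  simp [tt, sface, this]

theorem tt_sface_succ (A : Alg C) (n i : ℕ) (h : i ≤ n) :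
    tt A.X (n + 1) ≫ sface A n (i + 1) = sface A n i ≫ tt A.X n := by
  have key : cyc A.X (n + 1) ≫ (if i + 1 ≤ n then face A n (i + 1) else
      cyc A.X (n + 1) ≫ mulHead A n) = face A n i ≫ cyc A.X n := by
    split_ifs with h1
    · exact cyc_face A n i h1
    · obtain rfl : i = n := by omega
      exact cyc_cyc_mulHead A i
  simp only [tt, sface, Preadditive.zsmul_comp, Preadditive.comp_zsmul, key, if_pos h, smul_smul]
  congr 1
  ring

theorem sface_sface_inner (A : Alg C) (n i j : ℕ) (h : i ≤ j) (h' : j ≤ n) :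
    sface A (n + 1) (j + 1) ≫ sface A n i = - (sface A (n + 1) i ≫ sface A n j) := by
  simp only [sface, if_pos (show j + 1 ≤ n + 1 by omega), if_pos (show i ≤ n by omega),
    if_pos (show i ≤ n + 1 by omega), if_pos h', Preadditive.zsmul_comp, Preadditive.comp_zsmul,
    face_face A n i j h h', smul_smul]
  rw [← neg_smul]
  congr 1
  ring

theorem ipow_tt (X : C) (n : ℕ) : ipow (tt X n) (n + 1) = 𝟙 _ := by
  have h : ∀ (a : ℤ) k, ipow (a • cyc X n) k = a ^ k • ipow (cyc X n) k := by
    intro a k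
    induction k with
    | zero => simp [ipow]
    | succ k ih =>
      rw [ipow, ih, ipow, Preadditive.zsmul_comp, Preadditive.comp_zsmul, smul_smul, pow_succ]
  rw [tt, h, ipow_cyc, ← pow_mul, Even.neg_one_pow (Nat.even_mul_succ_self n), one_smul]

theorem tt_nm (X : C) (n : ℕ) : tt X n ≫ nm X n = nm X n := by
  have h : tt X n ≫ nm X n = ∑ k ∈ Finset.range (n + 1), ipow (tt X n) (k + 1) := by
    simp only [nm, Preadditive.comp_sum, ipow_succ']
  rw [h]
  have h1 := Finset.sum_range_succ' (fun k => ipow (tt X n) k) (n + 1)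
  have h2 := Finset.sum_range_succ (fun k => ipow (tt X n) k) (n + 1)
  rw [ipow_tt] at h2
  rw [h2] at h1
  exact (add_right_cancel h1).symm

theorem nm_tt (X : C) (n : ℕ) : nm X n ≫ tt X n = nm X n := by
  refine Eq.trans ?_ (tt_nm X n)
  simp only [nm, Preadditive.comp_sum, Preadditive.sum_comp, ← ipow_succ']
  rfl

theorem ipow_nm (X : C) (n : ℕ) : ∀ k, ipow (tt X n) k ≫ nm X n = nm X n
  | 0 => Category.id_comp _
  | k + 1 => by rw [ipow, Category.assoc, tt_nm, ipow_nm X n k]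

theorem nm_ipow (X : C) (n : ℕ) : ∀ k, nm X n ≫ ipow (tt X n) k = nm X n
  | 0 => Category.comp_id _
  | k + 1 => by rw [ipow, ← Category.assoc, nm_ipow X n k, nm_tt]

theorem ipow_add {X : C} (f : X ⟶ X) (k : ℕ) : ∀ l, ipow f (k + l) = ipow f k ≫ ipow f l
  | 0 => (Category.comp_id _).symm
  | l + 1 => by rw [← add_assoc, ipow, ipow_add f k l, Category.assoc]; rfl

theorem ipow_sface (A : Alg C) (n : ℕ) : ∀ i, i ≤ n + 1 →
    ipow (tt A.X (n + 1)) i ≫ sface A n i = sface A n 0 ≫ ipow (tt A.X n) i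
  | 0, _ => (Category.id_comp _).trans (Category.comp_id _).symm
  | i + 1, h => by
    rw [ipow, Category.assoc, tt_sface_succ A n i (by omega), ← Category.assoc,
      ipow_sface A n i (by omega), Category.assoc]
    rfl

theorem nm_sface (A : Alg C) (n i : ℕ) (h : i ≤ n + 1) :
    nm A.X (n + 1) ≫ sface A n i = nm A.X (n + 1) ≫ sface A n 0 ≫ ipow (tt A.X n) i := by
  rw [← ipow_sface A n i h, ← Category.assoc, nm_ipow]

theorem sface_nm (A : Alg C) (n i : ℕ) (h : i ≤ n + 1) :
    sface A n i ≫ nm A.X n =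
      ipow (tt A.X (n + 1)) (n + 2 - i) ≫ sface A n 0 ≫ nm A.X n := by
  have h1 : ipow (tt A.X (n + 1)) (n + 2 - i) ≫ ipow (tt A.X (n + 1)) i = 𝟙 _ := by
    rw [← ipow_add, show n + 2 - i + i = n + 1 + 1 by omega, ipow_tt]
  calc sface A n i ≫ nm A.X n
    _ = (ipow (tt A.X (n + 1)) (n + 2 - i) ≫ ipow (tt A.X (n + 1)) i) ≫ sface A n i ≫
          nm A.X n := by rw [h1, Category.id_comp]
    _ = ipow (tt A.X (n + 1)) (n + 2 - i) ≫ (ipow (tt A.X (n + 1)) i ≫ sface A n i) ≫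
          nm A.X n := by simp only [Category.assoc]
    _ = _ := by rw [ipow_sface A n i h, Category.assoc, ipow_nm]

theorem nm_bp (A : Alg C) (n : ℕ) : nm A.X (n + 1) ≫ bp A n = hb A n ≫ nm A.X n := by
  have h1 : nm A.X (n + 1) ≫ bp A n = nm A.X (n + 1) ≫ sface A n 0 ≫ nm A.X n := by
    rw [bp, Preadditive.comp_sum]
    conv_rhs => rw [nm.eq_def A.X n, Preadditive.comp_sum, Preadditive.comp_sum]
    exact Finset.sum_congr rfl fun i hi => nm_sface A n i (by
      have := Finset.mem_range.mp hi; omega)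
  have h2 : hb A n ≫ nm A.X n = nm A.X (n + 1) ≫ sface A n 0 ≫ nm A.X n := by
    have e : nm A.X (n + 1) = ∑ k ∈ Finset.range (n + 2), ipow (tt A.X (n + 1)) (n + 2 - k) := by
      rw [← tt_nm, nm, Preadditive.comp_sum, ← Finset.sum_range_reflect]
      refine Finset.sum_congr rfl fun i hi => ?_
      have := Finset.mem_range.mp hi
      rw [← ipow_succ']
      congr 1
      omega
    rw [hb, Preadditive.sum_comp, e, Preadditive.sum_comp]
    exact Finset.sum_congr rfl fun i hi => sface_nm A n i (by
      have := Finset.mem_range.mp hi; omega)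
  rw [h1, h2]

theorem tt_hb (A : Alg C) (n : ℕ) :
    (𝟙 _ - tt A.X (n + 1)) ≫ hb A n = bp A n ≫ (𝟙 _ - tt A.X n) := by
  have h : tt A.X (n + 1) ≫ hb A n = bp A n ≫ tt A.X n + sface A n (n + 1) := by
    rw [hb, Finset.sum_range_succ', Preadditive.comp_add, tt_sface_zero, Preadditive.comp_sum,
      bp, Preadditive.sum_comp]
    congr 1
    exact Finset.sum_congr rfl fun i hi => tt_sface_succ A n i (by
      have := Finset.mem_range.mp hi; omega)
  rw [Preadditive.sub_comp, Preadditive.comp_sub, h, Category.id_comp, Category.comp_id, hb,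
    Finset.sum_range_succ, ← bp]
  abel

theorem sum_simplicial {G : Type*} [AddCommGroup G] (f : ℕ → ℕ → G) : ∀ N : ℕ,
    (∀ i j, i ≤ j → j < N → f (j + 1) i = - f i j) →
    ∑ j ∈ Finset.range (N + 1), ∑ i ∈ Finset.range N, f j i = 0
  | 0, _ => by simp
  | N + 1, h => by
    have ih := sum_simplicial f N fun i j h1 h2 => h i j h1 (by omega)
    have e : ∀ j, ∑ i ∈ Finset.range (N + 1), f j i = ∑ i ∈ Finset.range N, f j i + f j N :=
      fun j => Finset.sum_range_succ _ N
    simp only [e]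
    rw [Finset.sum_range_succ, Finset.sum_add_distrib, ih, zero_add, Finset.sum_range_succ,
      h N N le_rfl (by omega),
      Finset.sum_congr rfl fun i hi => h i N (Finset.mem_range.mp hi).le (by omega)]
    rw [Finset.sum_neg_distrib]
    abel

theorem sface_sface (A : Alg C) (n i j : ℕ) (h : i ≤ j) (h' : j < n + 2) :
    sface A (n + 1) (j + 1) ≫ sface A n i = - (sface A (n + 1) i ≫ sface A n j) := by
  by_cases hj : j ≤ n
  · exact sface_sface_inner A n i j h hj
  obtain rfl : j = n + 1 := by omega
  rw [← tt_sface_zero A (n + 1), Category.assoc]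
  by_cases hi : i ≤ n
  · have h0 := sface_sface_inner A n 0 i (Nat.zero_le _) hi
    replace h0 := eq_neg_of_add_eq_zero_right (eq_neg_iff_add_eq_zero.mp h0)
    rw [h0, Preadditive.comp_neg, ← Category.assoc, tt_sface_succ A (n + 1) i (by omega),
      Category.assoc, tt_sface_zero]
  · obtain rfl : i = n + 1 := by omega
    have h0 := sface_sface_inner A n 0 0 (Nat.zero_le _) (Nat.zero_le _)
    rw [← tt_sface_zero A n, ← Category.assoc (sface A (n + 1) 0),
      ← tt_sface_succ A (n + 1) 0 (Nat.zero_le _), Category.assoc, h0, Preadditive.comp_neg,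
      Preadditive.comp_neg, ← Category.assoc (tt A.X (n + 1 + 1)) (sface A (n + 1) 0),
      tt_sface_zero, ← Category.assoc (tt A.X (n + 1 + 1)),
      tt_sface_succ A (n + 1) (n + 1) le_rfl, Category.assoc]

theorem bp_bp (A : Alg C) (n : ℕ) : bp A (n + 1) ≫ bp A n = 0 := by
  simp only [bp, Preadditive.sum_comp, Preadditive.comp_sum]
  rw [Finset.sum_comm]
  exact sum_simplicial (fun j i => sface A (n + 1) j ≫ sface A n i) (n + 1)
    fun i j h1 h2 => sface_sface A n i j h1 (by omega)

theorem hb_hb (A : Alg C) (n : ℕ) : hb A (n + 1) ≫ hb A n = 0 := by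
  simp only [hb, Preadditive.sum_comp, Preadditive.comp_sum]
  rw [Finset.sum_comm]
  exact sum_simplicial (fun j i => sface A (n + 1) j ≫ sface A n i) (n + 2)
    fun i j h1 h2 => sface_sface A n i j h1 h2

theorem tt_map {X Y : C} (f : X ⟶ Y) (n : ℕ) :
    tt X n ≫ tpowMap f n = tpowMap f n ≫ tt Y n := by
  simp only [tt, Preadditive.zsmul_comp, Preadditive.comp_zsmul, cyc_map]

theorem sface_map {A B : Alg C} (f : A ⟶ B) (n i : ℕ) :
    sface A n i ≫ tpowMap f.hom n = tpowMap f.hom (n + 1) ≫ sface B n i := by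
  have : (if i ≤ n then face A n i else cyc A.X (n + 1) ≫ mulHead A n) ≫ tpowMap f.hom n =
      tpowMap f.hom (n + 1) ≫
        (if i ≤ n then face B n i else cyc B.X (n + 1) ≫ mulHead B n) := by
    split_ifs
    · exact face_map f n i
    · rw [Category.assoc, mulHead_map, ← Category.assoc, cyc_map, Category.assoc]
  simp only [sface, Preadditive.zsmul_comp, Preadditive.comp_zsmul, this]

theorem bp_map {A B : Alg C} (f : A ⟶ B) (n : ℕ) :
    bp A n ≫ tpowMap f.hom n = tpowMap f.hom (n + 1) ≫ bp B n := by
  simp only [bp, Preadditive.sum_comp, Preadditive.comp_sum, sface_map]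

theorem hb_map {A B : Alg C} (f : A ⟶ B) (n : ℕ) :
    hb A n ≫ tpowMap f.hom n = tpowMap f.hom (n + 1) ≫ hb B n := by
  simp only [hb, Preadditive.sum_comp, Preadditive.comp_sum, sface_map]

theorem nm_map {X Y : C} (f : X ⟶ Y) (n : ℕ) :
    nm X n ≫ tpowMap f n = tpowMap f n ≫ nm Y n := by
  have : ∀ k, ipow (tt X n) k ≫ tpowMap f n = tpowMap f n ≫ ipow (tt Y n) k := by
    intro k
    induction k with
    | zero => exact (Category.id_comp _).trans (Category.comp_id _).symm
    | succ k ih => rw [ipow, Category.assoc, tt_map, ← Category.assoc, ih, Category.assoc]; rfl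
  simp only [nm, Preadditive.sum_comp, Preadditive.comp_sum, this]

end Cyclic


section Mixed

variable (C : Type u) [Category.{v} C] [Preadditive C]

/-- Mixed complexes in degrees `≥ 0`: chain complexes `(M, b)` with an operator `B` of degree `1`
such that `B ^ 2 = 0` and `b B + B b = 0` (in degree `0` the latter reads `b B = 0`). -/
structure MixedComplex where
  cx : ChainComplex C ℕ
  B : ∀ i j, cx.X i ⟶ cx.X j
  shape : ∀ i j, i + 1 ≠ j → B i j = 0
  B_comp_B : ∀ i j k, B i j ≫ B j k = 0
  B_comp_d : B 0 1 ≫ cx.d 1 0 = 0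
  comm : ∀ n, cx.d (n + 1) n ≫ B n (n + 1) + B (n + 1) (n + 2) ≫ cx.d (n + 2) (n + 1) = 0

variable {C}

/-- Morphisms of mixed complexes: chain maps that commute with `B`. -/
@[ext]
structure MixedComplex.Hom (M N : MixedComplex C) where
  hom : M.cx ⟶ N.cx
  comm : ∀ i j, M.B i j ≫ hom.f j = hom.f i ≫ N.B i j

instance : Category (MixedComplex C) where
  Hom M N := MixedComplex.Hom M N
  id M := ⟨𝟙 M.cx, by simp⟩
  comp f g := ⟨f.hom ≫ g.hom, fun i j => by
    rw [HomologicalComplex.comp_f, HomologicalComplex.comp_f, ← Category.assoc, f.comm,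
      Category.assoc, g.comm, Category.assoc]⟩
  id_comp f := MixedComplex.Hom.ext (Category.id_comp _)
  comp_id f := MixedComplex.Hom.ext (Category.comp_id _)
  assoc f g h := MixedComplex.Hom.ext (Category.assoc _ _ _)

@[simp] theorem MixedComplex.id_hom (M : MixedComplex C) :
    MixedComplex.Hom.hom (𝟙 M) = 𝟙 M.cx := rfl

@[simp] theorem MixedComplex.comp_hom {M N P : MixedComplex C} (f : M ⟶ N) (g : N ⟶ P) :
    MixedComplex.Hom.hom (f ≫ g) = f.hom ≫ g.hom := rfl

@[ext]
theorem MixedComplex.hom_ext {M N : MixedComplex C} (f g : M ⟶ N)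
    (h : ∀ i, f.hom.f i = g.hom.f i) : f = g :=
  MixedComplex.Hom.ext (HomologicalComplex.hom_ext _ _ h)

end Mixed

instance {C : Type u} [Category.{v} C] [HasZeroMorphisms C] [HasFiniteBiproducts C] :
    HasBinaryBiproducts C :=
  hasBinaryBiproducts_of_finite_biproducts C

section Forms

variable {C : Type u} [Category.{v} C] [MonoidalCategory C] [SymmetricCategory C]
  [Preadditive C] [HasBinaryBiproducts C]

/-- Noncommutative forms: `Ω⁰ A = A` and `Ωⁿ A = (A ⊕ k) ⊗ A^{⊗n} = A^{⊗(n+1)} ⊕ A^{⊗n}`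
for `n ≥ 1`. -/
def Om (A : Alg C) : ℕ → C
  | 0 => tpow A.X 0
  | n + 1 => tpow A.X (n + 1) ⊞ tpow A.X n

/-- `b : Ω¹ A ⟶ Ω⁰ A`; it vanishes on the second summand, as `b (1 ⊗ a) = a - a = 0`. -/
def ob0 (A : Alg C) : tpow A.X 1 ⊞ tpow A.X 0 ⟶ tpow A.X 0 := biprod.desc (hb A 0) 0

/-- The Hochschild differential of `A ⊕ k` on `(A ⊕ k) ⊗ A^{⊗(n+2)} = A^{⊗(n+3)} ⊕ A^{⊗(n+2)}`: it is
`b` on the first summand and `(1 - t, -b')` on the second one. -/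
def ob (A : Alg C) (n : ℕ) :
    tpow A.X (n + 2) ⊞ tpow A.X (n + 1) ⟶ tpow A.X (n + 1) ⊞ tpow A.X n :=
  biprod.desc (hb A (n + 1) ≫ biprod.inl)
    ((𝟙 _ - tt A.X (n + 1)) ≫ biprod.inl - bp A n ≫ biprod.inr)

/-- The differential `b : Ω^{n+1} A ⟶ Ωⁿ A`. -/
def Omb (A : Alg C) : ∀ n, Om A (n + 1) ⟶ Om A n
  | 0 => ob0 A
  | n + 1 => ob A n

/-- `B : Ω⁰ A ⟶ Ω¹ A`, that is, `a ↦ 1 ⊗ a`. -/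
def oB0 (A : Alg C) : tpow A.X 0 ⟶ tpow A.X 1 ⊞ tpow A.X 0 := nm A.X 0 ≫ biprod.inr

/-- Connes' operator on `Ω^{n+1} A`: it sends the summand `A^{⊗(n+2)}` by `1 + t + ⋯ + t^{n+1}` to the
summand `k ⊗ A^{⊗(n+2)}` of `Ω^{n+2} A`, and the summand `k ⊗ A^{⊗(n+1)}` to zero. -/
def oB (A : Alg C) (n : ℕ) :
    tpow A.X (n + 1) ⊞ tpow A.X n ⟶ tpow A.X (n + 2) ⊞ tpow A.X (n + 1) :=
  biprod.desc (nm A.X (n + 1) ≫ biprod.inr) 0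

/-- Connes' operator `B : Ωⁿ A ⟶ Ω^{n+1} A`. -/
def OmB (A : Alg C) : ∀ n, Om A n ⟶ Om A (n + 1)
  | 0 => oB0 A
  | n + 1 => oB A n

theorem tt_zero (X : C) : tt X 0 = 𝟙 (tpow X 0) := by
  rw [tt, pow_zero, one_smul]; rfl

theorem nm_zero (X : C) : nm X 0 = 𝟙 (tpow X 0) := by
  rw [nm, zero_add, Finset.sum_range_one]; rfl

theorem ob_ob0 (A : Alg C) : ob A 0 ≫ ob0 A = 0 := by
  have := tt_hb A 0
  rw [tt_zero, sub_self, comp_zero] at this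
  apply biprod.hom_ext' <;> simp only [ob, ob0, biprod.inl_desc_assoc, biprod.inr_desc_assoc,
    Category.assoc, biprod.inl_desc, biprod.inr_desc, Preadditive.sub_comp, hb_hb, comp_zero,
    sub_zero]
  rw [← Preadditive.sub_comp, this]

theorem ob_ob (A : Alg C) (n : ℕ) : ob A (n + 1) ≫ ob A n = 0 := by
  have := tt_hb A (n + 1)
  apply biprod.hom_ext'
  · simp only [ob, biprod.inl_desc_assoc, Category.assoc, biprod.inl_desc]
    rw [← Category.assoc, hb_hb, zero_comp, comp_zero]
  · simp only [ob, biprod.inr_desc_assoc, biprod.inl_desc, biprod.inr_desc, comp_zero,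
      Preadditive.sub_comp (_ ≫ biprod.inl), Category.assoc, Preadditive.comp_sub (bp A (n + 1))]
    rw [← Category.assoc, ← Category.assoc, ← Category.assoc, this, bp_bp, zero_comp, sub_zero,
      sub_self]

theorem Omb_Omb (A : Alg C) : ∀ n, Omb A (n + 1) ≫ Omb A n = 0
  | 0 => ob_ob0 A
  | n + 1 => ob_ob A n

theorem OmB_OmB (A : Alg C) : ∀ n, OmB A n ≫ OmB A (n + 1) = 0
  | 0 => by
    change oB0 A ≫ oB A 0 = 0
    simp only [oB0, oB, Category.assoc, biprod.inr_desc, comp_zero]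
  | n + 1 => by
    change oB A n ≫ oB A (n + 1) = 0
    apply biprod.hom_ext' <;> simp [oB]

theorem oB0_ob0 (A : Alg C) : oB0 A ≫ ob0 A = 0 := by
  simp only [oB0, ob0, Category.assoc, biprod.inr_desc, comp_zero]

theorem ob0_oB0 (A : Alg C) : ob0 A ≫ oB0 A + oB A 0 ≫ ob A 0 = 0 := by
  have h1 := nm_bp A 0
  have h2 : nm A.X 1 ≫ (𝟙 _ - tt A.X 1) = 0 := by
    rw [Preadditive.comp_sub, Category.comp_id, nm_tt, sub_self]
  apply biprod.hom_ext'
  · simp only [ob0, oB0, oB, ob, Preadditive.comp_add, biprod.inl_desc_assoc, Category.assoc,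
      biprod.inr_desc, Preadditive.comp_sub (nm A.X (0 + 1)), comp_zero]
    rw [← Category.assoc, ← h1, ← Category.assoc (nm A.X (0 + 1)), h2]
    simp
  · simp [ob0, oB]

theorem ob_oB (A : Alg C) (n : ℕ) : ob A n ≫ oB A n + oB A (n + 1) ≫ ob A (n + 1) = 0 := by
  have h1 := nm_bp A (n + 1)
  have h2 : nm A.X (n + 2) ≫ (𝟙 _ - tt A.X (n + 2)) = 0 := by
    rw [Preadditive.comp_sub, Category.comp_id, nm_tt, sub_self]
  have h3 : (𝟙 _ - tt A.X (n + 1)) ≫ nm A.X (n + 1) = 0 := by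
    rw [Preadditive.sub_comp, Category.id_comp, tt_nm, sub_self]
  apply biprod.hom_ext'
  · simp only [oB, ob, Preadditive.comp_add, biprod.inl_desc_assoc, Category.assoc,
      biprod.inr_desc, Preadditive.comp_sub (nm A.X (n + 1 + 1)), comp_zero, biprod.inl_desc]
    rw [← Category.assoc, ← h1, ← Category.assoc (nm A.X (n + 1 + 1)), h2]
    simp
  · simp only [oB, ob, Preadditive.comp_add, biprod.inr_desc_assoc, Category.assoc,
      Preadditive.sub_comp (_ ≫ biprod.inl), biprod.inr_desc, comp_zero, biprod.inl_desc,
      zero_comp, add_zero, sub_zero]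
    rw [← Category.assoc, h3, zero_comp]

theorem Omb_OmB (A : Alg C) : ∀ n,
    Omb A n ≫ OmB A n + OmB A (n + 1) ≫ Omb A (n + 1) = 0
  | 0 => ob0_oB0 A
  | n + 1 => ob_oB A n

/-- The cyclic mixed complex of an algebra. -/
def Omega (A : Alg C) : MixedComplex C where
  cx := ChainComplex.of (Om A) (Omb A) (Omb_Omb A)
  B := (CochainComplex.of (Om A) (OmB A) (OmB_OmB A)).d
  shape := (CochainComplex.of (Om A) (OmB A) (OmB_OmB A)).shape
  B_comp_B := (CochainComplex.of (Om A) (OmB A) (OmB_OmB A)).d_comp_d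
  B_comp_d := by
    change CochainComplex.of.d (Om A) (OmB A) 0 (0 + 1) ≫
      ChainComplex.of.d (Om A) (Omb A) (0 + 1) 0 = 0
    rw [ChainComplex.of_d, CochainComplex.of_d]
    exact oB0_ob0 A
  comm n := by
    change ChainComplex.of.d (Om A) (Omb A) (n + 1) n ≫
      CochainComplex.of.d (Om A) (OmB A) n (n + 1) +
      CochainComplex.of.d (Om A) (OmB A) (n + 1) (n + 1 + 1) ≫
      ChainComplex.of.d (Om A) (Omb A) (n + 1 + 1) (n + 1) = 0
    rw [ChainComplex.of_d, CochainComplex.of_d, ChainComplex.of_d, CochainComplex.of_d]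
    exact Omb_OmB A n

/-- The map induced on forms by an algebra homomorphism. -/
def OmMap {A A' : Alg C} (f : A ⟶ A') : ∀ n, Om A n ⟶ Om A' n
  | 0 => tpowMap f.hom 0
  | n + 1 => biprod.map (tpowMap f.hom (n + 1)) (tpowMap f.hom n)

theorem OmMap_b {A A' : Alg C} (f : A ⟶ A') : ∀ n,
    OmMap f (n + 1) ≫ Omb A' n = Omb A n ≫ OmMap f n
  | 0 => by
    change biprod.map (tpowMap f.hom 1) (tpowMap f.hom 0) ≫ ob0 A' = ob0 A ≫ tpowMap f.hom 0
    apply biprod.hom_ext'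
    · simp only [ob0, biprod.inl_map_assoc, biprod.inl_desc, biprod.inl_desc_assoc]
      exact (hb_map f 0).symm
    · simp [ob0]
  | n + 1 => by
    change biprod.map (tpowMap f.hom (n + 2)) (tpowMap f.hom (n + 1)) ≫ ob A' n =
      ob A n ≫ biprod.map (tpowMap f.hom (n + 1)) (tpowMap f.hom n)
    apply biprod.hom_ext'
    · simp only [ob, biprod.inl_map_assoc, biprod.inl_desc, biprod.inl_desc_assoc,
        Category.assoc, biprod.inl_map]
      rw [← Category.assoc, ← hb_map, Category.assoc]
    · simp only [ob, biprod.inr_map_assoc, biprod.inr_desc, biprod.inr_desc_assoc,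
        Category.assoc, biprod.inr_map, Preadditive.comp_sub, Preadditive.sub_comp, biprod.inl_map,
        Category.id_comp]
      rw [← Category.assoc _ (tt A'.X (n + 1)), ← tt_map, ← Category.assoc _ (bp A' n), ← bp_map,
        Category.assoc, Category.assoc]

theorem OmMap_B {A A' : Alg C} (f : A ⟶ A') : ∀ n,
    OmMap f n ≫ OmB A' n = OmB A n ≫ OmMap f (n + 1)
  | 0 => by
    change tpowMap f.hom 0 ≫ oB0 A' = oB0 A ≫ biprod.map (tpowMap f.hom 1) (tpowMap f.hom 0)
    simp only [oB0, Category.assoc, biprod.inr_map]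
    rw [← Category.assoc, ← nm_map, Category.assoc]
  | n + 1 => by
    change biprod.map (tpowMap f.hom (n + 1)) (tpowMap f.hom n) ≫ oB A' n =
      oB A n ≫ biprod.map (tpowMap f.hom (n + 2)) (tpowMap f.hom (n + 1))
    apply biprod.hom_ext'
    · simp only [oB, biprod.inl_map_assoc, biprod.inl_desc, biprod.inl_desc_assoc,
        Category.assoc, biprod.inr_map]
      rw [← Category.assoc, ← nm_map, Category.assoc]
    · simp [oB]

theorem OmMap_id (A : Alg C) : ∀ n, OmMap (𝟙 A) n = 𝟙 (Om A n)
  | 0 => rfl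
  | n + 1 => by
    change biprod.map (tpowMap (𝟙 A.X) (n + 1)) (tpowMap (𝟙 A.X) n) =
      𝟙 (tpow A.X (n + 1) ⊞ tpow A.X n)
    rw [tpowMap_id, tpowMap_id]
    apply biprod.hom_ext' <;> simp

theorem OmMap_comp {A₁ A₂ A₃ : Alg C} (f : A₁ ⟶ A₂) (g : A₂ ⟶ A₃) : ∀ n,
    OmMap (f ≫ g) n = OmMap f n ≫ OmMap g n
  | 0 => rfl
  | n + 1 => by
    change biprod.map (tpowMap (f.hom ≫ g.hom) (n + 1)) (tpowMap (f.hom ≫ g.hom) n) =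
      biprod.map (tpowMap f.hom (n + 1)) (tpowMap f.hom n) ≫
      biprod.map (tpowMap g.hom (n + 1)) (tpowMap g.hom n)
    rw [tpowMap_comp, tpowMap_comp]
    apply biprod.hom_ext' <;> simp

/-- The functor `A ↦ Ω A`. -/
def OmegaFunctor : Alg C ⥤ MixedComplex C where
  obj A := Omega A
  map {A A'} f :=
    { hom := ChainComplex.ofHom (X := (Omega A).cx) (Y := (Omega A').cx) (OmMap f) fun i => by
        change OmMap f (i + 1) ≫ ChainComplex.of.d (Om A') (Omb A') (i + 1) i =
          ChainComplex.of.d (Om A) (Omb A) (i + 1) i ≫ OmMap f i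
        rw [ChainComplex.of_d, ChainComplex.of_d]
        exact OmMap_b f i
      comm := fun i j => by
        by_cases h : i + 1 = j
        · subst h
          change CochainComplex.of.d (Om A) (OmB A) i (i + 1) ≫ OmMap f (i + 1) =
            OmMap f i ≫ CochainComplex.of.d (Om A') (OmB A') i (i + 1)
          rw [CochainComplex.of_d, CochainComplex.of_d]
          exact (OmMap_B f i).symm
        · rw [(Omega A).shape i j h, (Omega A').shape i j h, zero_comp, comp_zero] }
  map_id A := MixedComplex.hom_ext _ _ (OmMap_id A)
  map_comp f g := MixedComplex.hom_ext _ _ (OmMap_comp f g)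

end Forms

section Tower

variable {C : Type u} [Category.{v} C] [Preadditive C]

variable (C) in
/-- Supercomplexes: `ℤ/2`-graded objects with a square-zero differential of degree one. -/
abbrev SupComplex := HomologicalComplex C (ComplexShape.up (ZMod 2))

/-- The degree of the summands of `X^n M = M_n / b M_{n+1} ⊕ ⨁_{i < n} M_i`: `some i` stands for
`M_i` and `none` for `M_n / b M_{n+1}`. -/
def Xdeg {n : ℕ} : Option (Fin n) → ℕ
  | none => n
  | some i => i

theorem Xdeg_le {n : ℕ} : ∀ x : Option (Fin n), Xdeg x ≤ n
  | none => le_rfl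
  | some i => i.2.le

variable [HasCokernels C]

/-- The summands of `X^n M = M_n / b M_{n+1} ⊕ ⨁_{i < n} M_i`. -/
def XObj (M : MixedComplex C) (n : ℕ) : Option (Fin n) → C
  | none => cokernel (M.cx.d (n + 1) n)
  | some i => M.cx.X i

/-- The projection `M_i ⟶ X^n M` for `i ≤ n`, in components. -/
def Xq (M : MixedComplex C) (n : ℕ) : ∀ x : Option (Fin n), M.cx.X (Xdeg x) ⟶ XObj M n x
  | none => cokernel.π (M.cx.d (n + 1) n)
  | some i => 𝟙 (M.cx.X i)

instance (M : MixedComplex C) (n : ℕ) : ∀ x : Option (Fin n), Epi (Xq M n x)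
  | none => inferInstanceAs (Epi (cokernel.π (M.cx.d (n + 1) n)))
  | some i => inferInstanceAs (Epi (𝟙 (M.cx.X i)))

/-- The components of the differential of `X^n M` that `b + B` induces. -/
def XD (M : MixedComplex C) (n : ℕ) : ∀ x y : Option (Fin n), XObj M n x ⟶ XObj M n y
  | none, none => 0
  | none, some j => cokernel.desc (M.cx.d (n + 1) n) (M.cx.d n j) (M.cx.d_comp_d _ _ _)
  | some i, none => M.B i n ≫ cokernel.π (M.cx.d (n + 1) n)
  | some i, some j => M.cx.d i j + M.B i j

/-- The component `M_i ⟶ M_j` of `b + B`. -/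
def MixedComplex.E (M : MixedComplex C) (i j : ℕ) : M.cx.X i ⟶ M.cx.X j := M.cx.d i j + M.B i j

theorem MixedComplex.d_zero (M : MixedComplex C) (i j : ℕ) (h : j + 1 ≠ i) : M.cx.d i j = 0 :=
  M.cx.shape i j h

theorem Xq_XD (M : MixedComplex C) (n : ℕ) : ∀ x y : Option (Fin n),
    Xq M n x ≫ XD M n x y = M.E (Xdeg x) (Xdeg y) ≫ Xq M n y
  | none, none => by
    change cokernel.π _ ≫ 0 = (M.cx.d n n + M.B n n) ≫ cokernel.π _
    rw [M.d_zero n n (by omega), M.shape n n (by omega)]; simp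
  | none, some j => by
    change cokernel.π _ ≫ cokernel.desc _ _ _ = (M.cx.d n j + M.B n j) ≫ 𝟙 _
    rw [M.shape n j (by omega)]; simp
  | some i, none => by
    change 𝟙 _ ≫ M.B i n ≫ cokernel.π _ = (M.cx.d i n + M.B i n) ≫ cokernel.π _
    rw [M.d_zero i n (by omega)]; simp
  | some i, some j => (Category.id_comp _).trans (Category.comp_id _).symm

theorem sum_Xdeg {G : Type*} [AddCommMonoid G] (n : ℕ) (f : ℕ → G) :
    ∑ x : Option (Fin n), f (Xdeg x) = ∑ k ∈ Finset.range (n + 1), f k := by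
  rw [Fintype.sum_option, Finset.sum_range_succ, add_comm]
  congr 1
  exact Fin.sum_univ_eq_sum_range f n

theorem MixedComplex.sum_E (M : MixedComplex C) (n i l : ℕ) (hi : i ≤ n) :
    ∑ k ∈ Finset.range (n + 2), M.E i k ≫ M.E k l = 0 := by
  have e : ∀ k, M.E i k ≫ M.E k l = M.cx.d i k ≫ M.B k l + M.B i k ≫ M.cx.d k l := by
    intro k
    simp only [MixedComplex.E, Preadditive.add_comp, Preadditive.comp_add, M.cx.d_comp_d,
      M.B_comp_B]
    abel
  simp only [e]
  by_cases h : i = l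
  · subst h
    rw [Finset.sum_add_distrib]
    cases i with
    | zero =>
      rw [Finset.sum_eq_zero fun k _ => by rw [M.d_zero 0 k (by omega), zero_comp], zero_add,
        Finset.sum_eq_single 1 (fun k _ hk => by rw [M.shape 0 k (by omega), zero_comp])
          (fun h => absurd (Finset.mem_range.mpr (by omega)) h)]
      exact M.B_comp_d
    | succ m =>
      rw [Finset.sum_eq_single m (fun k _ hk => by rw [M.d_zero (m + 1) k (by omega), zero_comp])
          (fun h => absurd (Finset.mem_range.mpr (by omega)) h),
        Finset.sum_eq_single (m + 2) (fun k _ hk => by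
          rw [M.shape (m + 1) k (by omega), zero_comp])
          (fun h => absurd (Finset.mem_range.mpr (by omega)) h)]
      exact M.comm m
  · refine Finset.sum_eq_zero fun k _ => ?_
    by_cases h1 : k + 1 = i
    · rw [M.shape k l (by omega), M.shape i k (by omega), comp_zero, zero_comp, add_zero]
    · rw [M.d_zero i k h1, zero_comp, zero_add]
      by_cases h2 : i + 1 = k
      · rw [M.d_zero k l (by omega), comp_zero]
      · rw [M.shape i k h2, zero_comp]

theorem d_Xq (M : MixedComplex C) (n : ℕ) : ∀ z : Option (Fin n),
    M.cx.d (n + 1) (Xdeg z) ≫ Xq M n z = 0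
  | none => cokernel.condition _
  | some i => by
    have : M.cx.d (n + 1) (Xdeg (some i)) = 0 := M.d_zero _ _ (by simp only [Xdeg]; omega)
    rw [this, zero_comp]

theorem E_Xq (M : MixedComplex C) (n : ℕ) (z : Option (Fin n)) :
    M.E (n + 1) (Xdeg z) ≫ Xq M n z = 0 := by
  have := Xdeg_le z
  rw [MixedComplex.E, M.shape (n + 1) (Xdeg z) (by omega), add_zero, d_Xq]

theorem XD_XD (M : MixedComplex C) (n : ℕ) (x z : Option (Fin n)) :
    ∑ y, XD M n x y ≫ XD M n y z = 0 := by
  rw [← cancel_epi (Xq M n x), Preadditive.comp_sum, comp_zero]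
  have e : ∀ y, Xq M n x ≫ XD M n x y ≫ XD M n y z =
      (M.E (Xdeg x) (Xdeg y) ≫ M.E (Xdeg y) (Xdeg z)) ≫ Xq M n z := fun y => by
    rw [← Category.assoc, Xq_XD, Category.assoc, Xq_XD, Category.assoc]
  have h := M.sum_E n (Xdeg x) (Xdeg z) (Xdeg_le x)
  rw [Finset.sum_range_succ] at h
  have h' := congrArg (· ≫ Xq M n z) h
  simp only [Preadditive.add_comp, Preadditive.sum_comp, zero_comp, Category.assoc, E_Xq,
    comp_zero, add_zero] at h'
  simp only [e]
  rw [sum_Xdeg n fun k => (M.E (Xdeg x) k ≫ M.E k (Xdeg z)) ≫ Xq M n z]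
  simpa only [Category.assoc] using h'

theorem MixedComplex.E_zero (M : MixedComplex C) (i j : ℕ) (h : (i : ZMod 2) + 1 ≠ j) :
    M.E i j = 0 := by
  have h1 : j + 1 ≠ i := by
    rintro rfl
    apply h
    push_cast
    rw [add_assoc, show (1 : ZMod 2) + 1 = 0 from rfl, add_zero]
  have h2 : i + 1 ≠ j := by
    rintro rfl
    exact h (by push_cast; rfl)
  rw [MixedComplex.E, M.d_zero i j h1, M.shape i j h2, add_zero]

theorem XD_zero (M : MixedComplex C) (n : ℕ) (x y : Option (Fin n))
    (h : (Xdeg x : ZMod 2) + 1 ≠ Xdeg y) : XD M n x y = 0 := by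
  rw [← cancel_epi (Xq M n x), Xq_XD, M.E_zero _ _ h, zero_comp, comp_zero]

/-- The indices of the summands of `X^n M` of parity `i`. -/
abbrev XIdx (n : ℕ) (i : ZMod 2) := {x : Option (Fin n) // (Xdeg x : ZMod 2) = i}

theorem sum_XIdx {G : Type*} [AddCommMonoid G] (n : ℕ) (j : ZMod 2) (f : Option (Fin n) → G)
    (h : ∀ y, (Xdeg y : ZMod 2) ≠ j → f y = 0) : ∑ y : XIdx n j, f y.1 = ∑ y, f y := by
  rw [← Finset.sum_filter_of_ne (p := fun y => (Xdeg y : ZMod 2) = j) (s := Finset.univ)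
    (fun y _ hy => by_contra fun hj => hy (h y hj))]
  exact (Finset.sum_subtype (p := fun y => (Xdeg y : ZMod 2) = j) _ (by simp) f).symm

/-- The components of the map `X^n M ⟶ X^n N` induced by a map of mixed complexes. -/
def XMapC {M N : MixedComplex C} (f : M ⟶ N) (n : ℕ) :
    ∀ x : Option (Fin n), XObj M n x ⟶ XObj N n x
  | none =>
    cokernel.map (M.cx.d (n + 1) n) (N.cx.d (n + 1) n) (f.hom.f (n + 1)) (f.hom.f n)
      (f.hom.comm (n + 1) n).symm
  | some i => f.hom.f i

theorem Xq_XMapC {M N : MixedComplex C} (f : M ⟶ N) (n : ℕ) : ∀ x : Option (Fin n),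
    Xq M n x ≫ XMapC f n x = f.hom.f (Xdeg x) ≫ Xq N n x
  | none => cokernel.π_desc (M.cx.d (n + 1) n) (f.hom.f n ≫ cokernel.π (N.cx.d (n + 1) n)) _
  | some _ => (Category.id_comp _).trans (Category.comp_id _).symm

variable [HasFiniteBiproducts C]

/-- The supercomplex `X^n M = M_n / b M_{n+1} ⊕ ⨁_{i < n} M_i` with its even-odd grading and the
differential induced by `b + B`. -/
def XCx (M : MixedComplex C) (n : ℕ) : SupComplex C where
  X i := ⨁ fun x : XIdx n i => XObj M n x.1
  d i j := biproduct.matrix fun (x : XIdx n i) (y : XIdx n j) => XD M n x.1 y.1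
  shape i j h := by
    refine biproduct.hom_ext' _ _ fun x => biproduct.hom_ext _ _ fun y => ?_
    have : XD M n x.1 y.1 = 0 := XD_zero M n _ _ (by rw [x.2, y.2]; exact h)
    simp [this]
  d_comp_d' i j k hij hjk := by
    refine biproduct.hom_ext' _ _ fun x => biproduct.hom_ext _ _ fun z => ?_
    have h := XD_XD M n x.1 z.1
    rw [← sum_XIdx n j _ fun y hy => by
      rw [XD_zero M n x.1 y (by rw [x.2]; intro h; exact hy (h.symm.trans hij)), zero_comp]] at h
    simpa [biproduct.lift_desc] using h

theorem MixedComplex.E_map {M N : MixedComplex C} (f : M ⟶ N) (i j : ℕ) :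
    M.E i j ≫ f.hom.f j = f.hom.f i ≫ N.E i j := by
  simp only [MixedComplex.E, Preadditive.add_comp, Preadditive.comp_add, f.comm, f.hom.comm]

theorem XMapC_XD {M N : MixedComplex C} (f : M ⟶ N) (n : ℕ) (x y : Option (Fin n)) :
    XMapC f n x ≫ XD N n x y = XD M n x y ≫ XMapC f n y := by
  rw [← cancel_epi (Xq M n x), ← Category.assoc, Xq_XMapC, Category.assoc, Xq_XD,
    ← Category.assoc, ← MixedComplex.E_map, Category.assoc, ← Xq_XMapC, ← Category.assoc,
    ← Xq_XD, Category.assoc]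

/-- The functor `M ↦ X^n M`. -/
def XFunctor (n : ℕ) : MixedComplex C ⥤ SupComplex C where
  obj M := XCx M n
  map {M N} f :=
    { f := fun i => biproduct.map fun x : XIdx n i => XMapC f n x.1
      comm' := fun i j _ => by
        change biproduct.map _ ≫ biproduct.matrix _ = biproduct.matrix _ ≫ biproduct.map _
        rw [biproduct.map_matrix, biproduct.matrix_map]
        simp only [XMapC_XD] }
  map_id M := by
    ext i
    refine biproduct.hom_ext' _ _ fun x => ?_
    have : XMapC (𝟙 M) n x.1 = 𝟙 _ := by
      rw [← cancel_epi (Xq M n x.1), Xq_XMapC]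
      simp
    simp [this, XCx]
  map_comp {M N P} f g := by
    ext i
    refine biproduct.hom_ext' _ _ fun x => ?_
    have : XMapC (f ≫ g) n x.1 = XMapC f n x.1 ≫ XMapC g n x.1 := by
      rw [← cancel_epi (Xq M n x.1), Xq_XMapC, ← Category.assoc, Xq_XMapC, Category.assoc,
        Xq_XMapC]
      simp
    change biproduct.ι (fun x : XIdx n i => XObj M n x.1) x ≫
        biproduct.map (fun x : XIdx n i => XMapC (f ≫ g) n x.1) =
      biproduct.ι (fun x : XIdx n i => XObj M n x.1) x ≫
        biproduct.map (fun x : XIdx n i => XMapC f n x.1) ≫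
        biproduct.map (fun x : XIdx n i => XMapC g n x.1)
    rw [biproduct.ι_map, biproduct.ι_map_assoc, biproduct.ι_map, this, Category.assoc]

/-- The identity `M_i ⟶ M_j` for `i = j`, and zero for `i ≠ j`. -/
def MixedComplex.delta (M : MixedComplex C) (i j : ℕ) : M.cx.X i ⟶ M.cx.X j :=
  if h : i = j then eqToHom (by rw [h]) else 0

/-- The components of the projection `X^{n+1} M ⟶ X^n M`: zero on `M_{n+1} / b M_{n+2}`, the
quotient map `M_n ⟶ M_n / b M_{n+1}`, and the identity on `M_i` for `i < n`. -/
def XTrC (M : MixedComplex C) (n : ℕ) (x : Option (Fin (n + 1))) (y : Option (Fin n)) :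
    XObj M (n + 1) x ⟶ XObj M n y :=
  match x with
  | none => 0
  | some i => M.delta i (Xdeg y) ≫ Xq M n y

theorem MixedComplex.delta_ne (M : MixedComplex C) {i j : ℕ} (h : i ≠ j) : M.delta i j = 0 :=
  dif_neg h

theorem MixedComplex.delta_self (M : MixedComplex C) (i : ℕ) : M.delta i i = 𝟙 _ := by
  rw [MixedComplex.delta, dif_pos rfl, eqToHom_refl]

theorem Xq_XTrC (M : MixedComplex C) (n : ℕ) : ∀ (x : Option (Fin (n + 1))) (y : Option (Fin n)),
    Xq M (n + 1) x ≫ XTrC M n x y = M.delta (Xdeg x) (Xdeg y) ≫ Xq M n y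
  | none, y => by
    have h : Xdeg (none : Option (Fin (n + 1))) ≠ Xdeg y := by
      have := Xdeg_le y
      simp only [Xdeg] at *
      omega
    rw [M.delta_ne h, zero_comp]
    exact comp_zero
  | some _, _ => Category.id_comp _

theorem XTrC_zero (M : MixedComplex C) (n : ℕ) (x : Option (Fin (n + 1))) (y : Option (Fin n))
    (h : (Xdeg x : ZMod 2) ≠ Xdeg y) : XTrC M n x y = 0 := by
  have : Xdeg x ≠ Xdeg y := fun h' => h (by rw [h'])
  rw [← cancel_epi (Xq M (n + 1) x), Xq_XTrC, M.delta_ne this, zero_comp, comp_zero]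

theorem XTrC_XD (M : MixedComplex C) (n : ℕ) (x : Option (Fin (n + 1))) (z : Option (Fin n)) :
    ∑ y, XTrC M n x y ≫ XD M n y z = ∑ y, XD M (n + 1) x y ≫ XTrC M n y z := by
  rw [← cancel_epi (Xq M (n + 1) x), Preadditive.comp_sum, Preadditive.comp_sum]
  have e1 : ∀ y, Xq M (n + 1) x ≫ XTrC M n x y ≫ XD M n y z =
      M.delta (Xdeg x) (Xdeg y) ≫ M.E (Xdeg y) (Xdeg z) ≫ Xq M n z := fun y => by
    rw [← Category.assoc, Xq_XTrC, Category.assoc, Xq_XD]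
  have e2 : ∀ y, Xq M (n + 1) x ≫ XD M (n + 1) x y ≫ XTrC M n y z =
      M.E (Xdeg x) (Xdeg y) ≫ M.delta (Xdeg y) (Xdeg z) ≫ Xq M n z := fun y => by
    rw [← Category.assoc, Xq_XD, Category.assoc, Xq_XTrC]
  simp only [e1, e2]
  rw [sum_Xdeg n fun k => M.delta (Xdeg x) k ≫ M.E k (Xdeg z) ≫ Xq M n z,
    sum_Xdeg (n + 1) fun k => M.E (Xdeg x) k ≫ M.delta k (Xdeg z) ≫ Xq M n z]
  have hz := Xdeg_le z
  have hx := Xdeg_le x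
  rw [Finset.sum_eq_single (s := Finset.range (n + 1 + 1)) (Xdeg z)
    (fun k _ hk => by rw [M.delta_ne hk, zero_comp, comp_zero])
    (fun h => absurd (Finset.mem_range.mpr (by omega)) h), M.delta_self, Category.id_comp]
  by_cases hx' : Xdeg x ≤ n
  · rw [Finset.sum_eq_single (Xdeg x)
      (fun k _ hk => by rw [M.delta_ne hk.symm, zero_comp])
      (fun h => absurd (Finset.mem_range.mpr (by omega)) h), M.delta_self, Category.id_comp]
  · have hx'' : Xdeg x = n + 1 := by omega
    rw [Finset.sum_eq_zero fun k hk => by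
      rw [M.delta_ne (by have := Finset.mem_range.mp hk; omega), zero_comp], hx'', E_Xq]

theorem XTrC_map {M N : MixedComplex C} (f : M ⟶ N) (n : ℕ) (x : Option (Fin (n + 1)))
    (y : Option (Fin n)) :
    XMapC f (n + 1) x ≫ XTrC N n x y = XTrC M n x y ≫ XMapC f n y := by
  have h : ∀ i j, M.delta i j ≫ f.hom.f j = f.hom.f i ≫ N.delta i j := by
    intro i j
    by_cases h : i = j
    · subst h; rw [M.delta_self, N.delta_self, Category.id_comp, Category.comp_id]
    · rw [M.delta_ne h, N.delta_ne h, zero_comp, comp_zero]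
  rw [← cancel_epi (Xq M (n + 1) x), ← Category.assoc, Xq_XMapC, Category.assoc, Xq_XTrC,
    ← Category.assoc, ← h, Category.assoc, ← Xq_XMapC, ← Category.assoc, ← Xq_XTrC,
    Category.assoc]

/-- The projection `X^{n+1} M ⟶ X^n M`. -/
def XTr (n : ℕ) : XFunctor (C := C) (n + 1) ⟶ XFunctor n where
  app M :=
    { f := fun i => biproduct.matrix fun (x : XIdx (n + 1) i) (y : XIdx n i) => XTrC M n x.1 y.1
      comm' := fun i j hij => by
        refine biproduct.hom_ext' _ _ fun x => biproduct.hom_ext _ _ fun z => ?_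
        have h := XTrC_XD M n x.1 z.1
        rw [← sum_XIdx n i _ fun y hy => by
            rw [XTrC_zero M n x.1 y (by rw [x.2]; exact fun h => hy h.symm), zero_comp],
          ← sum_XIdx (n + 1) j _ fun y hy => by
            rw [XD_zero M (n + 1) x.1 y (by rw [x.2]; intro h; exact hy (h.symm.trans hij)),
              zero_comp]] at h
        simpa [biproduct.lift_desc, XFunctor, XCx] using h }
  naturality M N f := by
    ext i
    change biproduct.map (fun x : XIdx (n + 1) i => XMapC f (n + 1) x.1) ≫
        biproduct.matrix (fun (x : XIdx (n + 1) i) (y : XIdx n i) => XTrC N n x.1 y.1) =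
      biproduct.matrix (fun (x : XIdx (n + 1) i) (y : XIdx n i) => XTrC M n x.1 y.1) ≫
        biproduct.map (fun y : XIdx n i => XMapC f n y.1)
    rw [biproduct.map_matrix, biproduct.matrix_map]
    simp only [XTrC_map]

/-- The inverse system `⋯ ⟶ X³ ⟶ X² ⟶ X¹`. -/
def XTower : ℕᵒᵖ ⥤ MixedComplex C ⥤ SupComplex C :=
  Functor.ofOpSequence (X := fun n => XFunctor (C := C) (n + 1)) fun n => XTr (n + 1)

end Tower

section Pro

variable {C : Type u} [Category.{v} C] [Preadditive C]

/-- A map is a cofibration if every map from its source to a basic object extends to its target. -/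
def IsCof (ℑ : ObjectProperty C) {X Y : C} (i : X ⟶ Y) : Prop :=
  ∀ I, ℑ I → ∀ g : X ⟶ I, ∃ h : Y ⟶ I, i ≫ h = g

/-- An object is relatively injective if maps to it extend along all cofibrations. -/
def RelInj (ℑ : ObjectProperty C) (V : C) : Prop :=
  ∀ ⦃X Y : C⦄ (i : X ⟶ Y), IsCof ℑ i → ∀ g : X ⟶ V, ∃ h : Y ⟶ V, i ≫ h = g

/-- The group `colim_m hom(X_m, V)` of pro-maps from a pro-object `X` to a constant object `V`. -/
def proHom (X : ℕᵒᵖ ⥤ C) (V : C) : AddCommGrpCat.{v} :=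
  colimit (X.rightOp ⋙ preadditiveYoneda.obj V)

/-- Precomposition with a map of pro-objects. -/
def proHomMap {X X' : ℕᵒᵖ ⥤ C} (f : X ⟶ X') (V : C) : proHom X' V ⟶ proHom X V :=
  colimMap (Functor.whiskerRight (NatTrans.rightOp f) (preadditiveYoneda.obj V))

/-- Cofibrations of pro-objects, where the basic pro-objects are the constant relatively
injective objects. -/
def IsProCof (ℑ : ObjectProperty C) {X X' : ℕᵒᵖ ⥤ C} (f : X ⟶ X') : Prop :=
  ∀ V, RelInj ℑ V → Function.Surjective (proHomMap f V)

/-- The homogeneous maps of degree `i` between two `ℤ/2`-graded objects: families of maps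
`X_p ⟶ Y_q` for the pairs `(p, q)` with `p + i = q`. -/
abbrev GradedHom (X Y : SupComplex C) (i : ZMod 2) : Type v :=
  ∀ s : {s : ZMod 2 × ZMod 2 // s.1 + i = s.2}, X.X s.1.1 ⟶ Y.X s.1.2

/-- The operator `f ↦ d f - (-1)^{|f|} f d` on homogeneous maps of degree `i`. -/
def gradedD (X Y : SupComplex C) (i j : ZMod 2) (h : i + 1 = j) :
    GradedHom X Y i →+ GradedHom X Y j :=
  AddMonoidHom.mk' (fun f s => f ⟨(s.1.1, s.1.1 + i), rfl⟩ ≫ Y.d (s.1.1 + i) s.1.2 -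
      (-1 : ℤ) ^ i.val • (X.d s.1.1 (s.1.1 + 1) ≫
        f ⟨(s.1.1 + 1, s.1.2), by
          have := s.2
          subst h
          exact (by ring : s.1.1 + 1 + i = s.1.1 + (i + 1)).trans this⟩))
    fun f g => by
      funext s
      simp only [Pi.add_apply, Preadditive.add_comp, Preadditive.comp_add, smul_add]
      abel

theorem gradedD_apply (X Y : SupComplex C) (i j : ZMod 2) (h : i + 1 = j) (f : GradedHom X Y i)
    (p r q : ZMod 2) (hs : p + j = q) (hr : p + i = r) (hq : p + 1 + i = q) :
    gradedD X Y i j h f ⟨(p, q), hs⟩ = f ⟨(p, r), hr⟩ ≫ Y.d r q -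
      (-1 : ℤ) ^ i.val • (X.d p (p + 1) ≫ f ⟨(p + 1, q), hq⟩) := by
  subst hr
  rfl

theorem gradedD_gradedD (X Y : SupComplex C) (i j k : ZMod 2) (h : i + 1 = j) (h' : j + 1 = k)
    (f : GradedHom X Y i) : gradedD X Y j k h' (gradedD X Y i j h f) = 0 := by
  funext ⟨⟨p, q⟩, hs⟩
  have h2 : (1 : ZMod 2) + 1 = 0 := rfl
  change p + k = q at hs
  have hq : p + 1 + j = q := by rw [← hs, ← h']; ring
  have hsgn : ((-1 : ℤ) ^ j.val) = - (-1 : ℤ) ^ i.val := by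
    have : ∀ i : ZMod 2, ((-1 : ℤ) ^ (i + 1).val) = - (-1 : ℤ) ^ i.val := by decide
    rw [← h, this]
  have hq' : p + 1 + 1 + i = q := by rw [← hs, ← h', ← h]; ring
  rw [gradedD_apply X Y j k h' _ p (p + j) q hs rfl hq,
    gradedD_apply X Y i j h f p (p + i) (p + j) rfl rfl (by rw [← h]; ring),
    gradedD_apply X Y i j h f (p + 1) (p + j) q hq (by rw [← h]; ring) hq']
  simp [hsgn]

/-- The supercomplex `Hom_{ℤ/2}(X, Y)` of homogeneous maps. -/
def supHom (X Y : SupComplex C) : SupComplex AddCommGrpCat.{v} where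
  X i := AddCommGrpCat.of (GradedHom X Y i)
  d i j := if h : i + 1 = j then AddCommGrpCat.ofHom (gradedD X Y i j h) else 0
  shape i j h := dif_neg h
  d_comp_d' i j k hij hjk := by
    change i + 1 = j at hij
    change j + 1 = k at hjk
    rw [dif_pos hij, dif_pos hjk]
    refine AddCommGrpCat.hom_ext (AddMonoidHom.ext fun f => ?_)
    exact gradedD_gradedD X Y i j k hij hjk f

/-- Precomposition of homogeneous maps with a map of supercomplexes. -/
def gradedPre {X X' : SupComplex C} (f : X ⟶ X') (Y : SupComplex C) (i : ZMod 2) :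
    GradedHom X' Y i →+ GradedHom X Y i :=
  AddMonoidHom.mk' (fun g s => f.f s.1.1 ≫ g s) fun g g' => by
    funext s
    exact Preadditive.comp_add _ _ _ _ _ _

theorem gradedPre_gradedD {X X' : SupComplex C} (f : X ⟶ X') (Y : SupComplex C) (i j : ZMod 2)
    (h : i + 1 = j) (g : GradedHom X' Y i) :
    gradedD X Y i j h (gradedPre f Y i g) = gradedPre f Y j (gradedD X' Y i j h g) := by
  funext s
  simp [gradedPre, gradedD]

/-- Precomposition with a map of supercomplexes. -/
def supHomMap {X X' : SupComplex C} (f : X ⟶ X') (Y : SupComplex C) : supHom X' Y ⟶ supHom X Y where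
  f i := AddCommGrpCat.ofHom (gradedPre f Y i)
  comm' i j h := by
    change i + 1 = j at h
    dsimp only [supHom]
    rw [dif_pos h, dif_pos h]
    refine AddCommGrpCat.hom_ext (AddMonoidHom.ext fun g => ?_)
    exact gradedPre_gradedD f Y i j h g

/-- The functor `X ↦ Hom_{ℤ/2}(X, Y)`. -/
def supHomFunctor (Y : SupComplex C) : (SupComplex C)ᵒᵖ ⥤ SupComplex AddCommGrpCat.{v} where
  obj X := supHom X.unop Y
  map f := supHomMap f.unop Y
  map_id X := by
    ext i : 1
    refine AddCommGrpCat.hom_ext (AddMonoidHom.ext fun g => ?_)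
    exact funext fun s => Category.id_comp _
  map_comp f g := by
    ext i : 1
    refine AddCommGrpCat.hom_ext (AddMonoidHom.ext fun g => ?_)
    exact funext fun s => Category.assoc _ _ _

/-- The supercomplex `Hom_{ℤ/2}(X, Y) = colim_m Hom_{ℤ/2}(X_m, Y)` for a pro-supercomplex `X` and a
constant supercomplex `Y`. -/
def proSupHom (X : ℕᵒᵖ ⥤ SupComplex C) (Y : SupComplex C) : SupComplex AddCommGrpCat.{v} :=
  colimit (X.rightOp ⋙ supHomFunctor Y)

/-- Precomposition with a map of pro-supercomplexes. -/
def proSupHomMap {X X' : ℕᵒᵖ ⥤ SupComplex C} (f : X ⟶ X') (Y : SupComplex C) :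
    proSupHom X' Y ⟶ proSupHom X Y :=
  colimMap (Functor.whiskerRight (NatTrans.rightOp f) (supHomFunctor Y))

/-- Weak equivalences of pro-supercomplexes. -/
def IsProWeakEquiv (ℑ : ObjectProperty C) {X X' : ℕᵒᵖ ⥤ SupComplex C} (f : X ⟶ X') : Prop :=
  ∀ Y : SupComplex C, (∀ i, RelInj ℑ (Y.X i)) → QuasiIso (proSupHomMap f Y)

end Pro

section Xinfty

variable {C : Type u} [Category.{v} C] [MonoidalCategory C] [SymmetricCategory C]
  [Preadditive C] [MonoidalPreadditive C] [HasCokernels C] [HasFiniteBiproducts C]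

/-- The pro-supercomplex `X^∞(A)` of a pro-algebra `A`. Inverse systems are indexed from `0`, so
that its level `n` is `X^{n+1}(Ω A_n)`. -/
def Xinf : (ℕᵒᵖ ⥤ Alg C) ⥤ (ℕᵒᵖ ⥤ SupComplex C) where
  obj A :=
    { obj := fun n => (XTower.obj n).obj (OmegaFunctor.obj (A.obj n))
      map := fun {m n} φ => (XTower.map φ).app (OmegaFunctor.obj (A.obj m)) ≫
        (XTower.obj n).map (OmegaFunctor.map (A.map φ))
      map_id := fun n => by simp
      map_comp := fun {m n k} φ ψ => by simp }
  map f :=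
    { app := fun n => (XTower.obj n).map (OmegaFunctor.map (f.app n))
      naturality := fun {m n} φ => by
        dsimp only
        rw [Category.assoc, ← Functor.map_comp, ← Functor.map_comp, f.naturality,
          Functor.map_comp, Functor.map_comp, NatTrans.naturality_assoc] }
  map_id A := by ext n : 2; simp
  map_comp f g := by ext n : 2; simp

end Xinfty

section Filtrations

variable {C : Type u} [Category.{v} C] [MonoidalCategory C]

variable (C) in
/-- The tensor product preserves cokernels in each variable. -/
class TensorPreservesCokernels [Preadditive C] : Prop where
  left : ∀ (V : C) {X Y : C} (f : X ⟶ Y), PreservesColimit (parallelPair f 0) (tensorLeft V)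
  right : ∀ (V : C) {X Y : C} (f : X ⟶ Y), PreservesColimit (parallelPair f 0) (tensorRight V)

/-- A multiplicative filtration of a pro-algebra `A` by subobjects `F i m` of the levels `A_m`,
compatible with the transfer maps of `A`. -/
structure MultFiltration (A : ℕᵒᵖ ⥤ Alg C) where
  F : ℕ → ∀ m : ℕᵒᵖ, Subobject (A.obj m).X
  zero : ∀ m, F 0 m = ⊤
  anti : ∀ i m, F (i + 1) m ≤ F i m
  mul : ∀ i j m, (F (i + j) m).Factors (((F i m).arrow ⊗ₘ (F j m).arrow) ≫ (A.obj m).mul)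
  compat : ∀ i {m n : ℕᵒᵖ} (φ : m ⟶ n), (F i n).Factors ((F i m).arrow ≫ (A.map φ).hom)

namespace MultFiltration

variable {A : ℕᵒᵖ ⥤ Alg C} (F : MultFiltration A)

/-- The pro-object `F_i A = {F_i A_m}_m`. -/
def pro (i : ℕ) : ℕᵒᵖ ⥤ C where
  obj m := (F.F i m : C)
  map {m n} φ := (F.F i n).factorThru ((F.F i m).arrow ≫ (A.map φ).hom) (F.compat i φ)
  map_id m := by
    rw [← cancel_mono (F.F i m).arrow]
    simp
  map_comp {m n k} φ ψ := by
    rw [← cancel_mono (F.F i k).arrow]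
    simp

/-- The inclusion of `F_{i+1} A` into `F_i A`. -/
def incl (i : ℕ) : F.pro (i + 1) ⟶ F.pro i where
  app m := Subobject.ofLE _ _ (F.anti i m)
  naturality m n φ := by
    refine (cancel_mono (F.F i n).arrow).mp ?_
    change ((F.F (i + 1) n).factorThru _ (F.compat (i + 1) φ) ≫ Subobject.ofLE _ _ _) ≫ (F.F i n).arrow =
      (Subobject.ofLE _ _ _ ≫ (F.F i n).factorThru _ (F.compat i φ)) ≫ (F.F i n).arrow
    simp

variable [Preadditive C] [MonoidalPreadditive C] [HasCokernels C] [TensorPreservesCokernels C]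

theorem tensor_cokernel_left (V : C) {X Y Z : C} (f : X ⟶ Y) (g : V ⊗ Y ⟶ Z) (w : V ◁ f ≫ g = 0) :
    ∃ h : V ⊗ cokernel f ⟶ Z, V ◁ cokernel.π f ≫ h = g := by
  have := TensorPreservesCokernels.left V f
  have hc := CokernelCofork.mapIsColimit _ (cokernelIsCokernel f) (tensorLeft V)
  exact ⟨hc.desc (CokernelCofork.ofπ g w), hc.fac _ WalkingParallelPair.one⟩

instance tensor_cokernel_left_epi (V : C) {X Y : C} (f : X ⟶ Y) : Epi (V ◁ cokernel.π f) := by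
  have := TensorPreservesCokernels.left V f
  have hc := CokernelCofork.mapIsColimit _ (cokernelIsCokernel f) (tensorLeft V)
  exact ⟨fun _ _ h => Cofork.IsColimit.hom_ext hc h⟩

theorem tensor_cokernel_right (V : C) {X Y Z : C} (f : X ⟶ Y) (g : Y ⊗ V ⟶ Z) (w : f ▷ V ≫ g = 0) :
    ∃ h : cokernel f ⊗ V ⟶ Z, cokernel.π f ▷ V ≫ h = g := by
  have := TensorPreservesCokernels.right V f
  have hc := CokernelCofork.mapIsColimit _ (cokernelIsCokernel f) (tensorRight V)
  exact ⟨hc.desc (CokernelCofork.ofπ g w), hc.fac _ WalkingParallelPair.one⟩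

instance tensor_cokernel_right_epi (V : C) {X Y : C} (f : X ⟶ Y) : Epi (cokernel.π f ▷ V) := by
  have := TensorPreservesCokernels.right V f
  have hc := CokernelCofork.mapIsColimit _ (cokernelIsCokernel f) (tensorRight V)
  exact ⟨fun _ _ h => Cofork.IsColimit.hom_ext hc h⟩

theorem tensor_cokernel_mid_epi (V W : C) {X Y : C} (f : X ⟶ Y) :
    Epi ((V ◁ cokernel.π f) ▷ W) := by
  have := TensorPreservesCokernels.left V f
  have := TensorPreservesCokernels.right W ((tensorLeft V).map f)
  have hc := CokernelCofork.mapIsColimit _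
    (CokernelCofork.mapIsColimit _ (cokernelIsCokernel f) (tensorLeft V)) (tensorRight W)
  exact ⟨fun _ _ h => Cofork.IsColimit.hom_ext hc h⟩

theorem tensor_cokernel_right_right_epi (V W : C) {X Y : C} (f : X ⟶ Y) :
    Epi ((cokernel.π f ▷ V) ▷ W) := by
  have : (cokernel.π f ▷ V) ▷ W = (α_ _ _ _).hom ≫ cokernel.π f ▷ (V ⊗ W) ≫ (α_ _ _ _).inv := by
    simp
  rw [this]
  infer_instance

/-- The underlying object of `A_m / F_1 A_m`. -/
abbrev quotX (m : ℕᵒᵖ) : C := cokernel (F.F 1 m).arrow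

abbrev quotπ (m : ℕᵒᵖ) : (A.obj m).X ⟶ F.quotX m := cokernel.π (F.F 1 m).arrow

theorem factors_quotπ (m : ℕᵒᵖ) {Z : C} (g : Z ⟶ (A.obj m).X) (h : (F.F 1 m).Factors g) :
    g ≫ F.quotπ m = 0 := by
  rw [← (F.F 1 m).factorThru_arrow g h, Category.assoc, cokernel.condition, comp_zero]

theorem ideal_left (m : ℕᵒᵖ) :
    ((A.obj m).X ◁ (F.F 1 m).arrow ≫ (A.obj m).mul) ≫ F.quotπ m = 0 := by
  have h := F.factors_quotπ m _ (F.mul 0 1 m)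
  have : IsIso (F.F 0 m).arrow := by rw [F.zero]; infer_instance
  rw [MonoidalCategory.tensorHom_def, Category.assoc, Category.assoc] at h
  rw [Category.assoc, ← cancel_epi ((F.F 0 m).arrow ▷ _), h, comp_zero]

theorem ideal_right (m : ℕᵒᵖ) :
    ((F.F 1 m).arrow ▷ (A.obj m).X ≫ (A.obj m).mul) ≫ F.quotπ m = 0 := by
  have h := F.factors_quotπ m _ (F.mul 1 0 m)
  have : IsIso (F.F 0 m).arrow := by rw [F.zero]; infer_instance
  rw [MonoidalCategory.tensorHom_def', Category.assoc, Category.assoc] at h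
  rw [Category.assoc, ← cancel_epi (_ ◁ (F.F 0 m).arrow), h, comp_zero]

theorem exists_quotMul (m : ℕᵒᵖ) : ∃ μ : F.quotX m ⊗ F.quotX m ⟶ F.quotX m,
    (A.obj m).mul ≫ F.quotπ m = (F.quotπ m ⊗ₘ F.quotπ m) ≫ μ := by
  obtain ⟨μ', h'⟩ := tensor_cokernel_left (A.obj m).X (F.F 1 m).arrow
    ((A.obj m).mul ≫ F.quotπ m) (by rw [← Category.assoc, ideal_left])
  obtain ⟨μ, h⟩ := tensor_cokernel_right (F.quotX m) (F.F 1 m).arrow μ' (by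
    rw [← cancel_epi (_ ◁ cokernel.π (F.F 1 m).arrow), whisker_exchange_assoc, h', comp_zero,
      ← Category.assoc, ideal_right])
  exact ⟨μ, by rw [MonoidalCategory.tensorHom_def', Category.assoc, h, h']⟩

/-- The multiplication of `A_m / F_1 A_m`: the unique map that makes the projection from `A_m`
multiplicative. -/
def quotMul (m : ℕᵒᵖ) : F.quotX m ⊗ F.quotX m ⟶ F.quotX m := (F.exists_quotMul m).choose

theorem mul_quotπ (m : ℕᵒᵖ) :
    (A.obj m).mul ≫ F.quotπ m = (F.quotπ m ⊗ₘ F.quotπ m) ≫ F.quotMul m :=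
  (F.exists_quotMul m).choose_spec

instance quotπ_tensor_epi (m : ℕᵒᵖ) : Epi (F.quotπ m ⊗ₘ F.quotπ m) := by
  rw [MonoidalCategory.tensorHom_def]
  infer_instance

instance quotπ_tensor_epi' (m : ℕᵒᵖ) : Epi ((F.quotπ m ⊗ₘ F.quotπ m) ⊗ₘ F.quotπ m) := by
  rw [MonoidalCategory.tensorHom_def, MonoidalCategory.tensorHom_def, comp_whiskerRight]
  have := tensor_cokernel_mid_epi (F.quotX m) (A.obj m).X (F.F 1 m).arrow
  have := tensor_cokernel_right_right_epi (A.obj m).X (A.obj m).X (F.F 1 m).arrow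
  infer_instance

/-- The algebra `A_m / F_1 A_m`. -/
def quotAlg (m : ℕᵒᵖ) : Alg C where
  X := F.quotX m
  mul := F.quotMul m
  mul_assoc := by
    rw [← cancel_epi ((F.quotπ m ⊗ₘ F.quotπ m) ⊗ₘ F.quotπ m)]
    have h1 : ((F.quotπ m ⊗ₘ F.quotπ m) ⊗ₘ F.quotπ m) ≫ F.quotMul m ▷ F.quotX m =
        (A.obj m).mul ▷ (A.obj m).X ≫ (F.quotπ m ⊗ₘ F.quotπ m) := by
      rw [← tensorHom_id, tensorHom_comp_tensorHom, ← mul_quotπ, Category.comp_id,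
        ← tensorHom_id, tensorHom_comp_tensorHom, Category.id_comp]
    have h2 : (F.quotπ m ⊗ₘ (F.quotπ m ⊗ₘ F.quotπ m)) ≫ F.quotX m ◁ F.quotMul m =
        (A.obj m).X ◁ (A.obj m).mul ≫ (F.quotπ m ⊗ₘ F.quotπ m) := by
      rw [← id_tensorHom, tensorHom_comp_tensorHom, ← mul_quotπ, Category.comp_id,
        ← id_tensorHom, tensorHom_comp_tensorHom, Category.id_comp]
    rw [reassoc_of% h1, ← mul_quotπ, associator_naturality_assoc, reassoc_of% h2, ← mul_quotπ,
      ← Category.assoc, (A.obj m).mul_assoc, Category.assoc, Category.assoc]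

/-- The projection from `A_m` to `A_m / F_1 A_m`. -/
def quotHom (m : ℕᵒᵖ) : A.obj m ⟶ F.quotAlg m where
  hom := F.quotπ m
  map_mul := F.mul_quotπ m

instance quotHom_epi (m : ℕᵒᵖ) : Epi (F.quotHom m) where
  left_cancellation f g h := Alg.hom_ext _ _ <| by
    exact (cancel_epi (F.quotπ m)).mp (congrArg Alg.Hom.hom h)

theorem exists_quotTr {m n : ℕᵒᵖ} (φ : m ⟶ n) :
    ∃ ψ : F.quotAlg m ⟶ F.quotAlg n, F.quotHom m ≫ ψ = A.map φ ≫ F.quotHom n := by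
  let ψ : F.quotX m ⟶ F.quotX n := cokernel.desc _ ((A.map φ).hom ≫ F.quotπ n) (by
    rw [← Category.assoc, F.factors_quotπ n _ (F.compat 1 φ)])
  have hψ : F.quotπ m ≫ ψ = (A.map φ).hom ≫ F.quotπ n := cokernel.π_desc _ _ _
  refine ⟨⟨ψ, ?_⟩, Alg.hom_ext _ _ hψ⟩
  change F.quotMul m ≫ ψ = (ψ ⊗ₘ ψ) ≫ F.quotMul n
  rw [← cancel_epi (F.quotπ m ⊗ₘ F.quotπ m), ← Category.assoc, ← mul_quotπ, Category.assoc, hψ,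
    ← Category.assoc, (A.map φ).map_mul, Category.assoc, mul_quotπ, tensorHom_comp_tensorHom_assoc,
    tensorHom_comp_tensorHom_assoc, hψ]

/-- The transfer maps of `A / F_1 A`: the unique maps that are compatible with those of `A`. -/
def quotTr {m n : ℕᵒᵖ} (φ : m ⟶ n) : F.quotAlg m ⟶ F.quotAlg n := (F.exists_quotTr φ).choose

theorem quotHom_quotTr {m n : ℕᵒᵖ} (φ : m ⟶ n) :
    F.quotHom m ≫ F.quotTr φ = A.map φ ≫ F.quotHom n :=
  (F.exists_quotTr φ).choose_spec

/-- The pro-algebra `A / F_1 A`. -/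
def quotient : ℕᵒᵖ ⥤ Alg C where
  obj m := F.quotAlg m
  map φ := F.quotTr φ
  map_id m := by
    rw [← cancel_epi (F.quotHom m), quotHom_quotTr, A.map_id, Category.id_comp, Category.comp_id]
  map_comp φ ψ := by
    rw [← cancel_epi (F.quotHom _), quotHom_quotTr, ← Category.assoc, quotHom_quotTr,
      Category.assoc, quotHom_quotTr, A.map_comp, Category.assoc]

/-- The projection from `A` to `A / F_1 A`. -/
def quotientMap : A ⟶ F.quotient where
  app m := F.quotHom m
  naturality _ _ φ := (F.quotHom_quotTr φ).symm

end MultFiltration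

end Filtrations

end ProCyclic

end

open ProCyclic

universe v u

/-! The method is Goodwillie's: a derivation that multiplies by the weight acts on cyclic cochains
null-homotopically, by Cartan's formula, and yet as an invertible number in each positive weight; so
everything of positive weight is acyclic.

Fix the target Y. A cochain is a sequence of maps from the terms of ΩA_m to the total object of Y.
It has filtration p if it vanishes on all tensors of total weight p. The filtration of A_m is finite
and a cochain on X^n only involves finitely many tensor powers, so every cochain has some filtration
p + 1 (`exists_mem_cochFil`). The cochains of filtration 1 are exactly those pulled back from
A_m/F_1 A_m, because ⊗ preserves cokernels (`exists_cochMap_quotHom`, and `exists_gradedPre_quotHom`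
on X^n). Hence it suffices to show that a cochain of filtration p + 1, p ≥ 1, whose coboundary has
filtration 1 can be moved into filtration p by subtracting a coboundary, at the price of passing to
a later level of the pro-algebra. This relative form gives injectivity and surjectivity on
cohomology at once (`quasiIso_colimMap`).

In place of a derivation there are weight maps D : A_{m'} → A_m, equal to i times the transfer map
on F_i modulo F_{i+1}. They are built by descending induction on i, by extension along the
cofibrations F_{i+1} → F_i (`exists_weight_aux`). Such a D obeys the Leibniz rule only up to higher
weight (`weight_leibniz`), but this is enough for Cartan's formula modulo filtration p on cochains
of filtration p + 1 (`IsWeightMap.cartan`), where the sum of all insertions of D is multiplication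
by p.

The homotopy consists of the contraction with D and a row homotopy for the cyclic groups. It leaves
an error term `offDiag` that maps the second component of a cochain to the first. Rather than
correct it, `exists_cochDiff_sub_mem` runs the formula twice: the error of the first run has no
second component, so the second run has no error. This shows that p² times the transferred cochain
is a coboundary modulo filtration p, and ℚ-linearity permits division by p².

Tensor products of subobjects need not be subobjects, so weights on tensor powers are described
through generalized elements: the tensors of weight w form an additive subfunctor of a representable
functor, generated by pure tensors of elements of the given weights. -/

noncomputable section

namespace ProCyclic

/-! ### Additive subfunctors of representable functors -/

section Subfunctors

variable {C : Type u} [Category.{v} C] [Preadditive C]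

/-- Additive subfunctors of the functor represented by `Z`. -/
structure SubRep (Z : C) where
  mem : ∀ T : C, AddSubgroup (T ⟶ Z)
  precomp : ∀ {T T' : C} (c : T' ⟶ T) {x : T ⟶ Z}, x ∈ mem T → c ≫ x ∈ mem T'

/-- Composition with `g` maps the subfunctor `S` to `S'`. -/
def SubRep.Maps {Z Z' : C} (S : SubRep Z) (g : Z ⟶ Z') (S' : SubRep Z') : Prop :=
  ∀ ⦃T : C⦄ ⦃x : T ⟶ Z⦄, x ∈ S.mem T → x ≫ g ∈ S'.mem T

/-- The zero subfunctor. -/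
def SubRep.zero (Z : C) : SubRep Z where
  mem _ := ⊥
  precomp c x hx := by
    rw [AddSubgroup.mem_bot] at hx ⊢
    rw [hx, comp_zero]

/-- The maps to `Z` that factor through a subobject. -/
def SubRep.ofSubobject {Z : C} (P : Subobject Z) : SubRep Z where
  mem T :=
    { carrier := {x | P.Factors x}
      zero_mem' := P.factors_zero
      add_mem' := fun ha hb => P.factors_add _ _ ha hb
      neg_mem' := fun {x} hx => by
        have := P.factors_of_factors_right (-𝟙 T) hx
        simpa using this }
  precomp c _ hx := P.factors_of_factors_right c hx

namespace SubRep

variable {Z Z' Z'' : C} {S : SubRep Z} {S' : SubRep Z'} {S'' : SubRep Z''}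

theorem Maps.comp {f : Z ⟶ Z'} {g : Z' ⟶ Z''} (hf : S.Maps f S') (hg : S'.Maps g S'') :
    S.Maps (f ≫ g) S'' := fun T x hx => by
  rw [← Category.assoc]
  exact hg (hf hx)

theorem maps_id (S : SubRep Z) : S.Maps (𝟙 Z) S := fun T x hx => by
  rwa [Category.comp_id]

theorem Maps.add {f g : Z ⟶ Z'} (hf : S.Maps f S') (hg : S.Maps g S') : S.Maps (f + g) S' :=
  fun T x hx => by
    rw [Preadditive.comp_add]
    exact add_mem (hf hx) (hg hx)

theorem Maps.neg {f : Z ⟶ Z'} (hf : S.Maps f S') : S.Maps (-f) S' :=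
  fun T x hx => by
    rw [Preadditive.comp_neg]
    exact neg_mem (hf hx)

theorem maps_zero : S.Maps (0 : Z ⟶ Z') S' := fun T x _ => by
  rw [comp_zero]
  exact zero_mem _

theorem Maps.zsmul {f : Z ⟶ Z'} (hf : S.Maps f S') (k : ℤ) : S.Maps (k • f) S' :=
  fun T x hx => by
    rw [Preadditive.comp_zsmul]
    exact zsmul_mem (hf hx) k

theorem Maps.sum {ι : Type*} {s : Finset ι} {f : ι → (Z ⟶ Z')}
    (hf : ∀ i ∈ s, S.Maps (f i) S') : S.Maps (∑ i ∈ s, f i) S' :=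
  fun T x hx => by
    rw [Preadditive.comp_sum]
    exact sum_mem fun i hi => hf i hi hx

theorem maps_ipow {f : Z ⟶ Z} (hf : S.Maps f S) : ∀ k, S.Maps (ipow f k) S
  | 0 => maps_id S
  | k + 1 => (maps_ipow hf k).comp hf

theorem maps_zero_iff {f : Z ⟶ Z'} :
    S.Maps f (SubRep.zero Z') ↔ ∀ ⦃T : C⦄ ⦃x : T ⟶ Z⦄, x ∈ S.mem T → x ≫ f = 0 := Iff.rfl

end SubRep

end Subfunctors

/-! ### The weight filtration on tensor powers -/

section TensorWeights

variable {C : Type u} [Category.{v} C] [MonoidalCategory C]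

/-- Elementary generalized elements of weight `w` in `X^{⊗(n+1)}`, for a filtration `P` of `X`. -/
def IsGen {X : C} (P : ℕ → Subobject X) : ∀ (n _ : ℕ) {T : C} (_ : T ⟶ tpow X n), Prop
  | 0, w, _, x => (P w).Factors x
  | n + 1, w, T, x => ∃ (T₁ T₂ : C) (c : T ⟶ T₁ ⊗ T₂) (i j : ℕ) (u : T₁ ⟶ X) (v : T₂ ⟶ tpow X n),
      i + j = w ∧ (P i).Factors u ∧ IsGen P n j v ∧ x = c ≫ (u ⊗ₘ v)

theorem IsGen.precomp {X : C} {P : ℕ → Subobject X} : ∀ {n w : ℕ} {T T' : C} (c : T' ⟶ T)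
    {x : T ⟶ tpow X n}, IsGen P n w x → IsGen P n w (c ≫ x)
  | 0, _, _, _, c, _, h => (P _).factors_of_factors_right c h
  | n + 1, w, T, T', c, x, h => by
    obtain ⟨T₁, T₂, d, i, j, a, b, hij, ha, hb, rfl⟩ := h
    exact ⟨T₁, T₂, c ≫ d, i, j, a, b, hij, ha, hb, (Category.assoc _ _ _).symm⟩

theorem IsGen.tensor {X : C} {P : ℕ → Subobject X} {n i j : ℕ} {T₁ T₂ : C} {a : T₁ ⟶ X}
    {b : T₂ ⟶ tpow X n} (ha : (P i).Factors a) (hb : IsGen P n j b) :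
    IsGen P (n + 1) (i + j) (T := T₁ ⊗ T₂) (a ⊗ₘ b : T₁ ⊗ T₂ ⟶ X ⊗ tpow X n) :=
  ⟨T₁, T₂, 𝟙 _, i, j, a, b, rfl, ha, hb, (Category.id_comp _).symm⟩

theorem IsGen.anti {X : C} {P : ℕ → Subobject X} (hP : ∀ i, P (i + 1) ≤ P i) :
    ∀ {n w : ℕ} {T : C} {x : T ⟶ tpow X n}, IsGen P n (w + 1) x → IsGen P n w x
  | 0, _, _, _, h => Subobject.factors_of_le _ (hP _) h
  | n + 1, w, T, x, h => by
    obtain ⟨T₁, T₂, d, i, j, a, b, hij, ha, hb, rfl⟩ := h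
    cases j with
    | succ j => exact ⟨T₁, T₂, d, i, j, a, b, by omega, ha, hb.anti hP, rfl⟩
    -- A tail of weight 0 cannot be lowered, so the head, which carries the whole weight, is lowered
    -- instead.
    | zero =>
      obtain rfl : i = w + 1 := by omega
      exact ⟨T₁, T₂, d, w, 0, a, b, by omega, Subobject.factors_of_le _ (hP _) ha, hb, rfl⟩

variable [Preadditive C]

/-- The generalized elements of weight `w` in `X^{⊗(n+1)}`. -/
def Fil {X : C} (P : ℕ → Subobject X) (n w : ℕ) : SubRep (tpow X n) where
  mem T := AddSubgroup.closure {x : T ⟶ tpow X n | IsGen P n w x}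
  precomp {T T'} c x hx := by
    induction hx using AddSubgroup.closure_induction with
    | mem x h => exact AddSubgroup.subset_closure (IsGen.precomp c h)
    | zero => rw [comp_zero]; exact zero_mem _
    | add x y _ _ hx hy => rw [Preadditive.comp_add]; exact add_mem hx hy
    | neg x _ hx => rw [Preadditive.comp_neg]; exact neg_mem hx

variable {X Y : C} {P : ℕ → Subobject X} {Q : ℕ → Subobject Y}

theorem IsGen.mem {n w : ℕ} {T : C} {x : T ⟶ tpow X n} (h : IsGen P n w x) :
    x ∈ (Fil P n w).mem T := AddSubgroup.subset_closure h

theorem fil_maps_of_gen {n w : ℕ} {Z : C} {g : tpow X n ⟶ Z} {S : SubRep Z}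
    (h : ∀ ⦃T : C⦄ ⦃x : T ⟶ tpow X n⦄, IsGen P n w x → x ≫ g ∈ S.mem T) : (Fil P n w).Maps g S :=
  fun T x hx => by
    induction hx using AddSubgroup.closure_induction with
    | mem x hx => exact h hx
    | zero => rw [zero_comp]; exact zero_mem _
    | add x y _ _ hx hy => rw [Preadditive.add_comp]; exact add_mem hx hy
    | neg x _ hx => rw [Preadditive.neg_comp]; exact neg_mem hx

theorem fil_maps_zero {w : ℕ} {Z : C} {g : X ⟶ Z} {S : SubRep Z}
    (h : ∀ ⦃T : C⦄ ⦃x : T ⟶ X⦄, (P w).Factors x → x ≫ g ∈ S.mem T) :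
    (Fil P 0 w).Maps (g : tpow X 0 ⟶ Z) S := fil_maps_of_gen h

/-- Pure tensors suffice as test elements: the map `c` in a generator is absorbed because `S` is
stable under precomposition. -/
theorem fil_maps_succ {n w : ℕ} {Z : C} {g : X ⊗ tpow X n ⟶ Z} {S : SubRep Z}
    (h : ∀ ⦃T₁ T₂ : C⦄ ⦃i j : ℕ⦄ ⦃a : T₁ ⟶ X⦄ ⦃b : T₂ ⟶ tpow X n⦄, i + j = w → (P i).Factors a →
      IsGen P n j b → (a ⊗ₘ b) ≫ g ∈ S.mem (T₁ ⊗ T₂)) :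
    (Fil P (n + 1) w).Maps (g : tpow X (n + 1) ⟶ Z) S := fil_maps_of_gen fun T x hx => by
  obtain ⟨T₁, T₂, c, i, j, a, b, hij, ha, hb, rfl⟩ := hx
  have := S.precomp c (h hij ha hb)
  rw [← Category.assoc] at this
  exact this

theorem fil_anti (hP : ∀ i, P (i + 1) ≤ P i) (n w : ℕ) {T : C} {x : T ⟶ tpow X n}
    (h : x ∈ (Fil P n (w + 1)).mem T) : x ∈ (Fil P n w).mem T := by
  have := fil_maps_of_gen (g := 𝟙 _) (S := Fil P n w) (fun T x (hx : IsGen P n (w + 1) x) => by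
    rw [Category.comp_id]; exact (hx.anti hP).mem) h
  rwa [Category.comp_id] at this

theorem fil_zero {w : ℕ} {T : C} {x : T ⟶ X} :
    (P w).Factors x → (x : T ⟶ tpow X 0) ∈ (Fil P 0 w).mem T := fun h => IsGen.mem (n := 0) h

variable [MonoidalPreadditive C]

theorem fil_tensor {n i j : ℕ} {T₁ T₂ : C} {a : T₁ ⟶ X} {b : T₂ ⟶ tpow X n}
    (ha : (P i).Factors a) (hb : b ∈ (Fil P n j).mem T₂) :
    (a ⊗ₘ b : T₁ ⊗ T₂ ⟶ X ⊗ tpow X n) ∈ (Fil P (n + 1) (i + j)).mem (T₁ ⊗ T₂) := by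
  induction hb using AddSubgroup.closure_induction with
  | mem x h => exact (IsGen.tensor ha h).mem
  | zero => rw [MonoidalPreadditive.tensor_zero]; exact zero_mem _
  | add x y _ _ hx hy => rw [MonoidalPreadditive.tensor_add]; exact add_mem hx hy
  | neg x _ hx =>
    have e : (a ⊗ₘ (-x)) = -(a ⊗ₘ x) := by
      rw [eq_neg_iff_add_eq_zero, ← MonoidalPreadditive.tensor_add, neg_add_cancel,
        MonoidalPreadditive.tensor_zero]
    rw [e]; exact neg_mem hx

theorem fil_tensor' {n i j w : ℕ} (hw : i + j = w) {T₁ T₂ : C} {a : T₁ ⟶ X} {b : T₂ ⟶ tpow X n}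
    (ha : (P i).Factors a) (hb : b ∈ (Fil P n j).mem T₂) :
    (a ⊗ₘ b : T₁ ⊗ T₂ ⟶ X ⊗ tpow X n) ∈ (Fil P (n + 1) w).mem (T₁ ⊗ T₂) := by
  subst hw
  exact fil_tensor ha hb

/-- Pigeonhole: if n + 1 weights add up to at least (n + 1)N, then one of them is at least N, and
that factor vanishes. -/
theorem fil_eq_zero (hP : ∀ i, P (i + 1) ≤ P i) {N : ℕ} (hN : IsZero (P N : C)) :
    ∀ {n w : ℕ} {T : C} {x : T ⟶ tpow X n}, (n + 1) * N ≤ w → IsGen P n w x → x = 0 := by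
  have hle : ∀ i, N ≤ i → ∀ {T : C} {x : T ⟶ X}, (P i).Factors x → x = 0 := by
    intro i hi T x hx
    have h1 : (P N).Factors x := Subobject.factors_of_le _ (antitone_nat_of_succ_le hP hi) hx
    rw [← (P N).factorThru_arrow x h1, hN.eq_zero_of_tgt ((P N).factorThru x h1), zero_comp]
  intro n
  induction n with
  | zero => exact fun hw hx => hle _ (by omega) hx
  | succ n ih =>
    rintro w T x hw ⟨T₁, T₂, d, i, j, a, b, hij, ha, hb, rfl⟩
    by_cases hi : N ≤ i
    · rw [hle i hi ha, MonoidalPreadditive.zero_tensor]; exact comp_zero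
    · rw [ih (by nlinarith) hb, MonoidalPreadditive.tensor_zero]; exact comp_zero

end TensorWeights

/-! ### Insertion of a map into one tensor factor: compatibility with faces and permutations -/

section Structural

variable {C : Type u} [Category.{v} C] [MonoidalCategory C]

/-- The map `f ⊗ ⋯ ⊗ D ⊗ ⋯ ⊗ f` with `D` in position `j`. -/
def dpos {X Y : C} (f D : X ⟶ Y) : ∀ (n _ : ℕ), tpow X n ⟶ tpow Y n
  | 0, _ => D
  | n + 1, 0 => D ⊗ₘ tpowMap f n
  | n + 1, j + 1 => f ⊗ₘ dpos f D n j

theorem tensor_mulHead {A B : Alg C} (f : A ⟶ B) {P Q : C} (r : P ⟶ Q) :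
    (f.hom ⊗ₘ f.hom ⊗ₘ r) ≫ (α_ B.X B.X Q).inv ≫ B.mul ▷ Q =
      ((α_ A.X A.X P).inv ≫ A.mul ▷ P) ≫ (f.hom ⊗ₘ r) := by
  rw [associator_inv_naturality_assoc, Category.assoc, tensorHom_def (f.hom ⊗ₘ f.hom),
      Category.assoc, whisker_exchange, tensorHom_def f.hom r,
      ← comp_whiskerRight_assoc, ← comp_whiskerRight_assoc, f.map_mul]

theorem dpos_two_mulHead {A B : Alg C} (f : A ⟶ B) (D : A.X ⟶ B.X) (n : ℕ) :
    dpos f.hom D (n + 2) 2 ≫ mulHead B (n + 1) = mulHead A (n + 1) ≫ dpos f.hom D (n + 1) 1 :=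
  tensor_mulHead f (dpos f.hom D n 0)

variable [SymmetricCategory C]

/-- Faces with nonzero number do not touch the first factor. Face zero is excluded; there the
Leibniz rule comes in. -/
theorem dpos_zero_face {A B : Alg C} (f : A ⟶ B) (D : A.X ⟶ B.X) : ∀ n i : ℕ, i + 1 ≤ n →
    dpos f.hom D (n + 1) 0 ≫ face B n (i + 1) = face A n (i + 1) ≫ dpos f.hom D n 0
  | 0, _, h => by omega
  | n + 1, i, _ => by
    have h := face_map f n i
    change (D ⊗ₘ tpowMap f.hom (n + 1)) ≫ B.X ◁ face B n i =
      A.X ◁ face A n i ≫ (D ⊗ₘ tpowMap f.hom n)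
    rw [tensorHom_def', tensorHom_def', Category.assoc, ← whisker_exchange,
      ← MonoidalCategory.whiskerLeft_comp_assoc, ← h, MonoidalCategory.whiskerLeft_comp_assoc]

theorem tensor_swap {X Y P Q : C} (f g : X ⟶ Y) (r : P ⟶ Q) :
    (f ⊗ₘ g ⊗ₘ r) ≫ (α_ Y Y Q).inv ≫ (β_ Y Y).hom ▷ Q ≫ (α_ Y Y Q).hom =
      ((α_ X X P).inv ≫ (β_ X X).hom ▷ P ≫ (α_ X X P).hom) ≫ (g ⊗ₘ f ⊗ₘ r) := by
  rw [associator_inv_naturality_assoc, Category.assoc, Category.assoc,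
      ← associator_naturality, tensorHom_def (f ⊗ₘ g), Category.assoc,
      whisker_exchange_assoc, ← comp_whiskerRight_assoc,
      BraidedCategory.braiding_naturality, comp_whiskerRight_assoc, tensorHom_def (g ⊗ₘ f),
      Category.assoc]

theorem dpos_zero_swapHead {X Y : C} (f D : X ⟶ Y) : ∀ n : ℕ,
    dpos f D (n + 1) 0 ≫ swapHead Y n = swapHead X n ≫ dpos f D (n + 1) 1
  | 0 => BraidedCategory.braiding_naturality D f
  | n + 1 => tensor_swap D f (tpowMap f n)

theorem dpos_swapHead {X Y : C} (f D : X ⟶ Y) (n j : ℕ) :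
    dpos f D (n + 2) (j + 2) ≫ swapHead Y (n + 1) = swapHead X (n + 1) ≫ dpos f D (n + 2) (j + 2) :=
  tensor_swap f f (dpos f D n j)

/-- The cyclic permutation moves the factor number j to place j + 1. In the induction, either D sits
in front and is moved by the exchange of the first two factors, or it sits in the tail and is moved
by the permutation of the tail, out of reach of that exchange. -/
theorem dpos_cyc {X Y : C} (f D : X ⟶ Y) : ∀ n j : ℕ, j + 1 ≤ n →
    dpos f D n j ≫ cyc Y n = cyc X n ≫ dpos f D n (j + 1)
  | 0, _, h => by omega
  | n + 1, 0, _ => by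
    have h : (D ⊗ₘ tpowMap f n) ≫ Y ◁ cyc Y n = X ◁ cyc X n ≫ (D ⊗ₘ tpowMap f n) := by
      rw [tensorHom_def', Category.assoc, ← whisker_exchange,
        ← MonoidalCategory.whiskerLeft_comp_assoc, ← cyc_map,
        MonoidalCategory.whiskerLeft_comp_assoc]
    calc dpos f D (n + 1) 0 ≫ wl Y (cyc Y n) ≫ swapHead Y n
      _ = (dpos f D (n + 1) 0 ≫ wl Y (cyc Y n)) ≫ swapHead Y n := (Category.assoc _ _ _).symm
      _ = (wl X (cyc X n) ≫ dpos f D (n + 1) 0) ≫ swapHead Y n := congrArg (· ≫ swapHead Y n) h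
      _ = wl X (cyc X n) ≫ swapHead X n ≫ dpos f D (n + 1) 1 := by
        rw [Category.assoc, dpos_zero_swapHead]
      _ = _ := (Category.assoc _ _ _).symm
  | n + 2, j + 1, hj => by
    have ih := dpos_cyc f D (n + 1) j (by omega)
    have h : (f ⊗ₘ dpos f D (n + 1) j) ≫ Y ◁ cyc Y (n + 1) =
        X ◁ cyc X (n + 1) ≫ (f ⊗ₘ dpos f D (n + 1) (j + 1)) := by
      rw [tensorHom_def', tensorHom_def', Category.assoc, ← whisker_exchange,
        ← MonoidalCategory.whiskerLeft_comp_assoc, ih, MonoidalCategory.whiskerLeft_comp_assoc]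
    calc dpos f D (n + 2) (j + 1) ≫ wl Y (cyc Y (n + 1)) ≫ swapHead Y (n + 1)
      _ = (dpos f D (n + 2) (j + 1) ≫ wl Y (cyc Y (n + 1))) ≫ swapHead Y (n + 1) :=
        (Category.assoc _ _ _).symm
      _ = (wl X (cyc X (n + 1)) ≫ dpos f D (n + 2) (j + 2)) ≫ swapHead Y (n + 1) :=
        congrArg (· ≫ swapHead Y (n + 1)) h
      _ = wl X (cyc X (n + 1)) ≫ swapHead X (n + 1) ≫ dpos f D (n + 2) (j + 2) := by
        rw [Category.assoc, dpos_swapHead]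
      _ = _ := (Category.assoc _ _ _).symm

end Structural

/-! ### Weight maps and their extension to tensor powers -/

section Filtered

variable {C : Type u} [Category.{v} C] [MonoidalCategory C]

/-- Multiplicative filtrations of an algebra. -/
structure AlgFil (A : Alg C) where
  P : ℕ → Subobject A.X
  zero : P 0 = ⊤
  anti : ∀ i, P (i + 1) ≤ P i
  mul : ∀ {i j : ℕ} {S T : C} {a : S ⟶ A.X} {b : T ⟶ A.X}, (P i).Factors a → (P j).Factors b →
    (P (i + j)).Factors ((a ⊗ₘ b) ≫ A.mul)

variable [Preadditive C]

/-- `D` multiplies elements of weight `i` by `i`, up to elements of weight `i + 1`. -/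
structure IsWeightMap {A B : Alg C} (P : AlgFil A) (Q : AlgFil B) (f : A ⟶ B) (D : A.X ⟶ B.X) :
    Prop where
  map : ∀ {i : ℕ} {T : C} {x : T ⟶ A.X}, (P.P i).Factors x → (Q.P i).Factors (x ≫ f.hom)
  weight : ∀ {i : ℕ} {T : C} {x : T ⟶ A.X}, (P.P i).Factors x →
    (Q.P (i + 1)).Factors (x ≫ D - (i : ℤ) • x ≫ f.hom)

theorem factors_add' {X Y : C} (P : Subobject Y) {f g : X ⟶ Y} (hf : P.Factors f)
    (hg : P.Factors g) : P.Factors (f + g) := P.factors_add f g hf hg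

theorem factors_zsmul {X Y : C} (P : Subobject Y) {f : X ⟶ Y} (hf : P.Factors f) (k : ℤ) :
    P.Factors (k • f) := by
  have : f ∈ (SubRep.ofSubobject P).mem X := hf
  exact zsmul_mem this k

theorem factors_sub {X Y : C} (P : Subobject Y) {f g : X ⟶ Y} (hf : P.Factors f)
    (hg : P.Factors g) : P.Factors (f - g) := by
  have h1 : f ∈ (SubRep.ofSubobject P).mem X := hf
  have h2 : g ∈ (SubRep.ofSubobject P).mem X := hg
  exact sub_mem h1 h2

theorem IsWeightMap.filtered {A B : Alg C} {P : AlgFil A} {Q : AlgFil B} {f : A ⟶ B}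
    {D : A.X ⟶ B.X} (h : IsWeightMap P Q f D) {i : ℕ} {T : C} {x : T ⟶ A.X}
    (hx : (P.P i).Factors x) : (Q.P i).Factors (x ≫ D) := by
  have h1 := factors_add' _ (Subobject.factors_of_le _ (Q.anti i) (h.weight hx))
    (factors_zsmul _ (h.map hx) i)
  rwa [sub_add_cancel] at h1

variable [MonoidalPreadditive C]

/-- Tensoring with `y` on the right, as an additive map. -/
def tensorRightHom {U V U' V' : C} (y : U' ⟶ V') : (U ⟶ V) →+ (U ⊗ U' ⟶ V ⊗ V') :=
  AddMonoidHom.mk' (fun x => x ⊗ₘ y) fun x x' => MonoidalPreadditive.add_tensor x x' y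

/-- Tensoring with `x` on the left, as an additive map. -/
def tensorLeftHom {U V U' V' : C} (x : U ⟶ V) : (U' ⟶ V') →+ (U ⊗ U' ⟶ V ⊗ V') :=
  AddMonoidHom.mk' (fun y => x ⊗ₘ y) fun y y' => MonoidalPreadditive.tensor_add x y y'

theorem zsmul_tensorHom (k : ℤ) {U V U' V' : C} (x : U ⟶ V) (y : U' ⟶ V') :
    ((k • x) ⊗ₘ y) = k • (x ⊗ₘ y) := map_zsmul (tensorRightHom y) k x

theorem tensorHom_zsmul (k : ℤ) {U V U' V' : C} (x : U ⟶ V) (y : U' ⟶ V') :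
    (x ⊗ₘ (k • y)) = k • (x ⊗ₘ y) := map_zsmul (tensorLeftHom x) k y

theorem sub_tensorHom {U V U' V' : C} (x x' : U ⟶ V) (y : U' ⟶ V') :
    ((x - x') ⊗ₘ y) = (x ⊗ₘ y) - (x' ⊗ₘ y) := map_sub (tensorRightHom y) x x'

theorem tensorHom_sub {U V U' V' : C} (x : U ⟶ V) (y y' : U' ⟶ V') :
    (x ⊗ₘ (y - y')) = (x ⊗ₘ y) - (x ⊗ₘ y') := map_sub (tensorLeftHom x) y y'

/-- The form of `fil_maps_succ` for operations that mix the first two factors. -/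
theorem fil_maps_succ_succ {X : C} {P : ℕ → Subobject X} {n w : ℕ} {Z : C}
    {g : X ⊗ X ⊗ tpow X n ⟶ Z} {S : SubRep Z}
    (h : ∀ ⦃T₁ T₂ T₃ : C⦄ ⦃i j k : ℕ⦄ ⦃a : T₁ ⟶ X⦄ ⦃b : T₂ ⟶ X⦄ ⦃x : T₃ ⟶ tpow X n⦄,
      i + (j + k) = w → (P i).Factors a → (P j).Factors b → IsGen P n k x →
      (a ⊗ₘ (b ⊗ₘ x)) ≫ g ∈ S.mem (T₁ ⊗ T₂ ⊗ T₃)) :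
    (Fil P (n + 2) w).Maps (g : tpow X (n + 2) ⟶ Z) S := by
  refine fil_maps_succ (n := n + 1) (g := g) fun T₁ T₂ i j a b hij ha hb => ?_
  obtain ⟨T₂', T₃, c, j', k, b', x, hjk, hb', hx, rfl⟩ := hb
  have := S.precomp (T₁ ◁ c) (h (show i + (j' + k) = w by omega) ha hb' hx)
  rw [← Category.assoc, ← id_tensorHom, tensorHom_comp_tensorHom, Category.id_comp] at this
  exact this

theorem fil_maps_tensor {X Y : C} {P : ℕ → Subobject X} {Q : ℕ → Subobject Y} {n m e w : ℕ}
    {f : X ⟶ Y} {r : tpow X n ⟶ tpow Y m}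
    (hf : ∀ {i : ℕ} {T : C} {a : T ⟶ X}, (P i).Factors a → (Q (i + e)).Factors (a ≫ f))
    (hr : ∀ w, (Fil P n w).Maps r (Fil Q m w)) :
    (Fil P (n + 1) w).Maps (f ⊗ₘ r : X ⊗ tpow X n ⟶ Y ⊗ tpow Y m) (Fil Q (m + 1) (w + e)) := by
  refine fil_maps_succ (g := (f ⊗ₘ r : X ⊗ tpow X n ⟶ Y ⊗ tpow Y m))
    fun T₁ T₂ i j a b hij ha hb => ?_
  rw [tensorHom_comp_tensorHom]
  exact fil_tensor' (by omega) (hf ha) (hr _ hb.mem)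

theorem fil_maps_tpowMap {A B : Alg C} {P : AlgFil A} {Q : AlgFil B} {f : A ⟶ B}
    (h : ∀ {i : ℕ} {T : C} {x : T ⟶ A.X}, (P.P i).Factors x → (Q.P i).Factors (x ≫ f.hom)) :
    ∀ n w, (Fil P.P n w).Maps (tpowMap f.hom n) (Fil Q.P n w)
  | 0, _ => fil_maps_zero fun _ _ hx => fil_zero (h hx)
  | n + 1, _ => fil_maps_tensor (e := 0) (fun ha => h ha) (fil_maps_tpowMap h n)

theorem fil_maps_wl {X : C} {P : ℕ → Subobject X} {n m w : ℕ} {r : tpow X n ⟶ tpow X m}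
    (hr : ∀ w, (Fil P n w).Maps r (Fil P m w)) :
    (Fil P (n + 1) w).Maps (wl X r) (Fil P (m + 1) w) := by
  have := fil_maps_tensor (P := P) (Q := P) (e := 0) (w := w) (f := 𝟙 X) (r := r)
    (fun ha => by rwa [Category.comp_id]) hr
  rw [id_tensorHom] at this
  exact this

theorem IsWeightMap.maps_dpos {A B : Alg C} {P : AlgFil A} {Q : AlgFil B} {f : A ⟶ B}
    {D : A.X ⟶ B.X} (h : IsWeightMap P Q f D) :
    ∀ n j w, (Fil P.P n w).Maps (dpos f.hom D n j) (Fil Q.P n w)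
  | 0, _, _ => fil_maps_zero fun _ _ hx => fil_zero (h.filtered hx)
  | n + 1, 0, _ => fil_maps_tensor (e := 0) (fun ha => h.filtered ha) (fil_maps_tpowMap h.map n)
  | n + 1, j + 1, _ => fil_maps_tensor (e := 0) (fun ha => h.map ha) (h.maps_dpos n j)

theorem sum_dpos_succ {X Y : C} (f D : X ⟶ Y) (n : ℕ) :
    ∑ j ∈ Finset.range (n + 2), dpos f D (n + 1) j =
      ((D ⊗ₘ tpowMap f n) + (f ⊗ₘ ∑ j ∈ Finset.range (n + 1), dpos f D n j) :
        X ⊗ tpow X n ⟶ Y ⊗ tpow Y n) := by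
  refine (Finset.sum_range_succ' _ (n + 1)).trans ((add_comm _ _).trans ?_)
  exact congrArg _ (map_sum (tensorLeftHom f) (fun j => dpos f D n j) _).symm

/-- The sum of all insertions of `D` multiplies elements of weight `w` by `w`, up to elements of
weight `w + 1`. -/
theorem IsWeightMap.maps_sum_dpos {A B : Alg C} {P : AlgFil A} {Q : AlgFil B} {f : A ⟶ B}
    {D : A.X ⟶ B.X} (h : IsWeightMap P Q f D) : ∀ n w, (Fil P.P n w).Maps
      (∑ j ∈ Finset.range (n + 1), dpos f.hom D n j - (w : ℤ) • tpowMap f.hom n)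
      (Fil Q.P n (w + 1))
  | 0, w => fil_maps_zero fun T x hx => fil_zero (by
      have := h.weight hx
      rw [zero_add, Finset.sum_range_one]
      rw [← Preadditive.comp_zsmul, ← Preadditive.comp_sub] at this
      exact this)
  | n + 1, w => by
    rw [sum_dpos_succ]
    refine fil_maps_succ (g := ((D ⊗ₘ tpowMap f.hom n) +
      (f.hom ⊗ₘ ∑ j ∈ Finset.range (n + 1), dpos f.hom D n j)) -
        (w : ℤ) • (f.hom ⊗ₘ tpowMap f.hom n)) fun T₁ T₂ i j a b hij ha hb => ?_
    -- With w = i + j the deviation splits into (D − i)a ⊗ b and a ⊗ (L − j)b, where L is the sum of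
    -- insertions into the tail. In each of them one factor has gained weight 1.
    have e : (a ⊗ₘ b) ≫ (((D ⊗ₘ tpowMap f.hom n) +
        (f.hom ⊗ₘ ∑ j ∈ Finset.range (n + 1), dpos f.hom D n j)) -
          (w : ℤ) • (f.hom ⊗ₘ tpowMap f.hom n)) =
        ((a ≫ D - (i : ℤ) • a ≫ f.hom) ⊗ₘ (b ≫ tpowMap f.hom n)) +
        ((a ≫ f.hom) ⊗ₘ (b ≫ (∑ j ∈ Finset.range (n + 1), dpos f.hom D n j -
          (j : ℤ) • tpowMap f.hom n))) := by
      have hw : (w : ℤ) = i + j := by exact_mod_cast hij.symm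
      rw [Preadditive.comp_sub, Preadditive.comp_add, Preadditive.comp_zsmul,
        tensorHom_comp_tensorHom, tensorHom_comp_tensorHom, tensorHom_comp_tensorHom,
        Preadditive.comp_sub, Preadditive.comp_zsmul, sub_tensorHom, tensorHom_sub,
        zsmul_tensorHom, tensorHom_zsmul, hw, add_smul]
      abel
    rw [e]
    exact add_mem (fil_tensor' (by omega) (h.weight ha) (fil_maps_tpowMap h.map n _ hb.mem))
      (fil_tensor' (by omega) (h.map ha) (h.maps_sum_dpos n j hb.mem))

theorem fil_maps_mulHead {A : Alg C} (P : AlgFil A) :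
    ∀ n w, (Fil P.P (n + 1) w).Maps (mulHead A n) (Fil P.P n w)
  | 0, w => fil_maps_succ (n := 0) (g := A.mul) fun T₁ T₂ i j a b hij ha hb =>
      fil_zero (by subst hij; exact P.mul ha hb)
  | n + 1, w => by
    refine fil_maps_succ_succ (n := n) (g := (α_ A.X A.X (tpow A.X n)).inv ≫ A.mul ▷ tpow A.X n)
      fun T₁ T₂ T₃ i j k a b x hw ha hb hx => ?_
    rw [associator_inv_naturality_assoc, ← tensorHom_id, tensorHom_comp_tensorHom,
      Category.comp_id]
    exact SubRep.precomp _ _ (fil_tensor' (by omega) (P.mul ha hb) hx.mem)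

/-- Modulo weight i + j + 1 both D(ab) and D(a)b + aD(b) equal (i + j)ab. So D is a derivation on
the associated graded algebra, whatever it is on A itself. -/
theorem weight_leibniz {A B : Alg C} {P : AlgFil A} {Q : AlgFil B} {f : A ⟶ B}
    {D : A.X ⟶ B.X} (h : IsWeightMap P Q f D) {i j : ℕ} {S T : C} {a : S ⟶ A.X} {b : T ⟶ A.X}
    (ha : (P.P i).Factors a) (hb : (P.P j).Factors b) :
    (Q.P (i + j + 1)).Factors
      ((a ⊗ₘ b) ≫ (A.mul ≫ D - ((D ⊗ₘ f.hom) + (f.hom ⊗ₘ D)) ≫ B.mul)) := by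
  have h0 := h.weight (P.mul ha hb)
  have h1 := Q.mul (h.weight ha) (h.map hb)
  have h2 := Q.mul (h.map ha) (h.weight hb)
  rw [show i + 1 + j = i + j + 1 by omega] at h1
  rw [← add_assoc] at h2
  have := factors_sub _ h0 (factors_add' _ h1 h2)
  convert this using 1
  rw [Preadditive.comp_sub, Preadditive.add_comp, Preadditive.comp_add,
    tensorHom_comp_tensorHom_assoc, tensorHom_comp_tensorHom_assoc, sub_tensorHom, tensorHom_sub,
    zsmul_tensorHom, tensorHom_zsmul, Preadditive.sub_comp, Preadditive.sub_comp,
    Preadditive.zsmul_comp, Preadditive.zsmul_comp, Category.assoc, Category.assoc, f.map_mul,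
    tensorHom_comp_tensorHom_assoc, Nat.cast_add, add_smul]
  abel

/-- The defect of the Leibniz rule for `D` and the multiplication of the first two factors. -/
def leibnizDefect {A B : Alg C} (f : A ⟶ B) (D : A.X ⟶ B.X) (n : ℕ) :
    tpow A.X (n + 1) ⟶ tpow B.X n :=
  mulHead A n ≫ dpos f.hom D n 0 -
    (dpos f.hom D (n + 1) 0 + dpos f.hom D (n + 1) 1) ≫ mulHead B n

/-- The defect only concerns the first two factors, so it is the defect for the algebra tensored
with f on the rest. This reduces its weight estimate to `weight_leibniz`. -/
theorem leibnizDefect_succ {A B : Alg C} (f : A ⟶ B) (D : A.X ⟶ B.X) (n : ℕ) :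
    leibnizDefect f D (n + 1) = (α_ A.X A.X (tpow A.X n)).inv ≫
      ((A.mul ≫ D - ((D ⊗ₘ f.hom) + (f.hom ⊗ₘ D)) ≫ B.mul) ⊗ₘ tpowMap f.hom n) := by
  change ((α_ A.X A.X (tpow A.X n)).inv ≫ A.mul ▷ tpow A.X n) ≫ (D ⊗ₘ tpowMap f.hom n) -
    ((D ⊗ₘ (f.hom ⊗ₘ tpowMap f.hom n)) + (f.hom ⊗ₘ (D ⊗ₘ tpowMap f.hom n))) ≫
      (α_ B.X B.X (tpow B.X n)).inv ≫ B.mul ▷ tpow B.X n = _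
  rw [Preadditive.add_comp, associator_inv_naturality_assoc, associator_inv_naturality_assoc,
    ← tensorHom_id, ← tensorHom_id, tensorHom_comp_tensorHom, tensorHom_comp_tensorHom,
    Category.assoc, tensorHom_comp_tensorHom, Category.comp_id, Category.id_comp,
    ← Preadditive.comp_add, ← Preadditive.comp_sub, ← MonoidalPreadditive.add_tensor,
    ← sub_tensorHom, Preadditive.add_comp]

theorem IsWeightMap.maps_leibnizDefect {A B : Alg C} {P : AlgFil A} {Q : AlgFil B} {f : A ⟶ B}
    {D : A.X ⟶ B.X} (h : IsWeightMap P Q f D) :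
    ∀ n w, (Fil P.P (n + 1) w).Maps (leibnizDefect f D n) (Fil Q.P n (w + 1))
  | 0, w => fil_maps_succ (n := 0)
      (g := A.mul ≫ D - ((D ⊗ₘ f.hom) + (f.hom ⊗ₘ D)) ≫ B.mul) fun T₁ T₂ i j a b hij ha hb =>
      fil_zero (by subst hij; exact weight_leibniz h ha hb)
  | n + 1, w => by
    rw [leibnizDefect_succ]
    refine fil_maps_succ_succ (n := n) (g := (α_ A.X A.X (tpow A.X n)).inv ≫
      ((A.mul ≫ D - ((D ⊗ₘ f.hom) + (f.hom ⊗ₘ D)) ≫ B.mul) ⊗ₘ tpowMap f.hom n))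
      fun T₁ T₂ T₃ i j k a b x hw ha hb hx => ?_
    rw [associator_inv_naturality_assoc, tensorHom_comp_tensorHom]
    exact SubRep.precomp _ _ (fil_tensor' (by omega) (weight_leibniz h ha hb)
      (fil_maps_tpowMap h.map n k hx.mem))

theorem fil_maps_face {A : Alg C} (P : AlgFil A) :
    ∀ n i w, (Fil P.P (n + 1) w).Maps (face A n i) (Fil P.P n w)
  | 0, 0, w => fil_maps_mulHead P 0 w
  | n + 1, 0, w => fil_maps_mulHead P (n + 1) w
  | 0, _ + 1, w => fil_maps_mulHead P 0 w
  | n + 1, i + 1, _ => fil_maps_wl fun w => fil_maps_face P n i w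

/-! ### The cyclic and Hochschild operators preserve weights -/

variable [SymmetricCategory C]

/-- By naturality of the braiding, a pure tensor of weights i, j becomes one of weights j, i, and
the total weight is symmetric. -/
theorem fil_maps_swapHead {X : C} (P : ℕ → Subobject X) :
    ∀ n w, (Fil P (n + 1) w).Maps (swapHead X n) (Fil P (n + 1) w)
  | 0, w => fil_maps_succ (n := 0) (g := (β_ X X).hom) fun T₁ T₂ i j a b hij ha hb => by
      have e : (a ⊗ₘ b) ≫ (β_ X X).hom = (β_ T₁ T₂).hom ≫ (b ⊗ₘ a) :=
        BraidedCategory.braiding_naturality a b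
      exact (congrArg (fun z : T₁ ⊗ T₂ ⟶ X ⊗ X => z ∈ (Fil P 1 w).mem (T₁ ⊗ T₂)) e).mpr
        (SubRep.precomp _ _ (fil_tensor' (n := 0) (b := a) (by omega) hb (fil_zero ha)))
  | n + 1, w => by
    refine fil_maps_succ_succ (n := n)
      (g := (α_ X X (tpow X n)).inv ≫ (β_ X X).hom ▷ tpow X n ≫ (α_ X X (tpow X n)).hom)
      fun T₁ T₂ T₃ i j k a b x hw ha hb hx => ?_
    have e : (a ⊗ₘ b ⊗ₘ x) ≫ (α_ X X (tpow X n)).inv ≫ (β_ X X).hom ▷ tpow X n ≫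
        (α_ X X (tpow X n)).hom = ((α_ T₁ T₂ T₃).inv ≫ (β_ T₁ T₂).hom ▷ T₃ ≫
          (α_ T₂ T₁ T₃).hom) ≫ (b ⊗ₘ a ⊗ₘ x) := by
      rw [associator_inv_naturality_assoc, Category.assoc, Category.assoc,
        ← associator_naturality, MonoidalCategory.tensorHom_def (a ⊗ₘ b), Category.assoc,
        whisker_exchange_assoc, ← comp_whiskerRight_assoc,
        BraidedCategory.braiding_naturality, comp_whiskerRight_assoc,
        MonoidalCategory.tensorHom_def (b ⊗ₘ a), Category.assoc]
    rw [e]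
    exact SubRep.precomp _ _ (fil_tensor' (n := n + 1) (show j + (i + k) = w by omega) hb
      (fil_tensor ha hx.mem))

theorem fil_maps_cyc {X : C} (P : ℕ → Subobject X) :
    ∀ n w, (Fil P n w).Maps (cyc X n) (Fil P n w)
  | 0, _ => SubRep.maps_id _
  | n + 1, w => (fil_maps_wl fun w => fil_maps_cyc P n w).comp (fil_maps_swapHead P n w)

theorem fil_maps_tt {X : C} (P : ℕ → Subobject X) (n w : ℕ) :
    (Fil P n w).Maps (tt X n) (Fil P n w) := (fil_maps_cyc P n w).zsmul _

theorem fil_maps_sface {A : Alg C} (P : AlgFil A) (n i w : ℕ) :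
    (Fil P.P (n + 1) w).Maps (sface A n i) (Fil P.P n w) := by
  refine SubRep.Maps.zsmul ?_ _
  split_ifs
  · exact fil_maps_face P n i w
  · exact (fil_maps_cyc P.P (n + 1) w).comp (fil_maps_mulHead P n w)

theorem fil_maps_bp {A : Alg C} (P : AlgFil A) (n w : ℕ) :
    (Fil P.P (n + 1) w).Maps (bp A n) (Fil P.P n w) :=
  SubRep.Maps.sum fun i _ => fil_maps_sface P n i w

theorem fil_maps_hb {A : Alg C} (P : AlgFil A) (n w : ℕ) :
    (Fil P.P (n + 1) w).Maps (hb A n) (Fil P.P n w) :=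
  SubRep.Maps.sum fun i _ => fil_maps_sface P n i w

theorem fil_maps_nm {X : C} (P : ℕ → Subobject X) (n w : ℕ) :
    (Fil P n w).Maps (nm X n) (Fil P n w) :=
  SubRep.Maps.sum fun k _ => SubRep.maps_ipow (fil_maps_tt P n w) k

end Filtered

/-! ### A homotopy for cyclic group actions -/

section RowHomotopy

variable {C : Type u} [Category.{v} C] [Preadditive C] {X Y : C} (t : X ⟶ X) (t' : Y ⟶ Y)
  (D : X ⟶ Y)

theorem ipow_succ_left : ∀ k, ipow t (k + 1) = t ≫ ipow t k
  | 0 => by simp [ipow]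
  | k + 1 => by
    calc ipow t (k + 1) ≫ t
      _ = t ≫ ipow t k ≫ t := by rw [ipow_succ_left k, Category.assoc]

/-- `∑ t^l D t'^(n+1-l)` for `l ≤ n`. -/
def rowSum (n : ℕ) : X ⟶ Y :=
  ∑ l ∈ Finset.range (n + 1), ipow t l ≫ D ≫ ipow t' (n + 1 - l)

/-- `-∑ t^l D t'^i` for `l + i ≤ n`. -/
def rowHtpy (n : ℕ) : X ⟶ Y :=
  -∑ l ∈ Finset.range (n + 1), ∑ i ∈ Finset.range (n + 1 - l), ipow t l ≫ D ≫ ipow t' i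

/-- For each l the sum over i telescopes; its lower end gives the norm of t followed by D, its upper
end gives `rowSum`. -/
theorem rowHtpy_comp (n : ℕ) : rowHtpy t t' D n ≫ (𝟙 Y - t') =
    rowSum t t' D n - (∑ l ∈ Finset.range (n + 1), ipow t l) ≫ D := by
  have h : ∀ l, (∑ i ∈ Finset.range (n + 1 - l), ipow t l ≫ D ≫ ipow t' i) ≫ (𝟙 Y - t') =
      ipow t l ≫ D - ipow t l ≫ D ≫ ipow t' (n + 1 - l) := by
    intro l
    have := Finset.sum_range_sub' (fun i => ipow t l ≫ D ≫ ipow t' i) (n + 1 - l)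
    rw [Preadditive.comp_sub, Category.comp_id, Preadditive.sum_comp, ← Finset.sum_sub_distrib]
    simpa only [ipow, Category.comp_id, Category.assoc] using this
  rw [rowHtpy, Preadditive.neg_comp, Preadditive.sum_comp, Finset.sum_congr rfl fun l _ => h l,
    Finset.sum_sub_distrib, rowSum, Preadditive.sum_comp, neg_sub]

/-- The same telescoping in the exponent of t, after exchange of the two summations. Here the
periodicity of t and t' is needed to recognize `rowSum`. -/
theorem comp_rowHtpy (n : ℕ) (ht : ipow t (n + 1) = 𝟙 X) (ht' : ipow t' (n + 1) = 𝟙 Y) :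
    (𝟙 X - t) ≫ rowHtpy t t' D n =
      rowSum t t' D n - D ≫ ∑ i ∈ Finset.range (n + 1), ipow t' i := by
  have h : ∀ i, (𝟙 X - t) ≫ (∑ l ∈ Finset.range (n + 1 - i), ipow t l ≫ D ≫ ipow t' i) =
      D ≫ ipow t' i - ipow t (n + 1 - i) ≫ D ≫ ipow t' i := by
    intro i
    have := Finset.sum_range_sub' (fun l => ipow t l ≫ D ≫ ipow t' i) (n + 1 - i)
    rw [Preadditive.sub_comp, Category.id_comp, Preadditive.comp_sum, ← Finset.sum_sub_distrib]
    simpa only [ipow_succ_left, show ipow t 0 = 𝟙 X from rfl, Category.id_comp, Category.assoc] using this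
  have h2 : ∑ i ∈ Finset.range (n + 1), ipow t (n + 1 - i) ≫ D ≫ ipow t' i =
      rowSum t t' D n := by
    -- Reflection is applied to n + 2 terms, with l = n + 1 included. The two end terms D t'^(n+1)
    -- and t^(n+1) D both equal D by periodicity, so they cancel and leave the sums over n + 1
    -- terms.
    have e1 := Finset.sum_range_reflect (fun l => ipow t l ≫ D ≫ ipow t' (n + 1 - l)) (n + 2)
    rw [Finset.sum_range_succ, Finset.sum_range_succ _ (n + 1)] at e1
    have e2 : ∀ i ∈ Finset.range (n + 1), ipow t (n + 2 - 1 - i) ≫ D ≫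
        ipow t' (n + 1 - (n + 2 - 1 - i)) = ipow t (n + 1 - i) ≫ D ≫ ipow t' i := by
      intro i hi
      have := Finset.mem_range.mp hi
      congr 3; omega
    rw [Finset.sum_congr rfl e2, show n + 2 - 1 - (n + 1) = 0 by omega, Nat.sub_zero,
      Nat.sub_self, ht', ht] at e1
    simp only [ipow, Category.id_comp, Category.comp_id] at e1
    exact add_right_cancel e1
  rw [rowHtpy, Finset.sum_comm' (t' := Finset.range (n + 1))
    (s' := fun i => Finset.range (n + 1 - i)) (by
      intro x y; simp only [Finset.mem_range]; omega),
    Preadditive.comp_neg, Preadditive.comp_sum, Finset.sum_congr rfl fun i _ => h i,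
    Finset.sum_sub_distrib, h2, Preadditive.comp_sum, neg_sub]

end RowHomotopy

/-! ### Sequences of maps on tensor powers and operators on them -/

section Sequences

variable {C : Type u} [Category.{v} C] [MonoidalCategory C] [Preadditive C]

/-- Sequences of maps from the tensor powers of `X` to `W`. -/
abbrev Seq (X W : C) := ∀ k, tpow X k ⟶ W

variable {X Y Z W : C}

/-- Composition with maps between tensor powers of the same order. -/
def levelOp (W : C) (g : ∀ k, tpow X k ⟶ tpow Y k) : Seq Y W →+ Seq X W :=
  AddMonoidHom.mk' (fun c k => g k ≫ c k) fun c c' => funext fun k =>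
    Preadditive.comp_add _ _ _ (g k) (c k) (c' k)

/-- The components of the composition with maps that lower the order of tensor powers by one. -/
def shiftFun (g : ∀ k, tpow X (k + 1) ⟶ tpow Y k) (c : Seq Y W) : Seq X W
  | 0 => 0
  | k + 1 => g k ≫ c k

/-- Composition with maps that lower the order of tensor powers by one. -/
def shiftOp (W : C) (g : ∀ k, tpow X (k + 1) ⟶ tpow Y k) : Seq Y W →+ Seq X W :=
  AddMonoidHom.mk' (shiftFun g) fun c c' => funext fun k => match k with
    | 0 => (add_zero _).symm
    | k + 1 => Preadditive.comp_add _ _ _ (g k) (c k) (c' k)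

theorem levelOp_apply (g : ∀ k, tpow X k ⟶ tpow Y k) (c : Seq Y W) (k : ℕ) :
    levelOp W g c k = g k ≫ c k := rfl

@[simp] theorem shiftOp_zero (g : ∀ k, tpow X (k + 1) ⟶ tpow Y k) (c : Seq Y W) :
    shiftOp W g c 0 = 0 := rfl

theorem shiftOp_succ (g : ∀ k, tpow X (k + 1) ⟶ tpow Y k) (c : Seq Y W) (k : ℕ) :
    shiftOp W g c (k + 1) = g k ≫ c k := rfl

/-- Postcomposition with a map. -/
def postOp (X : C) {W W' : C} (y : W ⟶ W') : Seq X W →+ Seq X W' :=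
  AddMonoidHom.mk' (fun c k => c k ≫ y) fun c c' => funext fun k =>
    Preadditive.add_comp _ _ _ (c k) (c' k) y

theorem levelOp_postOp {W' : C} (g : ∀ k, tpow X k ⟶ tpow Y k) (y : W ⟶ W') (c : Seq Y W) :
    levelOp W' g (postOp Y y c) = postOp X y (levelOp W g c) :=
  funext fun _ => (Category.assoc _ _ _).symm

theorem shiftOp_postOp {W' : C} (g : ∀ k, tpow X (k + 1) ⟶ tpow Y k) (y : W ⟶ W') (c : Seq Y W) :
    shiftOp W' g (postOp Y y c) = postOp X y (shiftOp W g c) :=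
  funext fun k => match k with
    | 0 => zero_comp.symm
    | _ + 1 => (Category.assoc _ _ _).symm

/-- The sequences that vanish in high degrees. -/
def bddSeq (X W : C) : AddSubgroup (Seq X W) where
  carrier := {c | ∃ K, ∀ k, K ≤ k → c k = 0}
  zero_mem' := ⟨0, fun _ _ => rfl⟩
  add_mem' := by
    rintro c c' ⟨K, h⟩ ⟨K', h'⟩
    refine ⟨max K K', fun k hk => ?_⟩
    rw [Pi.add_apply, h k (le_trans (le_max_left _ _) hk), h' k (le_trans (le_max_right _ _) hk),
      add_zero]
  neg_mem' := by
    rintro c ⟨K, h⟩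
    exact ⟨K, fun k hk => by rw [Pi.neg_apply, h k hk, neg_zero]⟩

theorem levelOp_bdd (g : ∀ k, tpow X k ⟶ tpow Y k) {c : Seq Y W} (hc : c ∈ bddSeq Y W) :
    levelOp W g c ∈ bddSeq X W := by
  obtain ⟨K, h⟩ := hc
  exact ⟨K, fun k hk => by rw [levelOp_apply, h k hk, comp_zero]⟩

theorem shiftOp_bdd (g : ∀ k, tpow X (k + 1) ⟶ tpow Y k) {c : Seq Y W} (hc : c ∈ bddSeq Y W) :
    shiftOp W g c ∈ bddSeq X W := by
  obtain ⟨K, h⟩ := hc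
  refine ⟨K + 1, fun k hk => ?_⟩
  obtain ⟨k, rfl⟩ : ∃ l, k = l + 1 := ⟨k - 1, by omega⟩
  rw [shiftOp_succ, h k (by omega), comp_zero]

/-- The sequences that vanish on elements of weight `p`. -/
def seqFil (P : ℕ → Subobject X) (W : C) (p : ℕ) : AddSubgroup (Seq X W) where
  carrier := {c | ∀ k, (Fil P k p).Maps (c k) (SubRep.zero W)}
  zero_mem' := fun _ => SubRep.maps_zero
  add_mem' := fun h h' k => (h k).add (h' k)
  neg_mem' := fun h k => (h k).neg

variable {P : ℕ → Subobject X} {Q : ℕ → Subobject Y}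

theorem levelOp_seqFil {g : ∀ k, tpow X k ⟶ tpow Y k} {p q : ℕ}
    (hg : ∀ k, (Fil P k p).Maps (g k) (Fil Q k q)) {c : Seq Y W} (hc : c ∈ seqFil Q W q) :
    levelOp W g c ∈ seqFil P W p := fun k => (hg k).comp (hc k)

theorem shiftOp_seqFil {g : ∀ k, tpow X (k + 1) ⟶ tpow Y k} {p q : ℕ}
    (hg : ∀ k, (Fil P (k + 1) p).Maps (g k) (Fil Q k q)) {c : Seq Y W} (hc : c ∈ seqFil Q W q) :
    shiftOp W g c ∈ seqFil P W p := fun k => match k with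
  | 0 => SubRep.maps_zero
  | k + 1 => (hg k).comp (hc k)

theorem postOp_seqFil {W' : C} (y : W ⟶ W') {p : ℕ} {c : Seq X W} (hc : c ∈ seqFil P W p) :
    postOp X y c ∈ seqFil P W' p := fun k T x hx => by
  have : x ≫ c k = 0 := hc k hx
  change x ≫ c k ≫ y = 0
  rw [← Category.assoc, this, zero_comp]

/-- The filtration of sequences increases with p, since an element of weight p + 1 also has weight
p. -/
theorem seqFil_mono (hP : ∀ i, P (i + 1) ≤ P i) (p : ℕ) {c : Seq X W} (hc : c ∈ seqFil P W p) :
    c ∈ seqFil P W (p + 1) := fun k _ _ hx => hc k (fil_anti hP k p hx)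

end Sequences

/-! ### Operator identities for the contraction and the row homotopy -/

section Operators

variable {C : Type u} [Category.{v} C] [MonoidalCategory C] [SymmetricCategory C] [Preadditive C]
  {A B : Alg C} {W : C}

variable (A W) in
abbrev hbOp : Seq A.X W →+ Seq A.X W := shiftOp W (hb A)

variable (A W) in
abbrev bpOp : Seq A.X W →+ Seq A.X W := shiftOp W (bp A)

variable (A W) in
abbrev headOp : Seq A.X W →+ Seq A.X W := shiftOp W (mulHead A)

variable (A W) in
abbrev ttOp : Seq A.X W →+ Seq A.X W := levelOp W (tt A.X)

variable (A W) in
abbrev nmOp : Seq A.X W →+ Seq A.X W := levelOp W (nm A.X)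

theorem sface_zero (A : Alg C) (n : ℕ) : sface A n 0 = mulHead A n := by
  have : face A n 0 = mulHead A n := by cases n <;> rfl
  simp [sface, this]

/-- The last face, which multiplies the last factor with the first, is t followed by face zero. -/
theorem hb_eq (A : Alg C) (n : ℕ) : hb A n = bp A n + tt A.X (n + 1) ≫ mulHead A n := by
  rw [hb, Finset.sum_range_succ, ← bp, ← tt_sface_zero, sface_zero]

theorem hbOp_eq (c : Seq A.X W) : hbOp A W c = bpOp A W c + ttOp A W (headOp A W c) :=
  funext fun k => match k with
    | 0 => ((zero_add _).trans comp_zero).symm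
    | k + 1 => by
      rw [Pi.add_apply, shiftOp_succ, shiftOp_succ, levelOp_apply, shiftOp_succ, hb_eq,
        Preadditive.add_comp, Category.assoc]

theorem ttOp_hbOp (c : Seq A.X W) :
    hbOp A W c - ttOp A W (hbOp A W c) = bpOp A W c - bpOp A W (ttOp A W c) :=
  funext fun k => match k with
    | 0 => by
      change (0 : tpow A.X 0 ⟶ W) - tt A.X 0 ≫ 0 = 0 - 0
      rw [comp_zero]
    | k + 1 => by
      have := congrArg (· ≫ c k) (tt_hb A k)
      simp only [Preadditive.sub_comp, Preadditive.comp_sub, Category.assoc, Category.id_comp,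
        Category.comp_id] at this
      exact this

theorem nmOp_bpOp (c : Seq A.X W) : nmOp A W (bpOp A W c) = hbOp A W (nmOp A W c) :=
  funext fun k => match k with
    | 0 => comp_zero
    | k + 1 => by
      have := congrArg (· ≫ c k) (nm_bp A k)
      simp only [Category.assoc] at this
      exact this

theorem nmOp_ttOp (c : Seq A.X W) : nmOp A W (ttOp A W c) = nmOp A W c :=
  funext fun k => by
    have := congrArg (· ≫ c k) (nm_tt A.X k)
    simp only [Category.assoc] at this
    exact this

theorem ttOp_nmOp (c : Seq A.X W) : ttOp A W (nmOp A W c) = nmOp A W c :=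
  funext fun k => by
    have := congrArg (· ≫ c k) (tt_nm A.X k)
    simp only [Category.assoc] at this
    exact this

theorem hbOp_hbOp (c : Seq A.X W) : hbOp A W (hbOp A W c) = 0 :=
  funext fun k => match k with
    | 0 => rfl
    | 1 => comp_zero
    | k + 2 => by
      have := congrArg (· ≫ c k) (hb_hb A k)
      simp only [Category.assoc, zero_comp] at this
      exact this

theorem bpOp_bpOp (c : Seq A.X W) : bpOp A W (bpOp A W c) = 0 :=
  funext fun k => match k with
    | 0 => rfl
    | 1 => comp_zero
    | k + 2 => by
      have := congrArg (· ≫ c k) (bp_bp A k)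
      simp only [Category.assoc, zero_comp] at this
      exact this

/-- The alternating sum of the faces with nonzero number anticommutes past the face number zero. -/
theorem hbOp_sub_headOp (c : Seq A.X W) :
    hbOp A W (headOp A W c) - headOp A W (headOp A W c) = - headOp A W (hbOp A W c) :=
  funext fun k => match k with
    | 0 => by change (0 : tpow A.X 0 ⟶ W) - 0 = - 0; rw [sub_zero, neg_zero]
    | 1 => by
      change hb A 0 ≫ 0 - mulHead A 0 ≫ 0 = - (mulHead A 0 ≫ 0)
      rw [comp_zero, comp_zero, sub_zero, neg_zero]
    | k + 2 => by
      have h : (hb A (k + 1) - mulHead A (k + 1)) ≫ mulHead A k =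
          - (mulHead A (k + 1) ≫ hb A k) := by
        rw [← sface_zero, ← sface_zero, hb, Finset.sum_range_succ', add_sub_cancel_right,
          Preadditive.sum_comp, hb, Preadditive.comp_sum, ← Finset.sum_neg_distrib]
        exact Finset.sum_congr rfl fun j hj => sface_sface A k 0 j (Nat.zero_le _)
          (Finset.mem_range.mp hj)
      have := congrArg (· ≫ c k) h
      simp only [Category.assoc, Preadditive.sub_comp, Preadditive.neg_comp] at this
      exact this

/-- Since t followed by face zero is the last face, this is the simplicial identity between the last
face and face zero. -/
theorem ttOp_headOp_headOp (c : Seq A.X W) :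
    ttOp A W (headOp A W (headOp A W c)) = - headOp A W (ttOp A W (headOp A W c)) :=
  funext fun k => match k with
    | 0 => by change tt A.X 0 ≫ 0 = - 0; rw [comp_zero, neg_zero]
    | 1 => by
      change tt A.X 1 ≫ mulHead A 0 ≫ 0 = - (mulHead A 0 ≫ tt A.X 0 ≫ 0)
      rw [comp_zero, comp_zero, comp_zero, comp_zero, neg_zero]
    | k + 2 => by
      have h := sface_sface A k 0 (k + 1) (Nat.zero_le _) (by omega)
      rw [← tt_sface_zero, ← tt_sface_zero, sface_zero, sface_zero] at h
      have := congrArg (· ≫ c k) h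
      simp only [Category.assoc, Preadditive.neg_comp] at this
      exact this

variable (f : A ⟶ B) (D : A.X ⟶ B.X)

variable (W) in
abbrev dposOp (j : ℕ) : Seq B.X W →+ Seq A.X W := levelOp W fun k => dpos f.hom D k j

theorem dpos_tt {X Y : C} (f D : X ⟶ Y) (n j : ℕ) (h : j + 1 ≤ n) :
    dpos f D n j ≫ tt Y n = tt X n ≫ dpos f D n (j + 1) := by
  simp only [tt, Preadditive.comp_zsmul, Preadditive.zsmul_comp, dpos_cyc f D n j h]

theorem dposOp_ttOp (c : Seq B.X W) :
    dposOp W f D 0 (ttOp B W c) = ttOp A W (dposOp W f D 1 c) :=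
  funext fun k => match k with
    -- On a single factor the position of the insertion is irrelevant: `dpos` takes the value D
    -- there for every position, and t is the identity.
    | 0 => by
      change D ≫ tt B.X 0 ≫ c 0 = tt A.X 0 ≫ D ≫ c 0
      have h : ∀ X : C, tt X 0 = 𝟙 (tpow X 0) := fun X => by rw [tt, pow_zero, one_smul]; rfl
      rw [h, h]
      exact (congrArg (D ≫ ·) (Category.id_comp _)).trans (Category.id_comp _).symm
    | k + 1 => by
      have := congrArg (· ≫ c (k + 1)) (dpos_tt f.hom D (k + 1) 0 (by omega))
      simp only [Category.assoc] at this
      exact this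

/-- An insertion into the first factor commutes with all faces of b' except face zero, which is
subtracted on both sides. -/
theorem dposOp_bpOp (c : Seq B.X W) :
    dposOp W f D 0 (bpOp B W c) - dposOp W f D 0 (headOp B W c) =
      bpOp A W (dposOp W f D 0 c) - headOp A W (dposOp W f D 0 c) :=
  funext fun k => match k with
    | 0 => by
      change dpos f.hom D 0 0 ≫ 0 - dpos f.hom D 0 0 ≫ 0 = (0 : tpow A.X 0 ⟶ W) - 0
      rw [comp_zero]
    | k + 1 => by
      have h : dpos f.hom D (k + 1) 0 ≫ (bp B k - mulHead B k) =
          (bp A k - mulHead A k) ≫ dpos f.hom D k 0 := by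
        rw [← sface_zero, ← sface_zero, bp, Finset.sum_range_succ', add_sub_cancel_right,
          bp, Finset.sum_range_succ', add_sub_cancel_right, Preadditive.comp_sum,
          Preadditive.sum_comp]
        refine Finset.sum_congr rfl fun j hj => ?_
        have hj' : j + 1 ≤ k := Finset.mem_range.mp hj
        rw [sface, sface, if_pos hj', if_pos hj', Preadditive.comp_zsmul, Preadditive.zsmul_comp,
          dpos_zero_face f D k j hj']
      have := congrArg (· ≫ c k) h
      simp only [Category.assoc, Preadditive.sub_comp, Preadditive.comp_sub] at this
      exact this

/-- The operator t moves D from position 1 to position 2, and the multiplication of the first two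
factors brings it back to position 1. -/
theorem ttOp_headOp_dposOp (c : Seq B.X W) :
    ttOp A W (headOp A W (dposOp W f D 1 (headOp B W c))) =
      dposOp W f D 1 (ttOp B W (headOp B W (headOp B W c))) :=
  funext fun k => match k with
    | 0 => by
      change tt A.X 0 ≫ 0 = dpos f.hom D 0 1 ≫ tt B.X 0 ≫ 0
      rw [comp_zero, comp_zero, comp_zero]
    | 1 => by
      change tt A.X 1 ≫ mulHead A 0 ≫ dpos f.hom D 0 1 ≫ 0 =
        dpos f.hom D 1 1 ≫ tt B.X 1 ≫ mulHead B 0 ≫ 0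
      simp only [comp_zero]
    | k + 2 => by
      have h := dpos_two_mulHead f D k
      have h' := dpos_tt f.hom D (k + 2) 1 (by omega)
      have := congrArg (· ≫ mulHead B (k + 1) ≫ mulHead B k ≫ c k) h'
      simp only [Category.assoc] at this
      rw [← Category.assoc (dpos f.hom D (k + 2) (1 + 1)), h, Category.assoc] at this
      exact this.symm

variable (W) in
abbrev defectOp : Seq B.X W →+ Seq A.X W := shiftOp W (leibnizDefect f D)

theorem defectOp_eq (c : Seq B.X W) : defectOp W f D c = headOp A W (dposOp W f D 0 c) -
    (dposOp W f D 0 (headOp B W c) + dposOp W f D 1 (headOp B W c)) :=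
  funext fun k => match k with
    | 0 => by
      change (0 : tpow A.X 0 ⟶ W) = 0 - (dpos f.hom D 0 0 ≫ 0 + dpos f.hom D 0 1 ≫ 0)
      simp only [comp_zero, add_zero, sub_zero]
    | k + 1 => by
      simp only [Pi.sub_apply, Pi.add_apply, shiftOp_succ, levelOp_apply, leibnizDefect,
        Preadditive.sub_comp, Preadditive.add_comp, Category.assoc]

variable (W) in
/-- The contraction with `D` in the Hochschild complex. -/
def contrOp : Seq B.X W →+ Seq A.X W := (dposOp W f D 1).comp (headOp B W)

theorem contrOp_apply (c : Seq B.X W) : contrOp W f D c = dposOp W f D 1 (headOp B W c) := rfl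

/-- By `dposOp_ttOp`, t applied to the contraction inserts D in front of the last face, that is,
into the difference of b and b'. What survives on the left side is face zero with D inserted before
it in position 0 and 1, and after it: the Leibniz defect. For a derivation the right side is zero.
-/
theorem contrOp_column (c : Seq B.X W) :
    contrOp W f D c - ttOp A W (contrOp W f D c) - bpOp A W (dposOp W f D 0 c) +
      dposOp W f D 0 (hbOp B W c) = - defectOp W f D c := by
  have h1 := dposOp_bpOp (W := W) f D c
  have h2 := dposOp_ttOp f D (headOp B W c)
  rw [contrOp_apply, ← h2, hbOp_eq, map_add, defectOp_eq]
  rw [sub_eq_sub_iff_add_eq_add] at h1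
  have h3 := eq_sub_of_add_eq h1
  rw [h3]
  abel

/-- For a derivation, b anticommutes with the contraction. In general, faces away from the inserted
factor cancel; conjugation by t moves the remaining ones to the front, where they form the Leibniz
defect. The operator t on the left does no harm because it is invertible and preserves weights
(`ttOp_fil_iff`). -/
theorem contrOp_hbOp (c : Seq B.X W) :
    ttOp A W (hbOp A W (contrOp W f D c) + contrOp W f D (hbOp B W c)) =
      defectOp W f D (ttOp B W (headOp B W c)) := by
  -- Conjugation by t lowers the number of a face by one, so b without face zero turns into b'.
  have hr : ∀ {A : Alg C} (c : Seq A.X W),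
      ttOp A W (hbOp A W c - headOp A W c) = bpOp A W (ttOp A W c) := fun {A} c => by
    have h1 := ttOp_hbOp c
    have h2 := hbOp_eq c
    have h3 : bpOp A W (ttOp A W c) = bpOp A W c - (hbOp A W c - ttOp A W (hbOp A W c)) := by
      rw [h1]; abel
    rw [map_sub, h3]
    nth_rw 2 [h2]
    abel
  have e1 : headOp B W (hbOp B W c) =
      - (hbOp B W (headOp B W c) - headOp B W (headOp B W c)) := by
    rw [hbOp_sub_headOp, neg_neg]
  have e2 : hbOp A W (dposOp W f D 1 (headOp B W c)) =
      (hbOp A W (dposOp W f D 1 (headOp B W c)) - headOp A W (dposOp W f D 1 (headOp B W c))) +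
        headOp A W (dposOp W f D 1 (headOp B W c)) := by abel
  have e3 := dposOp_bpOp (W := W) f D (ttOp B W (headOp B W c))
  rw [sub_eq_sub_iff_add_eq_add] at e3
  have e4 := eq_sub_of_add_eq e3
  rw [contrOp_apply, contrOp_apply, e1, e2, map_neg, map_add, map_add, map_neg, hr,
    ← dposOp_ttOp f D (_ - _), hr, ← dposOp_ttOp, ttOp_headOp_dposOp, e4, defectOp_eq,
    ttOp_headOp_headOp, map_neg]
  abel

variable (W) in
/-- The row homotopy between insertion of `D` in the first position and in all positions. -/
def rowOp : Seq B.X W →+ Seq A.X W :=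
  levelOp W fun k => rowHtpy (tt A.X k) (tt B.X k) (dpos f.hom D k 0) k

variable (W) in
/-- The sum of all insertions of `D`. -/
def lieOp : Seq B.X W →+ Seq A.X W :=
  levelOp W fun k => ∑ j ∈ Finset.range (k + 1), dpos f.hom D k j

theorem dpos_ipow {X Y : C} (f D : X ⟶ Y) (n : ℕ) : ∀ i ≤ n,
    dpos f D n 0 ≫ ipow (tt Y n) i = ipow (tt X n) i ≫ dpos f D n i
  | 0, _ => (Category.comp_id _).trans (Category.id_comp _).symm
  | i + 1, h => by
    rw [ipow, ← Category.assoc, dpos_ipow f D n i (by omega), Category.assoc,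
      dpos_tt f D n i h, ← Category.assoc]
    rfl

/-- Moving D_0 past t^(n+1−l) turns it into D_(n+1−l), and the powers of t combine to t^(n+1) = 1.
The term l = 0 gives D_0 directly. -/
theorem rowSum_dpos {X Y : C} (f D : X ⟶ Y) (n : ℕ) :
    rowSum (tt X n) (tt Y n) (dpos f D n 0) n = ∑ j ∈ Finset.range (n + 1), dpos f D n j := by
  rw [rowSum, Finset.sum_range_succ', Finset.sum_range_succ', ← Finset.sum_range_reflect]
  congr 1
  · refine Finset.sum_congr rfl fun l hl => ?_
    have hl' := Finset.mem_range.mp hl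
    rw [show n + 1 - (n - 1 - l + 1) = l + 1 by omega, dpos_ipow f D n (l + 1) (by omega),
      ← Category.assoc, ← ipow_add, show n - 1 - l + 1 + (l + 1) = n + 1 by omega, ipow_tt,
      Category.id_comp]
  · rw [Nat.sub_zero, ipow_tt, Category.comp_id]
    exact Category.id_comp _

/-- Together with `sub_rowOp`, this is what produces the sum of all insertions in both diagonal
entries of Cartan's formula. -/
theorem rowOp_sub (c : Seq B.X W) :
    rowOp W f D (c - ttOp B W c) = lieOp W f D c - nmOp A W (dposOp W f D 0 c) :=
  funext fun k => by
    have := congrArg (· ≫ c k)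
      (rowHtpy_comp (tt A.X k) (tt B.X k) (dpos f.hom D k 0) k)
    rw [rowSum_dpos] at this
    simp only [Category.assoc, Preadditive.sub_comp, Category.id_comp] at this
    exact this

theorem sub_rowOp (c : Seq B.X W) :
    rowOp W f D c - ttOp A W (rowOp W f D c) = lieOp W f D c - dposOp W f D 0 (nmOp B W c) :=
  funext fun k => by
    have := congrArg (· ≫ c k)
      (comp_rowHtpy (tt A.X k) (tt B.X k) (dpos f.hom D k 0) k (ipow_tt _ _) (ipow_tt _ _))
    rw [rowSum_dpos] at this
    simp only [Category.assoc, Preadditive.sub_comp, Category.id_comp] at this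
    exact this

end Operators

/-! ### The complex of cochains on ΩA and Cartan's homotopy -/

section Cochains

variable {C : Type u} [Category.{v} C] [MonoidalCategory C] [SymmetricCategory C] [Preadditive C]
  {A B : Alg C} {W : C}

/-- Pairs of sequences: the restrictions of a sequence of maps on `Ω A` to the summands `A^{⊗(n+1)}`
of `Ωⁿ A` and of `Ω^{n+1} A`. -/
abbrev Coch (A : Alg C) (W : C) := Seq A.X W × Seq A.X W

variable (A W) in
/-- Composition with `b + B`. -/
def cochD : Coch A W →+ Coch A W :=
  AddMonoidHom.mk' (fun φ => (hbOp A W φ.1 + nmOp A W φ.2,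
    φ.1 - ttOp A W φ.1 - bpOp A W φ.2)) fun φ ψ => by
      refine Prod.ext ?_ ?_
      · simp only [Prod.fst_add, Prod.snd_add, map_add]; abel
      · simp only [Prod.fst_add, Prod.snd_add, map_add]; abel

theorem cochD_apply (φ : Coch A W) : cochD A W φ =
    (hbOp A W φ.1 + nmOp A W φ.2, φ.1 - ttOp A W φ.1 - bpOp A W φ.2) := rfl

theorem cochD_cochD (φ : Coch A W) : cochD A W (cochD A W φ) = 0 := by
  rw [cochD_apply, cochD_apply]
  refine Prod.ext ?_ ?_
  · simp only [map_add, map_sub, hbOp_hbOp, nmOp_bpOp, nmOp_ttOp]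
    simp
  · have h := ttOp_hbOp φ.1
    have : hbOp A W φ.1 = bpOp A W φ.1 - bpOp A W (ttOp A W φ.1) + ttOp A W (hbOp A W φ.1) := by
      rw [← h]; abel
    simp only [map_add, map_sub, bpOp_bpOp, ttOp_nmOp]
    nth_rw 1 [this]
    simp only [Prod.snd_zero]
    abel

/-- Composition with the maps induced by an algebra homomorphism. -/
def cochMap (W : C) (f : A ⟶ B) : Coch B W →+ Coch A W :=
  (levelOp W (tpowMap f.hom)).prodMap (levelOp W (tpowMap f.hom))

theorem cochMap_apply (f : A ⟶ B) (φ : Coch B W) : cochMap W f φ =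
    (levelOp W (tpowMap f.hom) φ.1, levelOp W (tpowMap f.hom) φ.2) := rfl

/-- Postcomposition with a map. -/
def cochPost (A : Alg C) {W W' : C} (y : W ⟶ W') : Coch A W →+ Coch A W' :=
  (postOp A.X y).prodMap (postOp A.X y)

theorem cochPost_apply {W' : C} (y : W ⟶ W') (φ : Coch A W) :
    cochPost A y φ = (postOp A.X y φ.1, postOp A.X y φ.2) := rfl

theorem cochD_cochPost {W' : C} (y : W ⟶ W') (φ : Coch A W) :
    cochD A W' (cochPost A y φ) = cochPost A y (cochD A W φ) := by
  simp only [cochD_apply, cochPost_apply, shiftOp_postOp, levelOp_postOp, map_add, map_sub]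

theorem cochMap_cochD (f : A ⟶ B) (φ : Coch B W) :
    cochMap W f (cochD B W φ) = cochD A W (cochMap W f φ) := by
  have h1 : ∀ (g : ∀ {A : Alg C} (k : ℕ), tpow A.X (k + 1) ⟶ tpow A.X k)
      (_ : ∀ k, g k ≫ tpowMap f.hom k = tpowMap f.hom (k + 1) ≫ g k) (c : Seq B.X W),
      levelOp W (tpowMap f.hom) (shiftOp W g c) = shiftOp W g (levelOp W (tpowMap f.hom) c) :=
    fun g hg c => funext fun k => match k with
      | 0 => comp_zero
      | k + 1 => by
        have := congrArg (· ≫ c k) (hg k)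
        simp only [Category.assoc] at this
        exact this.symm
  have h2 : ∀ (g : ∀ {X : C} (k : ℕ), tpow X k ⟶ tpow X k)
      (_ : ∀ k, g k ≫ tpowMap f.hom k = tpowMap f.hom k ≫ g k) (c : Seq B.X W),
      levelOp W (tpowMap f.hom) (levelOp W g c) = levelOp W g (levelOp W (tpowMap f.hom) c) :=
    fun g hg c => funext fun k => by
      have := congrArg (· ≫ c k) (hg k)
      simp only [Category.assoc] at this
      exact this.symm
  simp only [cochD_apply, cochMap_apply, map_add, map_sub]
  rw [h1 (fun {A} k => hb A k) (hb_map f), h1 (fun {A} k => bp A k) (bp_map f),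
    h2 (fun {X} k => tt X k) (tt_map f.hom), h2 (fun {X} k => nm X k) (nm_map f.hom)]

theorem cochMap_cochPost {W' : C} (f : A ⟶ B) (y : W ⟶ W') (φ : Coch B W) :
    cochMap W' f (cochPost B y φ) = cochPost A y (cochMap W f φ) := by
  simp only [cochMap_apply, cochPost_apply, levelOp_postOp]

/-- The differential of the complex of maps from `Ω A` to a complex with total object `W` and
differential `y`; the sign `s` is that of the degree. -/
def cochDiff (A : Alg C) (y : W ⟶ W) (s : ℤ) : Coch A W →+ Coch A W :=
  cochPost A y - s • cochD A W

theorem cochDiff_apply (y : W ⟶ W) (s : ℤ) (φ : Coch A W) :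
    cochDiff A y s φ = cochPost A y φ - s • cochD A W φ := rfl

/-- Consecutive degrees carry opposite signs; hence the mixed terms, y after b + B and b + B after
y, cancel. -/
theorem cochDiff_cochDiff {y : W ⟶ W} (hy : y ≫ y = 0) {s : ℤ} (φ : Coch A W) :
    cochDiff A y s (cochDiff A y (-s) φ) = 0 := by
  have h : cochPost A y (cochPost A y φ) = 0 := by
    have : ∀ c : Seq A.X W, postOp A.X y (postOp A.X y c) = 0 := fun c => funext fun k => by
      change (c k ≫ y) ≫ y = 0
      rw [Category.assoc, hy, comp_zero]
    rw [cochPost_apply, cochPost_apply]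
    exact Prod.ext (this _) (this _)
  simp only [cochDiff_apply, map_sub, map_zsmul, cochD_cochPost, cochD_cochD, h]
  simp

theorem cochMap_cochDiff (f : A ⟶ B) (y : W ⟶ W) (s : ℤ) (φ : Coch B W) :
    cochMap W f (cochDiff B y s φ) = cochDiff A y s (cochMap W f φ) := by
  simp only [cochDiff_apply, map_sub, map_zsmul, cochMap_cochPost, cochMap_cochD]

/-- The pairs of sequences that vanish on elements of weight `p`. -/
def cochFil (P : AlgFil A) (W : C) (p : ℕ) : AddSubgroup (Coch A W) :=
  (seqFil P.P W p).prod (seqFil P.P W p)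

theorem mem_cochFil {P : AlgFil A} {p : ℕ} {φ : Coch A W} :
    φ ∈ cochFil P W p ↔ φ.1 ∈ seqFil P.P W p ∧ φ.2 ∈ seqFil P.P W p := AddSubgroup.mem_prod

/-- The pairs of sequences that vanish in high degrees. -/
def bddCoch (A : Alg C) (W : C) : AddSubgroup (Coch A W) :=
  (bddSeq A.X W).prod (bddSeq A.X W)

theorem mem_bddCoch {φ : Coch A W} :
    φ ∈ bddCoch A W ↔ φ.1 ∈ bddSeq A.X W ∧ φ.2 ∈ bddSeq A.X W := AddSubgroup.mem_prod

variable (W) in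
/-- Cartan's homotopy. -/
def cochHtpy (f : A ⟶ B) (D : A.X ⟶ B.X) : Coch B W →+ Coch A W :=
  AddMonoidHom.mk' (fun φ => (contrOp W f D φ.1 + rowOp W f D φ.2, dposOp W f D 0 φ.1))
    fun φ ψ => by
      refine Prod.ext ?_ ?_
      · simp only [Prod.fst_add, Prod.snd_add, map_add]; abel
      · simp only [Prod.fst_add, Prod.snd_add, map_add]

variable (W) in
/-- The off-diagonal part of the deviation from Cartan's homotopy formula. -/
def offDiag (f : A ⟶ B) (D : A.X ⟶ B.X) : Seq B.X W →+ Seq A.X W :=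
  (hbOp A W).comp (rowOp W f D) - (rowOp W f D).comp (bpOp B W) +
    (contrOp W f D).comp (nmOp B W)

theorem offDiag_apply (f : A ⟶ B) (D : A.X ⟶ B.X) (c : Seq B.X W) : offDiag W f D c =
    hbOp A W (rowOp W f D c) - rowOp W f D (bpOp B W c) + contrOp W f D (nmOp B W c) := rfl

theorem cochHtpy_apply (f : A ⟶ B) (D : A.X ⟶ B.X) (φ : Coch B W) : cochHtpy W f D φ =
    (contrOp W f D φ.1 + rowOp W f D φ.2, dposOp W f D 0 φ.1) := rfl

theorem cochHtpy_cochPost (f : A ⟶ B) (D : A.X ⟶ B.X) (y : W ⟶ W) (φ : Coch B W) :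
    cochHtpy W f D (cochPost B y φ) = cochPost A y (cochHtpy W f D φ) := by
  simp only [cochPost_apply, cochHtpy_apply, contrOp_apply, rowOp, shiftOp_postOp, levelOp_postOp,
    map_add]

theorem cochMap_bdd (f : A ⟶ B) {φ : Coch B W} (h : φ ∈ bddCoch B W) :
    cochMap W f φ ∈ bddCoch A W :=
  mem_bddCoch.mpr ⟨levelOp_bdd _ (mem_bddCoch.mp h).1, levelOp_bdd _ (mem_bddCoch.mp h).2⟩

theorem cochHtpy_bdd (f : A ⟶ B) (D : A.X ⟶ B.X) {φ : Coch B W} (h : φ ∈ bddCoch B W) :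
    cochHtpy W f D φ ∈ bddCoch A W := by
  obtain ⟨h1, h2⟩ := mem_bddCoch.mp h
  exact mem_bddCoch.mpr ⟨add_mem (levelOp_bdd _ (shiftOp_bdd _ h1)) (levelOp_bdd _ h2),
    levelOp_bdd _ h1⟩

theorem offDiag_bdd (f : A ⟶ B) (D : A.X ⟶ B.X) {c : Seq B.X W} (h : c ∈ bddSeq B.X W) :
    offDiag W f D c ∈ bddSeq A.X W :=
  add_mem (sub_mem (shiftOp_bdd _ (levelOp_bdd _ h)) (levelOp_bdd _ (shiftOp_bdd _ h)))
    (levelOp_bdd _ (shiftOp_bdd _ (levelOp_bdd _ h)))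

/-! ### Cartan's formula modulo lower filtration -/

section Filtered

variable [MonoidalPreadditive C] {P : AlgFil A} {Q : AlgFil B} {f : A ⟶ B} {D : A.X ⟶ B.X}

theorem IsWeightMap.maps_rowHtpy (h : IsWeightMap P Q f D) (k p : ℕ) :
    (Fil P.P k p).Maps (rowHtpy (tt A.X k) (tt B.X k) (dpos f.hom D k 0) k) (Fil Q.P k p) :=
  SubRep.Maps.neg <| SubRep.Maps.sum fun l _ => SubRep.Maps.sum fun i _ =>
    (SubRep.maps_ipow (fil_maps_tt P.P k p) l).comp
      ((h.maps_dpos k 0 p).comp (SubRep.maps_ipow (fil_maps_tt Q.P k p) i))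

theorem IsWeightMap.dposOp_fil (h : IsWeightMap P Q f D) {j p : ℕ} {c : Seq B.X W}
    (hc : c ∈ seqFil Q.P W p) : dposOp W f D j c ∈ seqFil P.P W p :=
  levelOp_seqFil (fun k => h.maps_dpos k j p) hc

theorem IsWeightMap.rowOp_fil (h : IsWeightMap P Q f D) {p : ℕ} {c : Seq B.X W}
    (hc : c ∈ seqFil Q.P W p) : rowOp W f D c ∈ seqFil P.P W p :=
  levelOp_seqFil (fun k => h.maps_rowHtpy k p) hc

theorem IsWeightMap.contrOp_fil (h : IsWeightMap P Q f D) {p : ℕ} {c : Seq B.X W}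
    (hc : c ∈ seqFil Q.P W p) : contrOp W f D c ∈ seqFil P.P W p :=
  h.dposOp_fil (shiftOp_seqFil (fun k => fil_maps_mulHead Q k p) hc)

theorem hbOp_fil {p : ℕ} {c : Seq A.X W} (hc : c ∈ seqFil P.P W p) :
    hbOp A W c ∈ seqFil P.P W p := shiftOp_seqFil (fun k => fil_maps_hb P k p) hc

theorem bpOp_fil {p : ℕ} {c : Seq A.X W} (hc : c ∈ seqFil P.P W p) :
    bpOp A W c ∈ seqFil P.P W p := shiftOp_seqFil (fun k => fil_maps_bp P k p) hc

theorem ttOp_fil {p : ℕ} {c : Seq A.X W} (hc : c ∈ seqFil P.P W p) :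
    ttOp A W c ∈ seqFil P.P W p := levelOp_seqFil (fun k => fil_maps_tt P.P k p) hc

theorem nmOp_fil {p : ℕ} {c : Seq A.X W} (hc : c ∈ seqFil P.P W p) :
    nmOp A W c ∈ seqFil P.P W p := levelOp_seqFil (fun k => fil_maps_nm P.P k p) hc

/-- The inverse of t on A^{⊗(k+1)} is t^k, which preserves weights. -/
theorem ttOp_fil_iff {p : ℕ} {c : Seq A.X W} (hc : ttOp A W c ∈ seqFil P.P W p) :
    c ∈ seqFil P.P W p := fun k => by
  have h : c k = ipow (tt A.X k) k ≫ ttOp A W c k := by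
    rw [levelOp_apply, ← Category.assoc]
    refine Eq.trans ?_ (congrArg (· ≫ c k) (ipow_tt A.X k).symm)
    exact (Category.id_comp _).symm
  rw [h]
  exact (SubRep.maps_ipow (fil_maps_tt P.P k p) k).comp (hc k)

theorem IsWeightMap.defectOp_fil (h : IsWeightMap P Q f D) {p : ℕ} {c : Seq B.X W}
    (hc : c ∈ seqFil Q.P W (p + 1)) : defectOp W f D c ∈ seqFil P.P W p :=
  shiftOp_seqFil (fun k => h.maps_leibnizDefect k p) hc

/-- By `IsWeightMap.maps_sum_dpos`, the sum of all insertions minus p times f takes weight p to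
weight p + 1, where c vanishes. -/
theorem IsWeightMap.lieOp_fil (h : IsWeightMap P Q f D) {p : ℕ} {c : Seq B.X W}
    (hc : c ∈ seqFil Q.P W (p + 1)) :
    lieOp W f D c - (p : ℤ) • levelOp W (tpowMap f.hom) c ∈ seqFil P.P W p := by
  have e : lieOp W f D c - (p : ℤ) • levelOp W (tpowMap f.hom) c = levelOp W (fun k =>
      ∑ j ∈ Finset.range (k + 1), dpos f.hom D k j - (p : ℤ) • tpowMap f.hom k) c :=
    funext fun k => by
      simp only [lieOp, Pi.sub_apply, Pi.smul_apply, levelOp_apply, Preadditive.sub_comp,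
        Preadditive.zsmul_comp]
  rw [e]
  exact levelOp_seqFil (fun k => h.maps_sum_dpos k p) hc

theorem cochD_fil {p : ℕ} {φ : Coch A W} (h : φ ∈ cochFil P W p) :
    cochD A W φ ∈ cochFil P W p := by
  obtain ⟨h1, h2⟩ := mem_cochFil.mp h
  exact mem_cochFil.mpr ⟨add_mem (hbOp_fil h1) (nmOp_fil h2),
    sub_mem (sub_mem h1 (ttOp_fil h1)) (bpOp_fil h2)⟩

theorem cochPost_fil {W' : C} (y : W ⟶ W') {p : ℕ} {φ : Coch A W} (h : φ ∈ cochFil P W p) :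
    cochPost A y φ ∈ cochFil P W' p :=
  mem_cochFil.mpr ⟨postOp_seqFil y (mem_cochFil.mp h).1, postOp_seqFil y (mem_cochFil.mp h).2⟩

theorem cochDiff_fil (y : W ⟶ W) (s : ℤ) {p : ℕ} {φ : Coch A W} (h : φ ∈ cochFil P W p) :
    cochDiff A y s φ ∈ cochFil P W p :=
  sub_mem (cochPost_fil y h) (zsmul_mem (cochD_fil h) s)

theorem cochMap_fil
    (h : ∀ {i : ℕ} {T : C} {x : T ⟶ A.X}, (P.P i).Factors x → (Q.P i).Factors (x ≫ f.hom))
    {p : ℕ} {φ : Coch B W} (hφ : φ ∈ cochFil Q W p) : cochMap W f φ ∈ cochFil P W p :=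
  mem_cochFil.mpr ⟨levelOp_seqFil (fun k => fil_maps_tpowMap h k p) (mem_cochFil.mp hφ).1,
    levelOp_seqFil (fun k => fil_maps_tpowMap h k p) (mem_cochFil.mp hφ).2⟩

theorem IsWeightMap.cochHtpy_fil (h : IsWeightMap P Q f D) {p : ℕ} {φ : Coch B W}
    (hφ : φ ∈ cochFil Q W p) : cochHtpy W f D φ ∈ cochFil P W p := by
  obtain ⟨h1, h2⟩ := mem_cochFil.mp hφ
  exact mem_cochFil.mpr ⟨add_mem (h.contrOp_fil h1) (h.rowOp_fil h2), h.dposOp_fil h1⟩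

theorem IsWeightMap.offDiag_fil (h : IsWeightMap P Q f D) {p : ℕ} {c : Seq B.X W}
    (hc : c ∈ seqFil Q.P W p) : offDiag W f D c ∈ seqFil P.P W p :=
  add_mem (sub_mem (hbOp_fil (h.rowOp_fil hc)) (h.rowOp_fil (bpOp_fil hc)))
    (h.contrOp_fil (nmOp_fil hc))

theorem cochFil_mono (p : ℕ) {φ : Coch A W} (h : φ ∈ cochFil P W p) : φ ∈ cochFil P W (p + 1) :=
  mem_cochFil.mpr ⟨seqFil_mono P.anti p (mem_cochFil.mp h).1,
    seqFil_mono P.anti p (mem_cochFil.mp h).2⟩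

/-- Cartan's homotopy formula, up to terms of lower filtration. -/
theorem IsWeightMap.cartan (h : IsWeightMap P Q f D) {p : ℕ} {φ : Coch B W}
    (hφ : φ ∈ cochFil Q W (p + 1)) :
    cochD A W (cochHtpy W f D φ) + cochHtpy W f D (cochD B W φ) - (p : ℤ) • cochMap W f φ -
      (offDiag W f D φ.2, 0) ∈ cochFil P W p := by
  obtain ⟨h1, h2⟩ := mem_cochFil.mp hφ
  refine mem_cochFil.mpr ⟨?_, ?_⟩
  · have e1 : hbOp A W (contrOp W f D φ.1) + contrOp W f D (hbOp B W φ.1) ∈ seqFil P.P W p := by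
      -- The formula for the anticommutator of b with the contraction is only available after t has
      -- been applied.
      refine ttOp_fil_iff ?_
      rw [contrOp_hbOp]
      exact h.defectOp_fil (ttOp_fil (shiftOp_seqFil (fun k => fil_maps_mulHead Q k _) h1))
    have e2 := rowOp_sub f D φ.1
    have := add_mem e1 (h.lieOp_fil h1)
    convert this using 1
    rw [eq_sub_iff_add_eq] at e2
    simp only [cochD_apply, cochHtpy_apply, cochMap_apply, Prod.fst_sub, Prod.fst_add, map_add,
      map_sub, Prod.smul_fst, offDiag_apply, ← e2]
    abel
  · have e1 := contrOp_column f D φ.1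
    have e2 := sub_rowOp f D φ.2
    have := add_mem (neg_mem (h.defectOp_fil h1)) (h.lieOp_fil h2)
    convert this using 1
    rw [eq_sub_iff_add_eq] at e2
    simp only [cochD_apply, cochHtpy_apply, cochMap_apply, Prod.snd_sub, Prod.snd_add, map_add,
      map_sub, Prod.smul_snd, ← e1, ← e2]
    abel

/-- Cartan's formula for the full differential. The homotopy commutes with the differential of the
target, so only the signs change; the term that applies the homotopy to the coboundary of φ already
has filtration p. -/
theorem IsWeightMap.cartan_cochDiff (h : IsWeightMap P Q f D) (y : W ⟶ W) {s : ℤ}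
    (hs : s * s = 1) {p : ℕ} {φ : Coch B W} (hφ : φ ∈ cochFil Q W (p + 1))
    (hd : cochDiff B y s φ ∈ cochFil Q W p) :
    (p : ℤ) • cochMap W f φ + (offDiag W f D φ.2, 0) -
      s • cochDiff A y (-s) (cochHtpy W f D φ) ∈ cochFil P W p := by
  have h1 := h.cartan hφ
  have h2 := zsmul_mem (h.cochHtpy_fil hd) s
  have := neg_mem (add_mem h1 h2)
  convert this using 1
  simp only [cochDiff_apply, map_sub, map_zsmul, cochHtpy_cochPost, smul_sub, smul_neg, smul_smul, hs,
    neg_smul, one_smul]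
  abel

variable [Linear ℚ C]

theorem smul_mem_cochFil {p : ℕ} (q : ℚ) {φ : Coch A W} (h : φ ∈ cochFil P W p) :
    q • φ ∈ cochFil P W p := by
  have key : ∀ {c : Seq A.X W}, c ∈ seqFil P.P W p → q • c ∈ seqFil P.P W p := by
    intro c hc k T x hx
    have : x ≫ c k = 0 := hc k hx
    change x ≫ (q • c k) = 0
    rw [Linear.comp_smul, this, smul_zero]
  exact mem_cochFil.mpr ⟨key (mem_cochFil.mp h).1, key (mem_cochFil.mp h).2⟩

theorem smul_mem_bddCoch (q : ℚ) {φ : Coch A W} (h : φ ∈ bddCoch A W) :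
    q • φ ∈ bddCoch A W := by
  have key : ∀ {c : Seq A.X W}, c ∈ bddSeq A.X W → q • c ∈ bddSeq A.X W := by
    rintro c ⟨K, hK⟩
    exact ⟨K, fun k hk => by rw [Pi.smul_apply, hK k hk, smul_zero]⟩
  exact mem_bddCoch.mpr ⟨key (mem_bddCoch.mp h).1, key (mem_bddCoch.mp h).2⟩

/-- A cochain of filtration `p + 1` whose coboundary has filtration `p` is cohomologous to one of
filtration `p`, after two transfers that admit weight maps. -/
theorem exists_cochDiff_sub_mem {A' : Alg C} {P' : AlgFil A'} {f' : A' ⟶ A} {D' : A'.X ⟶ A.X}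
    (h : IsWeightMap P Q f D) (h' : IsWeightMap P' P f' D') {y : W ⟶ W} (hy : y ≫ y = 0) {s : ℤ}
    (hs : s * s = 1) {p : ℕ} (hp : p ≠ 0) {φ : Coch B W} (hφ : φ ∈ cochFil Q W (p + 1))
    (hd : cochDiff B y s φ ∈ cochFil Q W p) (hb : φ ∈ bddCoch B W) :
    ∃ ψ ∈ bddCoch A' W, cochMap W f' (cochMap W f φ) - cochDiff A' y (-s) ψ ∈ cochFil P' W p := by
  set z : Coch A W := (offDiag W f D φ.2, 0) with hz
  have h1 := h.cartan_cochDiff y hs hφ hd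
  rw [← hz] at h1
  have hz1 : z ∈ cochFil P W (p + 1) :=
    mem_cochFil.mpr ⟨h.offDiag_fil (mem_cochFil.mp hφ).2, zero_mem _⟩
  -- Applying the differential to `h1` removes the exact term and shows that dz is −p times the
  -- transfer of dφ modulo filtration p. Thus z satisfies the hypotheses of the second run.
  have hz2 : cochDiff A y s z ∈ cochFil P W p := by
    have := sub_mem (cochDiff_fil y s h1) (zsmul_mem (cochMap_fil h.map hd) (p : ℤ))
    convert this using 1
    rw [map_sub, map_add, map_zsmul, map_zsmul, cochDiff_cochDiff hy, cochMap_cochDiff, smul_zero,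
      sub_zero, add_sub_cancel_left]
  have hzb : z ∈ bddCoch A W := mem_bddCoch.mpr ⟨offDiag_bdd _ _ (mem_bddCoch.mp hb).2, zero_mem _⟩
  have h2 := h'.cartan_cochDiff y hs hz1 hz2
  -- The second run has no error term, since the second component of z is zero.
  have e0 : ((offDiag W f' D' z.2, 0) : Coch A' W) = 0 := by
    rw [hz]; simp
  rw [e0, add_zero] at h2
  have h3 := sub_mem (zsmul_mem (cochMap_fil h'.map h1) (p : ℤ)) h2
  -- Multiplying the first relation by p and subtracting the second one eliminates z; χ is the
  -- resulting primitive of p² times the transfer of φ.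
  set χ : Coch A' W := (s * p) • cochMap W f' (cochHtpy W f D φ) - s • cochHtpy W f' D' z with hχ
  have e : ((p : ℚ) ^ 2) • (cochMap W f' (cochMap W f φ)) - cochDiff A' y (-s) χ ∈
      cochFil P' W p := by
    convert h3 using 1
    have : ((p : ℚ) ^ 2) • (cochMap W f' (cochMap W f φ)) =
        (p : ℤ) • (p : ℤ) • (cochMap W f' (cochMap W f φ)) := by
      rw [← Int.cast_smul_eq_zsmul ℚ, ← Int.cast_smul_eq_zsmul ℚ, smul_smul, pow_two]
      simp
    rw [this, hχ, map_sub, map_sub, map_add, map_zsmul, map_zsmul, map_zsmul, map_zsmul,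
      cochMap_cochDiff, smul_sub, smul_add, smul_smul _ s, mul_comm (p : ℤ) s]
    abel
  have hdq : ∀ (q : ℚ) (ψ : Coch A' W), cochDiff A' y (-s) (q • ψ) = q • cochDiff A' y (-s) ψ :=
    fun q ψ => map_rat_smul (cochDiff A' y (-s)) q ψ
  refine ⟨((p : ℚ) ^ 2)⁻¹ • χ, smul_mem_bddCoch _ (sub_mem
    (zsmul_mem (cochMap_bdd _ (cochHtpy_bdd _ _ hb)) _)
    (zsmul_mem (cochHtpy_bdd _ _ hzb) _)), ?_⟩
  have := smul_mem_cochFil ((p : ℚ) ^ 2)⁻¹ e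
  rwa [smul_sub, smul_smul, inv_mul_cancel₀ (by positivity), one_smul, ← hdq] at this

end Filtered

end Cochains

/-! ### Sequential colimits of abelian groups and extension along pro-cofibrations -/

section Colimits

/-- ℕ lives in universe 0 whereas the groups live in universe v, so the preservation of filtered
colimits has to be restricted to smaller index categories. It gives access to representatives of
elements of colimits. -/
instance preservesColimit_forget_nat (F : ℕ ⥤ AddCommGrpCat.{v}) :
    PreservesColimit F (forget AddCommGrpCat.{v}) := by
  have : PreservesFilteredColimitsOfSize.{0, 0} (forget AddCommGrpCat.{v}) :=
    preservesFilteredColimitsOfSize_shrink.{0, v, 0, v} _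
  infer_instance

variable {C : Type u} [Category.{v} C] [Preadditive C]

/-- Maps on a level of a pro-object extend along a cofibration at a later level. -/
theorem exists_extension {X X' : ℕᵒᵖ ⥤ C} (f : X ⟶ X') {V : C}
    (h : Function.Surjective (proHomMap f V)) (m : ℕ) (g : X.obj (op m) ⟶ V) :
    ∃ (m' : ℕ) (hm : m ≤ m') (g' : X'.obj (op m') ⟶ V),
      f.app (op m') ≫ g' = X.map (homOfLE hm).op ≫ g := by
  let F := X.rightOp ⋙ preadditiveYoneda.obj V
  let F' := X'.rightOp ⋙ preadditiveYoneda.obj V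
  obtain ⟨z, hz⟩ := h (colimit.ι F m (g : X.obj (op m) ⟶ V))
  obtain ⟨n, (g' : X'.obj (op n) ⟶ V), rfl⟩ :=
    Concrete.isColimit_exists_rep F' (colimit.isColimit F') z
  have e : colimit.ι F n (f.app (op n) ≫ g' : X.obj (op n) ⟶ V) = colimit.ι F m g := by
    rw [← hz]
    have := ι_colimMap (Functor.whiskerRight (NatTrans.rightOp f) (preadditiveYoneda.obj V)) n
    exact (ConcreteCategory.congr_hom this g').symm
  -- The preimage of g is represented by g' at some level n, and the two classes agree only in the
  -- colimit; at level k they agree as maps.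
  obtain ⟨k, φ, ψ, hk⟩ := Concrete.isColimit_exists_of_rep_eq F (colimit.isColimit F) _ _ e
  refine ⟨k, leOfHom ψ, X'.map φ.op ≫ g', ?_⟩
  have h1 : X.map φ.op ≫ f.app (op n) ≫ g' = X.map ψ.op ≫ g := hk
  rw [← Category.assoc, ← f.naturality, Category.assoc, h1]
  rfl

end Colimits

/-! ### Construction of weight maps -/

section WeightMaps

variable {C : Type u} [Category.{v} C] [MonoidalCategory C] {A : ℕᵒᵖ ⥤ Alg C}

/-- The filtration of a level of a filtered pro-algebra. -/
def MultFiltration.level (F : MultFiltration A) (m : ℕᵒᵖ) : AlgFil (A.obj m) where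
  P i := F.F i m
  zero := F.zero m
  anti i := F.anti i m
  mul {i j S T a b} ha hb := by
    rw [← Subobject.factorThru_arrow _ a ha, ← Subobject.factorThru_arrow _ b hb,
      ← tensorHom_comp_tensorHom, Category.assoc]
    exact Subobject.factors_of_factors_right _ (F.mul i j m)

theorem MultFiltration.factors_map (F : MultFiltration A) {i : ℕ} {m n : ℕᵒᵖ} (φ : m ⟶ n) {T : C}
    {x : T ⟶ (A.obj m).X} (hx : (F.F i m).Factors x) : (F.F i n).Factors (x ≫ (A.map φ).hom) := by
  rw [← Subobject.factorThru_arrow _ x hx, Category.assoc]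
  exact Subobject.factors_of_factors_right _ (F.compat i φ)

/-- The transfer maps of the pieces of the filtration. -/
def MultFiltration.tr (F : MultFiltration A) (i : ℕ) {m n : ℕᵒᵖ} (φ : m ⟶ n) :
    (F.F i m : C) ⟶ (F.F i n : C) :=
  (F.F i n).factorThru ((F.F i m).arrow ≫ (A.map φ).hom) (F.compat i φ)

theorem MultFiltration.tr_arrow (F : MultFiltration A) {i : ℕ} {m n : ℕᵒᵖ} (φ : m ⟶ n) :
    F.tr i φ ≫ (F.F i n).arrow = (F.F i m).arrow ≫ (A.map φ).hom :=
  Subobject.factorThru_arrow _ _ (F.compat i φ)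

variable [Preadditive C]

/-- If the inclusions of the filtration are cofibrations and the filtration vanishes eventually at
the level `m`, then there are maps of the pieces of the filtration to the level `m` that multiply
elements of weight `j` by `j`, up to elements of weight `j + 1`. -/
theorem exists_weight_aux (F : MultFiltration A)
    (hcof : ∀ i V, Function.Surjective (proHomMap (F.incl i) V)) (m : ℕ) {N : ℕ}
    (hN : IsZero (F.F N (op m) : C)) : ∀ d i : ℕ, i + d = N → ∃ (m' : ℕ) (hm : m ≤ m')
      (E : (F.F i (op m') : C) ⟶ (F.F i (op m) : C)), ∀ j, i ≤ j → ∀ {T : C}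
      (x : T ⟶ (F.F i (op m') : C)), (F.F j (op m')).Factors (x ≫ (F.F i (op m')).arrow) →
      (F.F (j + 1) (op m)).Factors ((x ≫ E) ≫ (F.F i (op m)).arrow -
        (j : ℤ) • (x ≫ (F.F i (op m')).arrow) ≫ (A.map (homOfLE hm).op).hom)
  | 0, i, hi => by
    obtain rfl : i = N := by omega
    -- Since F_N A_m = 0, the zero map has the required property for all weights j ≥ N.
    refine ⟨m, le_rfl, (0 : (F.F i (op m) : C) ⟶ (F.F i (op m) : C)), fun j _ T x _ => ?_⟩
    have h1 : (x ≫ (F.F i (op m)).arrow) ≫ (A.map (homOfLE le_rfl).op).hom = 0 := by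
      rw [Category.assoc, ← F.tr_arrow, hN.eq_zero_of_tgt (F.tr i _), zero_comp,
        comp_zero]
    rw [h1, comp_zero, zero_comp, smul_zero, sub_zero]
    exact Subobject.factors_zero
  | d + 1, i, hi => by
    obtain ⟨m₁, hm₁, E', hE'⟩ := exists_weight_aux F hcof m hN d (i + 1) (by omega)
    -- The map E' − i on F_{i+1} is extended to F_i with values still in F_{i+1} A_m. Keeping this
    -- smaller target is what makes the correction invisible modulo F_{i+1}.
    obtain ⟨m₂, hm₂, G, hG⟩ : ∃ (m₂ : ℕ) (hm₂ : m₁ ≤ m₂)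
        (G : (F.F i (op m₂) : C) ⟶ (F.F (i + 1) (op m) : C)),
        Subobject.ofLE _ _ (F.anti i (op m₂)) ≫ G = F.tr (i + 1) (homOfLE hm₂).op ≫
          (E' - (i : ℤ) • F.tr (i + 1) (homOfLE hm₁).op) :=
      exists_extension (F.incl i) (hcof i (F.F (i + 1) (op m) : C)) m₁ _
    -- The new weight map is i + G: it is i modulo F_{i+1} on all of F_i, and i + (E' − i) = E' on
    -- F_{i+1}.
    refine ⟨m₂, hm₁.trans hm₂, (i : ℤ) • F.tr i (homOfLE (hm₁.trans hm₂)).op +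
      G ≫ Subobject.ofLE _ _ (F.anti i (op m)), fun j hj T x hx => ?_⟩
    have e1 : (x ≫ ((i : ℤ) • F.tr i (homOfLE (hm₁.trans hm₂)).op +
        G ≫ Subobject.ofLE _ _ (F.anti i (op m)))) ≫ (F.F i (op m)).arrow =
        (i : ℤ) • (x ≫ (F.F i (op m₂)).arrow) ≫ (A.map (homOfLE (hm₁.trans hm₂)).op).hom +
          x ≫ G ≫ (F.F (i + 1) (op m)).arrow := by
      rw [Preadditive.comp_add, Preadditive.add_comp, Preadditive.comp_zsmul,
        Preadditive.zsmul_comp, Category.assoc, F.tr_arrow, Category.assoc, Category.assoc,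
        Category.assoc, Subobject.ofLE_arrow]
    rw [e1]
    rcases eq_or_lt_of_le hj with rfl | hj'
    · rw [add_sub_cancel_left, ← Category.assoc]
      exact Subobject.factors_comp_arrow _
    · have hle : F.F j (op m₂) ≤ F.F (i + 1) (op m₂) :=
        antitone_nat_of_succ_le (f := fun i => F.F i (op m₂)) (fun i => F.anti i _) hj'
      obtain ⟨x', hx'⟩ : ∃ x' : T ⟶ (F.F (i + 1) (op m₂) : C),
          x = x' ≫ Subobject.ofLE _ _ (F.anti i (op m₂)) := by
        refine ⟨(F.F (i + 1) (op m₂)).factorThru _ (Subobject.factors_of_le _ hle hx), ?_⟩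
        rw [← cancel_mono (F.F i (op m₂)).arrow, Category.assoc, Subobject.ofLE_arrow,
          Subobject.factorThru_arrow]
      have e2 : (x' ≫ F.tr (i + 1) (homOfLE hm₂).op) ≫ (F.F (i + 1) (op m₁)).arrow =
          (x ≫ (F.F i (op m₂)).arrow) ≫ (A.map (homOfLE hm₂).op).hom := by
        rw [Category.assoc, F.tr_arrow, hx', Category.assoc, Category.assoc,
          Subobject.ofLE_arrow_assoc]
      have e3 : A.map (homOfLE (hm₁.trans hm₂)).op =
          A.map (homOfLE hm₂).op ≫ A.map (homOfLE hm₁).op := by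
        rw [← A.map_comp]
        rfl
      have e4 : x ≫ G = (x' ≫ F.tr (i + 1) (homOfLE hm₂).op) ≫
          (E' - (i : ℤ) • F.tr (i + 1) (homOfLE hm₁).op) := by
        rw [hx', Category.assoc, Category.assoc]
        exact congrArg (x' ≫ ·) hG
      have h := hE' j hj' (x' ≫ F.tr (i + 1) (homOfLE hm₂).op) (by
        rw [e2]
        exact F.factors_map _ hx)
      convert h using 1
      rw [← Category.assoc x, e4, Preadditive.comp_sub, Preadditive.sub_comp,
        Preadditive.comp_zsmul, Preadditive.zsmul_comp, Category.assoc _ _ (F.F (i + 1) _).arrow,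
        Category.assoc _ (F.tr (i + 1) (homOfLE hm₁).op), F.tr_arrow,
        ← Category.assoc _ (F.F (i + 1) (op m₁)).arrow, e2, e3, Alg.comp_hom]
      simp only [Category.assoc]
      abel

theorem exists_isWeightMap (F : MultFiltration A)
    (hcof : ∀ i V, Function.Surjective (proHomMap (F.incl i) V))
    (hbdd : ∀ m : ℕᵒᵖ, ∃ i : ℕ, IsZero (F.F i m : C)) (m : ℕ) :
    ∃ (m' : ℕ) (hm : m ≤ m') (D : (A.obj (op m')).X ⟶ (A.obj (op m)).X),
      IsWeightMap (F.level (op m')) (F.level (op m)) (A.map (homOfLE hm).op) D := by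
  obtain ⟨N, hN⟩ := hbdd (op m)
  obtain ⟨m', hm, E, hE⟩ := exists_weight_aux F hcof m hN N 0 (Nat.zero_add N)
  -- Since F_0 is the whole algebra, the map on F_0 is a map on A_{m'}.
  have : IsIso (F.F 0 (op m')).arrow := by rw [F.zero]; infer_instance
  refine ⟨m', hm, inv (F.F 0 (op m')).arrow ≫ E ≫ (F.F 0 (op m)).arrow,
    fun hx => F.factors_map _ hx, fun {j T x} hx => ?_⟩
  have h := hE j (Nat.zero_le j) (x ≫ inv (F.F 0 (op m')).arrow) (by
    rw [Category.assoc, IsIso.inv_hom_id, Category.comp_id]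
    exact hx)
  simp only [Category.assoc, IsIso.inv_hom_id_assoc] at h ⊢
  exact h

end WeightMaps

/-! ### Maps into and between the supercomplexes X^n M -/

section Tower

variable {C : Type u} [Category.{v} C] [Preadditive C] [HasCokernels C] [HasFiniteBiproducts C]

theorem Xdeg_injective {n : ℕ} : Function.Injective (Xdeg (n := n))
  | none, none, _ => rfl
  | none, some j, h => absurd j.2 (by change n = (j : ℕ) at h; omega)
  | some i, none, h => absurd i.2 (by change (i : ℕ) = n at h; omega)
  | some i, some j, h => congrArg some (Fin.ext h)

theorem exists_Xdeg_eq {n k : ℕ} (h : k ≤ n) : ∃ x : Option (Fin n), Xdeg x = k := by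
  rcases h.eq_or_lt with rfl | h
  · exact ⟨none, rfl⟩
  · exact ⟨some ⟨k, h⟩, rfl⟩

variable (M : MixedComplex C)

/-- The projection of a term of `X^n M` onto a summand. -/
def XPr (n : ℕ) (p : ZMod 2) (x : XIdx n p) : (XCx M n).X p ⟶ XObj M n x.1 :=
  biproduct.π (fun x : XIdx n p => XObj M n x.1) x

/-- The inclusion of a summand into a term of `X^n M`. -/
def XIn (n : ℕ) (p : ZMod 2) (x : XIdx n p) : XObj M n x.1 ⟶ (XCx M n).X p :=
  biproduct.ι (fun x : XIdx n p => XObj M n x.1) x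

/-- The map from a term of `X^n M` with given restrictions to the summands. -/
def XDesc {n : ℕ} {p : ZMod 2} {Z : C} (f : ∀ x : XIdx n p, XObj M n x.1 ⟶ Z) :
    (XCx M n).X p ⟶ Z :=
  biproduct.desc f

variable {M}

theorem XIn_XDesc {n : ℕ} {p : ZMod 2} {Z : C} (f : ∀ x : XIdx n p, XObj M n x.1 ⟶ Z)
    (x : XIdx n p) : XIn M n p x ≫ XDesc M f = f x := biproduct.ι_desc _ _

theorem XPr_ext {n : ℕ} {p : ZMod 2} {Z : C} {f g : Z ⟶ (XCx M n).X p}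
    (h : ∀ x, f ≫ XPr M n p x = g ≫ XPr M n p x) : f = g :=
  biproduct.hom_ext _ _ h

theorem XIn_ext {n : ℕ} {p : ZMod 2} {Z : C} {f g : (XCx M n).X p ⟶ Z}
    (h : ∀ x, XIn M n p x ≫ f = XIn M n p x ≫ g) : f = g :=
  biproduct.hom_ext' _ _ h

variable (M)

theorem XIn_XPr_self (n : ℕ) (p : ZMod 2) (x : XIdx n p) : XIn M n p x ≫ XPr M n p x = 𝟙 _ :=
  biproduct.ι_π_self _ _

theorem XIn_XPr_ne (n : ℕ) (p : ZMod 2) {x y : XIdx n p} (h : x ≠ y) :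
    XIn M n p x ≫ XPr M n p y = 0 :=
  biproduct.ι_π_ne _ h

theorem XIn_d_XPr (n : ℕ) {p p' : ZMod 2} (x : XIdx n p) (y : XIdx n p') :
    XIn M n p x ≫ (XCx M n).d p p' ≫ XPr M n p' y = XD M n x.1 y.1 := by
  change biproduct.ι (fun x : XIdx n p => XObj M n x.1) x ≫
    biproduct.matrix (fun (x : XIdx n p) (y : XIdx n p') => XD M n x.1 y.1) ≫
    biproduct.π (fun x : XIdx n p' => XObj M n x.1) y = _
  simp

/-- The canonical map `M_k ⟶ X^n M`, which vanishes for `k > n`, in the parity `p`. -/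
def toX (n k : ℕ) (p : ZMod 2) : M.cx.X k ⟶ (XCx M n).X p :=
  biproduct.lift fun x : XIdx n p => M.delta k (Xdeg x.1) ≫ Xq M n x.1

theorem toX_XPr (n k : ℕ) (p : ZMod 2) (x : XIdx n p) :
    toX M n k p ≫ XPr M n p x = M.delta k (Xdeg x.1) ≫ Xq M n x.1 :=
  biproduct.lift_π _ _

theorem toX_Xdeg (n : ℕ) (p : ZMod 2) (x : XIdx n p) :
    toX M n (Xdeg x.1) p = Xq M n x.1 ≫ XIn M n p x := by
  refine XPr_ext fun z => ?_
  rw [toX_XPr, Category.assoc]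
  by_cases h : x = z
  · subst h
    rw [XIn_XPr_self, M.delta_self, Category.id_comp, Category.comp_id]
  · rw [XIn_XPr_ne M n p h, M.delta_ne fun h' => h (Subtype.ext (Xdeg_injective h')), zero_comp,
      comp_zero]

theorem toX_eq_zero {n k : ℕ} (h : n < k) (p : ZMod 2) : toX M n k p = 0 := by
  refine XPr_ext fun z => ?_
  have := Xdeg_le z.1
  rw [toX_XPr, M.delta_ne (by omega), zero_comp, zero_comp]

/-- Nothing leaves M_l for l > n within X^n M: for l > n + 1 the targets have degree above n, and
for l = n + 1 only b reaches degree n, where its image has been divided out. -/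
theorem E_top_toX (n l : ℕ) (h : n < l) (k : ℕ) (p : ZMod 2) : M.E l k ≫ toX M n k p = 0 := by
  rcases lt_or_ge n k with hk | hk
  · rw [toX_eq_zero M hk, comp_zero]
  · rcases Nat.lt_or_ge (n + 1) l with hl | hl
    · rw [MixedComplex.E, M.d_zero l k (by omega), M.shape l k (by omega), add_zero, zero_comp]
    · obtain rfl : l = n + 1 := by omega
      refine XPr_ext fun z => ?_
      rw [Category.assoc, toX_XPr, zero_comp]
      by_cases hz : k = Xdeg z.1
      · subst hz
        rw [M.delta_self, Category.id_comp, E_Xq]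
      · rw [M.delta_ne hz, zero_comp, comp_zero]

/-- Says that the differential of X^n M is induced by b + B. The bound k + 2 is enough, as b + B has
no component from M_k to degrees above k + 1. -/
theorem toX_d (n k : ℕ) {p p' : ZMod 2} (hk : (k : ZMod 2) = p) :
    toX M n k p ≫ (XCx M n).d p p' =
      ∑ l ∈ Finset.range (k + 2), M.E k l ≫ toX M n l p' := by
  rcases lt_or_ge n k with h | h
  · rw [toX_eq_zero M h, zero_comp, Finset.sum_eq_zero fun l _ => E_top_toX M n k h l p']
  · obtain ⟨x, rfl⟩ := exists_Xdeg_eq h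
    refine XPr_ext fun z => ?_
    rw [toX_Xdeg M n p ⟨x, hk⟩, Category.assoc, Category.assoc, XIn_d_XPr, Xq_XD,
      Preadditive.sum_comp]
    simp only [Category.assoc, toX_XPr]
    rw [Finset.sum_eq_single (Xdeg z.1), M.delta_self, Category.id_comp]
    · intro l _ hl
      rw [M.delta_ne hl, zero_comp, comp_zero]
    · intro hz
      rw [Finset.mem_range, not_lt] at hz
      rw [MixedComplex.E, M.d_zero _ _ (by omega), M.shape _ _ (by omega), add_zero, zero_comp]

/-- A map `X^n M ⟶ X^{n'} N` that is induced by the maps `g_k : M_k ⟶ N_k`. -/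
def IsInduced {M N : MixedComplex C} {n n' : ℕ} (g : ∀ k, M.cx.X k ⟶ N.cx.X k)
    (u : XCx M n ⟶ XCx N n') : Prop :=
  ∀ (k : ℕ) (p : ZMod 2), toX M n k p ≫ u.f p = g k ≫ toX N n' k p

variable {M}

theorem IsInduced.comp {N P : MixedComplex C} {n n' n'' : ℕ} {g : ∀ k, M.cx.X k ⟶ N.cx.X k}
    {g' : ∀ k, N.cx.X k ⟶ P.cx.X k} {u : XCx M n ⟶ XCx N n'} {u' : XCx N n' ⟶ XCx P n''}
    (h : IsInduced g u) (h' : IsInduced g' u') : IsInduced (fun k => g k ≫ g' k) (u ≫ u') :=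
  fun k p => by
    rw [HomologicalComplex.comp_f, ← Category.assoc, h, Category.assoc, h', Category.assoc]

theorem isInduced_id (n : ℕ) : IsInduced (fun k => 𝟙 (M.cx.X k)) (𝟙 (XCx M n)) := fun k p => by
  rw [HomologicalComplex.id_f, Category.comp_id, Category.id_comp]

theorem MixedComplex.delta_map {N : MixedComplex C} (f : M ⟶ N) (i j : ℕ) :
    M.delta i j ≫ f.hom.f j = f.hom.f i ≫ N.delta i j := by
  by_cases h : i = j
  · subst h; rw [M.delta_self, N.delta_self, Category.id_comp, Category.comp_id]
  · rw [M.delta_ne h, N.delta_ne h, zero_comp, comp_zero]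

theorem isInduced_map {N : MixedComplex C} (f : M ⟶ N) (n : ℕ) :
    IsInduced (M := M) (N := N) (n := n) (n' := n) (fun k => f.hom.f k)
      ((XFunctor n).map f) := fun k p => by
  refine XPr_ext fun z => ?_
  have e : ((XFunctor n).map f).f p ≫ XPr N n p z = XPr M n p z ≫ XMapC f n z.1 :=
    biproduct.map_π (fun x : XIdx n p => XMapC f n x.1) z
  calc (toX M n k p ≫ ((XFunctor n).map f).f p) ≫ XPr N n p z
    _ = toX M n k p ≫ XPr M n p z ≫ XMapC f n z.1 :=
      (Category.assoc _ _ _).trans (congrArg (toX M n k p ≫ ·) e)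
    _ = (f.hom.f k ≫ toX N n k p) ≫ XPr N n p z := by
      rw [← Category.assoc, toX_XPr, Category.assoc, Xq_XMapC, ← Category.assoc,
        MixedComplex.delta_map, Category.assoc, Category.assoc, toX_XPr]

theorem isInduced_XTr (n : ℕ) :
    IsInduced (M := M) (N := M) (n := n + 1) (n' := n) (fun k => 𝟙 (M.cx.X k))
      ((XTr n).app M) := fun k p => by
  refine Eq.trans ?_ (Category.id_comp _).symm
  rcases lt_or_ge (n + 1) k with h | h
  · rw [toX_eq_zero M h, toX_eq_zero M (by omega)]
    exact zero_comp
  · obtain ⟨x, rfl⟩ := exists_Xdeg_eq h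
    refine XPr_ext fun z => ?_
    by_cases hx : (Xdeg x : ZMod 2) = p
    · have e : XIn M (n + 1) p ⟨x, hx⟩ ≫ ((XTr n).app M).f p ≫ XPr M n p z = XTrC M n x z.1 := by
        change biproduct.ι (fun x : XIdx (n + 1) p => XObj M (n + 1) x.1) ⟨x, hx⟩ ≫
          biproduct.matrix (fun (x : XIdx (n + 1) p) (y : XIdx n p) => XTrC M n x.1 y.1) ≫
          biproduct.π (fun x : XIdx n p => XObj M n x.1) z = _
        simp
      rw [toX_Xdeg M (n + 1) p ⟨x, hx⟩]
      calc ((Xq M (n + 1) x ≫ XIn M (n + 1) p ⟨x, hx⟩) ≫ ((XTr n).app M).f p) ≫ XPr M n p z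
        _ = Xq M (n + 1) x ≫ XTrC M n x z.1 := by
          rw [← e]
          exact (Category.assoc _ _ _).trans (Category.assoc _ _ _)
        _ = _ := by rw [Xq_XTrC, toX_XPr]
    -- In the wrong parity both sides are zero.
    · have e0 : ∀ n, toX M n (Xdeg x) p = 0 := fun n => XPr_ext fun z => by
        rw [toX_XPr, zero_comp, M.delta_ne fun h' => hx (by rw [h', z.2]), zero_comp]
      rw [e0, e0]
      exact congrArg (· ≫ XPr M n p z) zero_comp

theorem isInduced_tower {m n : ℕ} (h : m ≤ n) :
    IsInduced (M := M) (N := M) (n := n + 1) (n' := m + 1) (fun k => 𝟙 (M.cx.X k))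
      ((XTower.map (homOfLE h).op).app M) := by
  induction n, h using Nat.le_induction with
  | base =>
    have e : (XTower (C := C).map (homOfLE (le_refl m)).op).app M = 𝟙 _ := by
      rw [show (homOfLE (le_refl m)).op = 𝟙 (op m) from rfl, XTower.map_id]
      rfl
    intro k p
    have := isInduced_id (M := M) (m + 1) k p
    rw [e]
    exact this
  | succ n h ih =>
    have e : (XTower (C := C).map (homOfLE (Nat.le_succ_of_le h)).op).app M =
        (XTr (n + 1)).app M ≫ (XTower.map (homOfLE h).op).app M := by
      rw [show (homOfLE (Nat.le_succ_of_le h)).op =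
        (homOfLE (Nat.le_succ n)).op ≫ (homOfLE h).op from rfl, XTower.map_comp]
      have := Functor.ofOpSequence_map_homOfLE_succ (X := fun n => XFunctor (C := C) (n + 1))
        (fun n => XTr (n + 1)) n
      exact congrArg (fun t => NatTrans.app t M ≫ (XTower.map (homOfLE h).op).app M) this
    intro k p
    have h2 := (isInduced_XTr (M := M) (n + 1)).comp ih k p
    rw [e]
    exact h2.trans (congrArg (· ≫ toX M (m + 1) k p) (Category.id_comp _))

end Tower

/-! ### The total object of a supercomplex -/

section Total

variable {C : Type u} [Category.{v} C] [Preadditive C] [HasFiniteBiproducts C]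

/-- The total object of a supercomplex. -/
abbrev totObj (Y : SupComplex C) : C := ⨁ Y.X

/-- The differential on the total object of a supercomplex. -/
def totD (Y : SupComplex C) : totObj Y ⟶ totObj Y :=
  biproduct.desc fun q => Y.d q (q + 1) ≫ biproduct.ι Y.X (q + 1)

/-- The projection of the total object of a supercomplex onto one of the two summands. -/
def totProj (Y : SupComplex C) (q : ZMod 2) : totObj Y ⟶ totObj Y :=
  biproduct.π Y.X q ≫ biproduct.ι Y.X q

variable (Y : SupComplex C)

theorem ι_totD {q r : ZMod 2} (h : q + 1 = r) :
    biproduct.ι Y.X q ≫ totD Y = Y.d q r ≫ biproduct.ι Y.X r := by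
  subst h
  exact biproduct.ι_desc _ _

theorem totD_totD : totD Y ≫ totD Y = 0 := biproduct.hom_ext' _ _ fun q => by
  rw [← Category.assoc, ι_totD Y rfl, Category.assoc, ι_totD Y rfl, ← Category.assoc, Y.d_comp_d,
    zero_comp, comp_zero]

theorem totD_totProj {q r : ZMod 2} (h : q + 1 = r) :
    totD Y ≫ totProj Y r = totProj Y q ≫ totD Y := biproduct.hom_ext' _ _ fun t => by
  rw [← Category.assoc, ι_totD Y rfl, totProj, totProj, Category.assoc]
  by_cases ht : t = q
  · subst ht
    subst h
    rw [biproduct.ι_π_self_assoc, Category.assoc, biproduct.ι_π_self_assoc, ι_totD Y rfl]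
  · have : t + 1 ≠ r := fun h' => ht (add_right_cancel (h'.trans h.symm))
    rw [biproduct.ι_π_ne_assoc _ this, Category.assoc, biproduct.ι_π_ne_assoc _ ht, zero_comp,
      comp_zero, zero_comp]

theorem ι_totProj (q : ZMod 2) : biproduct.ι Y.X q ≫ totProj Y q = biproduct.ι Y.X q := by
  rw [totProj, biproduct.ι_π_self_assoc]

end Total

/-! ### Homogeneous maps on X^n M as sequences of maps on M -/

section GradedSequences

variable {C : Type u} [Category.{v} C] [Preadditive C] [HasCokernels C] [HasFiniteBiproducts C]
  {M : MixedComplex C} {n : ℕ} {Y : SupComplex C} {i : ZMod 2}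

/-- The maps from the terms of `M` to the total object of `Y` that correspond to a homogeneous
map `X^n M ⟶ Y`. -/
def gradedSeq (f : GradedHom (XCx M n) Y i) (k : ℕ) : M.cx.X k ⟶ totObj Y :=
  toX M n k k ≫ f ⟨((k : ZMod 2), k + i), rfl⟩ ≫ biproduct.ι Y.X (k + i)

theorem gradedSeq_eq (f : GradedHom (XCx M n) Y i) {k : ℕ} {p q : ZMod 2} (hk : (k : ZMod 2) = p)
    (h : p + i = q) : gradedSeq f k = toX M n k p ≫ f ⟨(p, q), h⟩ ≫ biproduct.ι Y.X q := by
  subst hk h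
  rfl

theorem gradedSeq_add (f g : GradedHom (XCx M n) Y i) (k : ℕ) :
    gradedSeq (f + g) k = gradedSeq f k + gradedSeq g k := by
  simp only [gradedSeq, Pi.add_apply, Preadditive.add_comp, Preadditive.comp_add]

/-- The maps M_k → X^n M are, up to the inclusion of a summand, the epimorphisms `Xq`, and the
summands of the total object are included by monomorphisms. -/
theorem gradedSeq_injective {f g : GradedHom (XCx M n) Y i}
    (h : ∀ k, gradedSeq f k = gradedSeq g k) : f = g := by
  funext ⟨⟨p, q⟩, hs⟩
  refine XIn_ext fun x => ?_
  have h1 := h (Xdeg x.1)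
  rw [gradedSeq_eq f x.2 hs, gradedSeq_eq g x.2 hs, toX_Xdeg] at h1
  simp only [Category.assoc] at h1
  have h2 := (cancel_epi _).mp h1
  simp only [← Category.assoc] at h2
  exact (cancel_mono _).mp h2

theorem gradedSeq_eq_zero (f : GradedHom (XCx M n) Y i) {k : ℕ} (h : n < k) :
    gradedSeq f k = 0 := by
  rw [gradedSeq, toX_eq_zero M h, zero_comp]

theorem E_gradedSeq_top (f : GradedHom (XCx M n) Y i) :
    M.E (n + 1) n ≫ gradedSeq f n = 0 := by
  rw [gradedSeq, ← Category.assoc, E_top_toX M n _ (by omega), zero_comp]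

theorem gradedSeq_totProj (f : GradedHom (XCx M n) Y i) (k : ℕ) :
    gradedSeq f k ≫ totProj Y (k + i) = gradedSeq f k := by
  simp only [gradedSeq, Category.assoc, ι_totProj]

/-- Under the passage to sequences the differential of Hom becomes composition with the total
differential minus the signed composition with b + B. Components with l of the same parity as k
contribute nothing to either side. -/
theorem gradedSeq_gradedD {j : ZMod 2} (hij : i + 1 = j) (f : GradedHom (XCx M n) Y i) (k : ℕ) :
    gradedSeq (gradedD _ Y i j hij f) k = gradedSeq f k ≫ totD Y -
      (-1 : ℤ) ^ i.val • ∑ l ∈ Finset.range (k + 2), M.E k l ≫ gradedSeq f l := by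
  have hq : (k : ZMod 2) + 1 + i = k + j := by rw [← hij]; ring
  rw [gradedSeq, gradedD_apply (XCx M n) Y i j hij f k (k + i) (k + j) rfl rfl hq,
    Preadditive.sub_comp, Preadditive.comp_sub, Preadditive.zsmul_comp, Preadditive.comp_zsmul]
  congr 1
  · rw [gradedSeq, Category.assoc, Category.assoc, Category.assoc,
      ι_totD Y (show (k : ZMod 2) + i + 1 = k + j by rw [← hij]; ring)]
  · rw [Category.assoc, ← Category.assoc, toX_d M n k rfl, Preadditive.sum_comp]
    congr 1
    refine Finset.sum_congr rfl fun l _ => ?_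
    rw [Category.assoc]
    by_cases hl : (k : ZMod 2) + 1 = l
    · rw [gradedSeq_eq f hl.symm hq]
    · rw [M.E_zero k l hl, zero_comp, zero_comp]

theorem gradedSeq_gradedPre {N : MixedComplex C} {n' : ℕ} {g : ∀ k, M.cx.X k ⟶ N.cx.X k}
    {u : XCx M n ⟶ XCx N n'} (h : IsInduced g u) (f : GradedHom (XCx N n') Y i) (k : ℕ) :
    gradedSeq (gradedPre u Y i f) k = g k ≫ gradedSeq f k := by
  have := congrArg (· ≫ f ⟨((k : ZMod 2), k + i), rfl⟩ ≫ biproduct.ι Y.X (k + i)) (h k k)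
  simp only [Category.assoc] at this
  simp only [gradedSeq]
  rw [← this]
  simp only [gradedPre, AddMonoidHom.mk'_apply, Category.assoc]

/-- The map from a summand of `X^n M` that corresponds to a sequence of maps on the terms of `M`. -/
def seqDesc {W : C} (g : ∀ k, M.cx.X k ⟶ W) (hg : M.cx.d (n + 1) n ≫ g n = 0) :
    ∀ x : Option (Fin n), XObj M n x ⟶ W
  | none => cokernel.desc (M.cx.d (n + 1) n) (g n) hg
  | some i => g i

theorem Xq_seqDesc {W : C} (g : ∀ k, M.cx.X k ⟶ W) (hg : M.cx.d (n + 1) n ≫ g n = 0) :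
    ∀ x : Option (Fin n), Xq M n x ≫ seqDesc g hg x = g (Xdeg x)
  | none => cokernel.π_desc (M.cx.d (n + 1) n) (g n) hg
  | some _ => Category.id_comp _

/-- The conditions on g are those needed to factor through X^n M. No homogeneity is assumed, so only
the degree i part of g is recovered. -/
theorem exists_gradedSeq (i : ZMod 2) (g : ∀ k, M.cx.X k ⟶ totObj Y)
    (hg : M.cx.d (n + 1) n ≫ g n = 0) (hg' : ∀ k, n < k → g k = 0) :
    ∃ f : GradedHom (XCx M n) Y i, ∀ k, gradedSeq f k = g k ≫ totProj Y (k + i) := by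
  let f : GradedHom (XCx M n) Y i := fun s =>
    XDesc M fun x => seqDesc g hg x.1 ≫ biproduct.π Y.X s.1.2
  refine ⟨f, fun k => ?_⟩
  rcases lt_or_ge n k with h | h
  · rw [gradedSeq_eq_zero _ h, hg' k h, zero_comp]
  · obtain ⟨x, rfl⟩ := exists_Xdeg_eq h
    have e : Xq M n x ≫ seqDesc g hg x = g (Xdeg x) := Xq_seqDesc g hg x
    rw [gradedSeq, toX_Xdeg M n _ ⟨x, rfl⟩, Category.assoc, ← Category.assoc (XIn M n _ _),
      XIn_XDesc, Category.assoc, ← Category.assoc, e]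
    rfl

end GradedSequences

/-! ### Maps on noncommutative forms as pairs of sequences -/

section FormSequences

variable {C : Type u} [Category.{v} C] [MonoidalCategory C] [SymmetricCategory C]
  [Preadditive C] [HasBinaryBiproducts C] [HasCokernels C]

/-- The inclusion of `A^{⊗(k+1)}` into `Ωᵏ A`. -/
def omInl (A : Alg C) : ∀ k, tpow A.X k ⟶ Om A k
  | 0 => 𝟙 (tpow A.X 0)
  | _ + 1 => biprod.inl

/-- The inclusion of `A^{⊗(k+1)}` into `Ω^{k+1} A`. -/
def omInr (A : Alg C) (k : ℕ) : tpow A.X k ⟶ Om A (k + 1) :=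
  (biprod.inr : _ ⟶ tpow A.X (k + 1) ⊞ tpow A.X k)

theorem omInl_OmB (A : Alg C) : ∀ k, omInl A k ≫ OmB A k = nm A.X k ≫ omInr A k
  | 0 => Category.id_comp _
  | _ + 1 => biprod.inl_desc _ _

theorem omInr_OmB (A : Alg C) (k : ℕ) : omInr A k ≫ OmB A (k + 1) = 0 := biprod.inr_desc _ _

theorem omInl_Omb (A : Alg C) : ∀ k, omInl A (k + 1) ≫ Omb A k = hb A k ≫ omInl A k
  | 0 => (biprod.inl_desc _ _).trans (Category.comp_id _).symm
  | _ + 1 => biprod.inl_desc _ _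

theorem omInr_Omb_zero (A : Alg C) : omInr A 0 ≫ Omb A 0 = 0 := biprod.inr_desc _ _

theorem omInr_Omb_succ (A : Alg C) (k : ℕ) : omInr A (k + 1) ≫ Omb A (k + 1) =
    (𝟙 _ - tt A.X (k + 1)) ≫ omInl A (k + 1) - bp A k ≫ omInr A k := biprod.inr_desc _ _

theorem omInl_OmMap {A B : Alg C} (f : A ⟶ B) :
    ∀ k, omInl A k ≫ OmMap f k = tpowMap f.hom k ≫ omInl B k
  | 0 => (Category.id_comp _).trans (Category.comp_id _).symm
  | _ + 1 => biprod.inl_map _ _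

theorem omInr_OmMap {A B : Alg C} (f : A ⟶ B) (k : ℕ) :
    omInr A k ≫ OmMap f (k + 1) = tpowMap f.hom k ≫ omInr B k := biprod.inr_map _ _

variable {A B : Alg C} {W : C}

/-- The restrictions of a sequence of maps on `Ω A` to the two summands of each term. -/
def ofForms (g : ∀ k, Om A k ⟶ W) : Coch A W :=
  (fun k => omInl A k ≫ g k, fun k => omInr A k ≫ g (k + 1))

/-- The sequence of maps on `Ω A` with given restrictions to the two summands of each term. -/
def toForms (φ : Coch A W) : ∀ k, Om A k ⟶ W
  | 0 => φ.1 0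
  | k + 1 => biprod.desc (φ.1 (k + 1)) (φ.2 k)

theorem ofForms_toForms (φ : Coch A W) : ofForms (toForms φ) = φ := by
  refine Prod.ext (funext fun k => ?_) (funext fun k => biprod.inr_desc _ _)
  cases k with
  | zero => exact Category.id_comp _
  | succ k => exact biprod.inl_desc _ _

theorem ofForms_injective {g g' : ∀ k, Om A k ⟶ W} (h : ofForms g = ofForms g') (k : ℕ) :
    g k = g' k := by
  have h1 := congrFun (congrArg Prod.fst h)
  have h2 := congrFun (congrArg Prod.snd h)
  cases k with
  | zero => exact (Category.id_comp _).symm.trans ((h1 0).trans (Category.id_comp _))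
  | succ k => exact biprod.hom_ext' _ _ (h1 (k + 1)) (h2 k)

variable (A) in
/-- The component `Ωᵏ A ⟶ Ωˡ A` of `b + B`. -/
def omE (k l : ℕ) : Om A k ⟶ Om A l := (Omega A).E k l

theorem omE_succ_right (k : ℕ) : omE A k (k + 1) = OmB A k := by
  change (Omega A).cx.d k (k + 1) + (Omega A).B k (k + 1) = OmB A k
  rw [(Omega A).d_zero k (k + 1) (by omega), zero_add]
  exact CochainComplex.of_d (Om A) (OmB A) k

theorem omE_succ_left (k : ℕ) : omE A (k + 1) k = Omb A k := by
  change (Omega A).cx.d (k + 1) k + (Omega A).B (k + 1) k = Omb A k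
  rw [(Omega A).shape (k + 1) k (by omega), add_zero]
  exact ChainComplex.of_d (Om A) (Omb A) k

theorem omE_eq_zero {k l : ℕ} (h : l + 1 ≠ k) (h' : k + 1 ≠ l) : omE A k l = 0 := by
  change (Omega A).cx.d k l + (Omega A).B k l = 0
  rw [(Omega A).shape k l h', add_zero, (Omega A).d_zero k l h]

/-- Composition with `b + B`. -/
def omD (g : ∀ k, Om A k ⟶ W) (k : ℕ) : Om A k ⟶ W :=
  ∑ l ∈ Finset.range (k + 2), omE A k l ≫ g l

theorem omD_zero (g : ∀ k, Om A k ⟶ W) : omD g 0 = OmB A 0 ≫ g 1 := by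
  rw [omD, Finset.sum_range_succ, Finset.sum_range_succ, Finset.sum_range_zero, zero_add,
    omE_eq_zero (by omega) (by omega), zero_comp, zero_add, ← omE_succ_right]

theorem omD_succ (g : ∀ k, Om A k ⟶ W) (k : ℕ) :
    omD g (k + 1) = Omb A k ≫ g k + OmB A (k + 1) ≫ g (k + 2) := by
  rw [← omE_succ_right, ← omE_succ_left]
  refine Finset.sum_eq_add k (k + 2) (by omega) (fun l _ hl => ?_) (fun h => ?_) (fun h => ?_)
  · rw [omE_eq_zero (by omega) (by omega), zero_comp]
  · exact absurd (Finset.mem_range.mpr (by omega)) h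
  · exact absurd (Finset.mem_range.mpr (by omega)) h

/-- Transposes the block form of b + B on A^{⊗(k+1)} ⊕ A^{⊗k}: the entries b, 1 − t and −b' come
from b, and the norm comes from B. -/
theorem ofForms_omD (g : ∀ k, Om A k ⟶ W) : ofForms (omD g) = cochD A W (ofForms g) := by
  refine Prod.ext (funext fun k => ?_) (funext fun k => ?_)
  · cases k with
    | zero =>
      change omInl A 0 ≫ omD g 0 = 0 + nm A.X 0 ≫ omInr A 0 ≫ g 1
      rw [omD_zero, ← Category.assoc, omInl_OmB, Category.assoc]
      exact (zero_add _).symm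
    | succ k =>
      change omInl A (k + 1) ≫ omD g (k + 1) =
        hb A k ≫ omInl A k ≫ g k + nm A.X (k + 1) ≫ omInr A (k + 1) ≫ g (k + 2)
      rw [omD_succ, Preadditive.comp_add, ← Category.assoc, omInl_Omb, Category.assoc,
        ← Category.assoc (omInl A (k + 1)), omInl_OmB, Category.assoc]
  · cases k with
    | zero =>
      change omInr A 0 ≫ omD g (0 + 1) = omInl A 0 ≫ g 0 - tt A.X 0 ≫ omInl A 0 ≫ g 0 - 0
      rw [omD_succ, Preadditive.comp_add, ← Category.assoc, omInr_Omb_zero,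
        ← Category.assoc (omInr A 0), omInr_OmB, tt_zero, Category.id_comp, zero_comp, zero_comp]
      simp
    | succ k =>
      change omInr A (k + 1) ≫ omD g (k + 1 + 1) =
        omInl A (k + 1) ≫ g (k + 1) - tt A.X (k + 1) ≫ omInl A (k + 1) ≫ g (k + 1) -
          bp A k ≫ omInr A k ≫ g (k + 1)
      rw [omD_succ, Preadditive.comp_add, ← Category.assoc, omInr_Omb_succ,
        ← Category.assoc (omInr A (k + 1)), omInr_OmB, zero_comp, add_zero, Preadditive.sub_comp,
        Preadditive.sub_comp, Preadditive.sub_comp, Category.id_comp, Category.assoc,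
        Category.assoc]

theorem ofForms_OmMap (f : A ⟶ B) (g : ∀ k, Om B k ⟶ W) :
    ofForms (fun k => OmMap f k ≫ g k) = cochMap W f (ofForms g) := by
  refine Prod.ext (funext fun k => ?_) (funext fun k => ?_)
  · change omInl A k ≫ OmMap f k ≫ g k = tpowMap f.hom k ≫ omInl B k ≫ g k
    rw [← Category.assoc, omInl_OmMap, Category.assoc]
  · change omInr A k ≫ OmMap f (k + 1) ≫ g (k + 1) = tpowMap f.hom k ≫ omInr B k ≫ g (k + 1)
    rw [← Category.assoc, omInr_OmMap, Category.assoc]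

end FormSequences

/-! ### Comparison of homogeneous maps with cochains -/

section GradedCochains

variable {C : Type u} [Category.{v} C] [MonoidalCategory C] [SymmetricCategory C]
  [Preadditive C] [HasCokernels C] [HasFiniteBiproducts C] {A B : Alg C} {n : ℕ}
  {Y : SupComplex C} {i : ZMod 2}

/-- The maps on the forms of `A` that correspond to a homogeneous map `X^n (Ω A) ⟶ Y`. -/
def formsOf (f : GradedHom (XCx (Omega A) n) Y i) (k : ℕ) : Om A k ⟶ totObj Y := gradedSeq f k

/-- The maps on tensor powers of `A` that correspond to a homogeneous map `X^n (Ω A) ⟶ Y`. -/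
def cochOf : GradedHom (XCx (Omega A) n) Y i →+ Coch A (totObj Y) :=
  AddMonoidHom.mk' (fun f => ofForms (formsOf f)) fun f g => by
    have : formsOf (f + g) = fun k => formsOf f k + formsOf g k :=
      funext (gradedSeq_add f g)
    rw [this]
    exact Prod.ext (funext fun k => Preadditive.comp_add _ _ _ _ _ _)
      (funext fun k => Preadditive.comp_add _ _ _ _ _ _)

theorem cochOf_apply (f : GradedHom (XCx (Omega A) n) Y i) : cochOf f = ofForms (formsOf f) := rfl

theorem cochOf_injective :
    Function.Injective (cochOf : GradedHom (XCx (Omega A) n) Y i →+ Coch A (totObj Y)) :=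
  fun _ _ h => gradedSeq_injective (ofForms_injective h)

theorem formsOf_gradedD {j : ZMod 2} (hij : i + 1 = j) (f : GradedHom (XCx (Omega A) n) Y i)
    (k : ℕ) : formsOf (gradedD _ Y i j hij f) k =
      formsOf f k ≫ totD Y - (-1 : ℤ) ^ i.val • omD (formsOf f) k := gradedSeq_gradedD hij f k

/-- Lets the cochain calculus, which ignores n and the grading, be applied to Hom(X^n(ΩA), Y). -/
theorem cochOf_gradedD {j : ZMod 2} (hij : i + 1 = j) (f : GradedHom (XCx (Omega A) n) Y i) :
    cochOf (gradedD _ Y i j hij f) = cochDiff A (totD Y) ((-1) ^ i.val) (cochOf f) := by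
  rw [cochDiff_apply, cochOf_apply, cochOf_apply, ← ofForms_omD, funext (formsOf_gradedD hij f)]
  refine Prod.ext (funext fun k => ?_) (funext fun k => ?_)
  · refine (Preadditive.comp_sub _ _ _).trans (congrArg₂ _ ?_ ?_)
    · exact (Category.assoc _ _ _).symm
    · exact Preadditive.comp_zsmul _ _ _
  · refine (Preadditive.comp_sub _ _ _).trans (congrArg₂ _ ?_ ?_)
    · exact (Category.assoc _ _ _).symm
    · exact Preadditive.comp_zsmul _ _ _

theorem cochOf_gradedPre {n' : ℕ} {g : A ⟶ B} {u : XCx (Omega A) n ⟶ XCx (Omega B) n'}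
    (h : IsInduced (M := Omega A) (N := Omega B) (OmMap g) u)
    (f : GradedHom (XCx (Omega B) n') Y i) :
    cochOf (gradedPre u Y i f) = cochMap (totObj Y) g (cochOf f) := by
  have e : formsOf (gradedPre u Y i f) = fun k => OmMap g k ≫ formsOf f k :=
    funext (gradedSeq_gradedPre h f)
  rw [cochOf_apply, cochOf_apply, e, ofForms_OmMap]

theorem cochOf_apply_eq_zero (f : GradedHom (XCx (Omega A) n) Y i) {k : ℕ} (h : n < k) :
    (cochOf f).1 k = 0 ∧ (cochOf f).2 k = 0 := by
  constructor
  · exact (congrArg (omInl A k ≫ ·) (gradedSeq_eq_zero f h)).trans comp_zero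
  · exact (congrArg (omInr A k ≫ ·) (gradedSeq_eq_zero f (by omega))).trans comp_zero

theorem cochOf_bdd (f : GradedHom (XCx (Omega A) n) Y i) : cochOf f ∈ bddCoch A (totObj Y) :=
  mem_bddCoch.mpr ⟨⟨n + 1, fun _ hk => (cochOf_apply_eq_zero f hk).1⟩,
    ⟨n + 1, fun _ hk => (cochOf_apply_eq_zero f hk).2⟩⟩

variable (A Y) in
/-- The homogeneous component of degree `i`. -/
def cochPr (i : ZMod 2) : Coch A (totObj Y) →+ Coch A (totObj Y) :=
  AddMonoidHom.mk' (fun φ => (fun k => φ.1 k ≫ totProj Y (k + i),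
    fun k => φ.2 k ≫ totProj Y (k + 1 + i))) fun _ _ =>
    Prod.ext (funext fun _ => Preadditive.add_comp _ _ _ _ _ _)
      (funext fun _ => Preadditive.add_comp _ _ _ _ _ _)

theorem cochPr_ofForms (g : ∀ k, Om A k ⟶ totObj Y) :
    cochPr A Y i (ofForms g) = ofForms fun k => g k ≫ totProj Y (k + i) := by
  refine Prod.ext (funext fun k => Category.assoc _ _ _) (funext fun k => ?_)
  change (omInr A k ≫ g (k + 1)) ≫ totProj Y (k + 1 + i) =
    omInr A k ≫ g (k + 1) ≫ totProj Y ((k + 1 : ℕ) + i)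
  rw [Category.assoc, Nat.cast_add, Nat.cast_one]

theorem cochPr_cochOf (f : GradedHom (XCx (Omega A) n) Y i) :
    cochPr A Y i (cochOf f) = cochOf f := by
  rw [cochOf_apply, cochPr_ofForms]
  exact congrArg ofForms (funext (gradedSeq_totProj f))

theorem cochPr_cochMap (f : A ⟶ B) (φ : Coch B (totObj Y)) :
    cochPr A Y i (cochMap _ f φ) = cochMap _ f (cochPr B Y i φ) :=
  Prod.ext (funext fun _ => Category.assoc _ _ _) (funext fun _ => Category.assoc _ _ _)

/-- The total differential of Y raises parity by one and b + B changes the form degree by ±1, which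
agree modulo 2. So homogeneous parts may be taken in any cobounding relation. -/
theorem cochPr_cochDiff {j : ZMod 2} (hij : i + 1 = j) (s : ℤ) (φ : Coch A (totObj Y)) :
    cochPr A Y j (cochDiff A (totD Y) s φ) = cochDiff A (totD Y) s (cochPr A Y i φ) := by
  have h1 : cochPr A Y j (cochPost A (totD Y) φ) = cochPost A (totD Y) (cochPr A Y i φ) := by
    refine Prod.ext (funext fun k => ?_) (funext fun k => ?_)
    · change (φ.1 k ≫ totD Y) ≫ totProj Y (k + j) = (φ.1 k ≫ totProj Y (k + i)) ≫ totD Y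
      rw [Category.assoc, totD_totProj Y (q := k + i) (by rw [← hij]; ring), Category.assoc]
    · change (φ.2 k ≫ totD Y) ≫ totProj Y (k + 1 + j) = (φ.2 k ≫ totProj Y (k + 1 + i)) ≫ totD Y
      rw [Category.assoc, totD_totProj Y (q := k + 1 + i) (by rw [← hij]; ring), Category.assoc]
  have h2 : cochPr A Y j (cochD A _ φ) = cochD A _ (cochPr A Y i φ) := by
    have e : ∀ k : ℕ, (k : ZMod 2) + 1 + i = k + j := fun k => by rw [← hij]; ring
    have e' : ∀ k : ℕ, ((k + 1 : ℕ) : ZMod 2) + j = k + i := fun k => by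
      rw [← hij, Nat.cast_add, Nat.cast_one]
      have : (1 : ZMod 2) + 1 = 0 := rfl
      linear_combination this
    have e'' : ∀ k : ℕ, (k : ZMod 2) + 1 + j = k + i := fun k => by
      rw [← e' k, Nat.cast_add, Nat.cast_one]
    refine Prod.ext (funext fun k => ?_) (funext fun k => ?_)
    · cases k with
      | zero =>
        change (0 + nm A.X 0 ≫ φ.2 0) ≫ totProj Y ((0 : ℕ) + j) =
          0 + nm A.X 0 ≫ φ.2 0 ≫ totProj Y ((0 : ℕ) + 1 + i)
        rw [zero_add, zero_add, e, Category.assoc]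
      | succ k =>
        change (hb A k ≫ φ.1 k + nm A.X (k + 1) ≫ φ.2 (k + 1)) ≫ totProj Y ((k + 1 : ℕ) + j) =
          hb A k ≫ φ.1 k ≫ totProj Y (k + i) +
            nm A.X (k + 1) ≫ φ.2 (k + 1) ≫ totProj Y ((k + 1 : ℕ) + 1 + i)
        rw [e, Preadditive.add_comp, Category.assoc, Category.assoc, e']
    · cases k with
      | zero =>
        change (φ.1 0 - tt A.X 0 ≫ φ.1 0 - 0) ≫ totProj Y ((0 : ℕ) + 1 + j) =
          φ.1 0 ≫ totProj Y ((0 : ℕ) + i) - tt A.X 0 ≫ φ.1 0 ≫ totProj Y ((0 : ℕ) + i) - 0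
        rw [e'', sub_zero, sub_zero, Preadditive.sub_comp, Category.assoc]
      | succ k =>
        change (φ.1 (k + 1) - tt A.X (k + 1) ≫ φ.1 (k + 1) - bp A k ≫ φ.2 k) ≫
            totProj Y ((k + 1 : ℕ) + 1 + j) =
          φ.1 (k + 1) ≫ totProj Y ((k + 1 : ℕ) + i) -
            tt A.X (k + 1) ≫ φ.1 (k + 1) ≫ totProj Y ((k + 1 : ℕ) + i) -
            bp A k ≫ φ.2 k ≫ totProj Y (k + 1 + i)
        rw [e'', Preadditive.sub_comp, Preadditive.sub_comp, Category.assoc, Category.assoc,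
          Nat.cast_add, Nat.cast_one]
  rw [cochDiff_apply, cochDiff_apply, map_sub, map_zsmul, h1, h2]

theorem cochPr_fil {P : AlgFil A} {p : ℕ} {φ : Coch A (totObj Y)}
    (h : φ ∈ cochFil P (totObj Y) p) : cochPr A Y i φ ∈ cochFil P (totObj Y) p := by
  have aux : ∀ {k : ℕ} {c : tpow A.X k ⟶ totObj Y} (e : totObj Y ⟶ totObj Y),
      (Fil P.P k p).Maps c (SubRep.zero _) → (Fil P.P k p).Maps (c ≫ e) (SubRep.zero _) :=
    fun e hc => hc.comp (S'' := SubRep.zero _) fun T x (hx : x = 0) => by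
      change x ≫ e = 0
      rw [hx, zero_comp]
  exact mem_cochFil.mpr ⟨fun k => aux _ ((mem_cochFil.mp h).1 k),
    fun k => aux _ ((mem_cochFil.mp h).2 k)⟩

/-- Here φ need not be homogeneous; its part of degree i factors through X^n as soon as φ respects
the relations of X^n. -/
theorem exists_cochOf_eq (i : ZMod 2) (φ : Coch A (totObj Y)) (h : Omb A n ≫ toForms φ n = 0)
    (h' : ∀ k, n < k → toForms φ k = 0) :
    ∃ f : GradedHom (XCx (Omega A) n) Y i, cochOf f = cochPr A Y i φ := by
  have hd : (Omega A).cx.d (n + 1) n = Omb A n := ChainComplex.of_d (Om A) (Omb A) n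
  obtain ⟨f, hf⟩ := exists_gradedSeq (M := Omega A) (n := n) i (toForms φ) (by rw [hd]; exact h) h'
  refine ⟨f, ?_⟩
  have e : formsOf f = fun k => toForms φ k ≫ totProj Y (k + i) := funext hf
  rw [cochOf_apply, e]
  conv_rhs => rw [← ofForms_toForms φ, cochPr_ofForms]

/-- A cochain that vanishes in high degrees lives on X^(n+1) for large n: it is zero in the top
degree n + 1, so the condition on the quotient by b holds trivially. -/
theorem exists_cochOf_eq_of_bdd (i : ZMod 2) {φ : Coch A (totObj Y)} {n : ℕ}
    (h : ∀ k, n ≤ k + 1 → φ.1 k = 0 ∧ φ.2 k = 0) :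
    ∃ f : GradedHom (XCx (Omega A) (n + 1)) Y i, cochOf f = cochPr A Y i φ := by
  have h0 : ∀ k, n < k → toForms φ k = 0 := fun k hk => by
    cases k with
    | zero => omega
    | succ k =>
      refine biprod.hom_ext' _ _ ?_ ?_
      · exact (biprod.inl_desc _ _).trans ((h (k + 1) (by omega)).1.trans comp_zero.symm)
      · exact (biprod.inr_desc _ _).trans ((h k (by omega)).2.trans comp_zero.symm)
  exact exists_cochOf_eq i φ (by rw [h0 _ (Nat.lt_succ_self n), comp_zero]) fun k hk => h0 k (by omega)

end GradedCochains

/-! ### Descent of maps along tensor powers of a cokernel -/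

section Descent

variable {C : Type u} [Category.{v} C] [MonoidalCategory C] [Preadditive C] [MonoidalPreadditive C]
  [HasCokernels C] [TensorPreservesCokernels C]

theorem tensor_cokernel_mid (V W : C) {X Y Z : C} (f : X ⟶ Y) (g : (V ⊗ Y) ⊗ W ⟶ Z)
    (w : (V ◁ f) ▷ W ≫ g = 0) :
    ∃ h : (V ⊗ cokernel f) ⊗ W ⟶ Z, (V ◁ cokernel.π f) ▷ W ≫ h = g := by
  have := TensorPreservesCokernels.left V f
  have := TensorPreservesCokernels.right W ((tensorLeft V).map f)
  have hc := CokernelCofork.mapIsColimit _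
    (CokernelCofork.mapIsColimit _ (cokernelIsCokernel f) (tensorLeft V)) (tensorRight W)
  exact ⟨hc.desc (CokernelCofork.ofπ g w), hc.fac _ WalkingParallelPair.one⟩

variable {X : C} {P : ℕ → Subobject X}

theorem whiskerLeft_tpowMap_succ {Y : C} (π : X ⟶ Y) (Z : C) (n : ℕ) :
    (Z ◁ tpowMap π (n + 1) : Z ⊗ (X ⊗ tpow X n) ⟶ Z ⊗ (Y ⊗ tpow Y n)) =
      (α_ Z X (tpow X n)).inv ≫ (Z ◁ π) ▷ tpow X n ≫ (Z ⊗ Y) ◁ tpowMap π n ≫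
        (α_ Z Y (tpow Y n)).hom := by
  change Z ◁ (π ⊗ₘ tpowMap π n) = _
  rw [MonoidalCategory.tensorHom_def]
  simp

/-- The spare factor Z stores the tensor factors already replaced by the quotient, so that the
induction can replace one factor at a time; Z = k recovers the plain statement. -/
theorem whiskerLeft_tpowMap_epi {X₁ : C} (ι : X₁ ⟶ X) :
    ∀ (n : ℕ) (Z : C), Epi (Z ◁ tpowMap (cokernel.π ι) n)
  | 0, Z => MultFiltration.tensor_cokernel_left_epi Z ι
  | n + 1, Z => by
    have h1 := whiskerLeft_tpowMap_epi ι n (Z ⊗ cokernel ι)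
    have h2 := MultFiltration.tensor_cokernel_mid_epi Z (tpow X n) ι
    have h3 := whiskerLeft_tpowMap_succ (cokernel.π ι) Z n
    have h4 : Epi ((α_ Z X (tpow X n)).inv ≫ (Z ◁ cokernel.π ι) ▷ tpow X n ≫
        (Z ⊗ cokernel ι) ◁ tpowMap (cokernel.π ι) n ≫
        (α_ Z (cokernel ι) (tpow (cokernel ι) n)).hom) := inferInstance
    rw [← h3] at h4
    exact h4

theorem tpowMap_epi {X₁ : C} (ι : X₁ ⟶ X) (n : ℕ) : Epi (tpowMap (cokernel.π ι) n) := by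
  have h := whiskerLeft_tpowMap_epi ι n (𝟙_ C)
  have e : tpowMap (cokernel.π ι) n =
      (λ_ _).inv ≫ 𝟙_ C ◁ tpowMap (cokernel.π ι) n ≫ (λ_ _).hom := by
    simp
  rw [e]
  infer_instance

/-- One factor is divided out at a time, with Z as storage for the quotient factors. Weight 1
tensors with the weight in the head allow descent in the first factor, those with the weight in the
tail feed the induction. -/
theorem exists_whiskerLeft_tpowMap_comp (h0 : P 0 = ⊤) {W : C} :
    ∀ (n : ℕ) (Z : C) (φ : Z ⊗ tpow X n ⟶ W),
      (∀ ⦃T : C⦄ ⦃x : T ⟶ tpow X n⦄, IsGen P n 1 x → Z ◁ x ≫ φ = 0) →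
      ∃ ψ : Z ⊗ tpow (cokernel (P 1).arrow) n ⟶ W,
        Z ◁ tpowMap (cokernel.π (P 1).arrow) n ≫ ψ = φ
  | 0, Z, φ, h => MultFiltration.tensor_cokernel_left Z (P 1).arrow φ
      (h (x := (P 1).arrow) ((P 1).factors_self))
  | n + 1, Z, φ, h => by
    have htop : ∀ n, IsGen P n 0 (𝟙 (tpow X n)) := by
      have hf : (P 0).Factors (𝟙 X) := by rw [h0]; exact Subobject.top_factors _
      intro n
      induction n with
      | zero => exact hf
      | succ n ih =>
        have := IsGen.tensor hf ih
        rw [MonoidalCategory.tensorHom_def, MonoidalCategory.whiskerLeft_id,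
          MonoidalCategory.id_whiskerRight, Category.comp_id] at this
        exact this
    obtain ⟨φ', hφ'⟩ : ∃ φ' : Z ⊗ (X ⊗ tpow X n) ⟶ W, φ' = φ := ⟨φ, rfl⟩
    have h' : ∀ ⦃T₁ T₂ : C⦄ ⦃a : T₁ ⟶ X⦄ ⦃b : T₂ ⟶ tpow X n⦄ ⦃i j : ℕ⦄, i + j = 1 →
        (P i).Factors a → IsGen P n j b → Z ◁ (a ⊗ₘ b) ≫ φ' = 0 := fun T₁ T₂ a b i j hij ha hb => by
      rw [hφ']
      have := IsGen.tensor ha hb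
      rw [hij] at this
      exact h this
    have h0' : (P 0).Factors (𝟙 X) := by rw [h0]; exact Subobject.top_factors _
    -- Descent in the first factor of X uses tensors of weights 1 + 0, with the identity of the tail
    -- as the element of weight 0.
    obtain ⟨φ₁, h₁⟩ := tensor_cokernel_mid Z (tpow X n) (P 1).arrow
      ((α_ Z X (tpow X n)).hom ≫ φ') (by
        have := h' (add_zero 1) (P 1).factors_self (htop n)
        rw [MonoidalCategory.tensorHom_id] at this
        rw [associator_naturality_middle_assoc, this, comp_zero])
    -- For the tail, tensors of weights 0 + 1 are used. The vanishing of φ₁ on them may be checked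
    -- after the projection of the first factor, which is an epimorphism also after tensoring.
    obtain ⟨ψ, hψ⟩ := exists_whiskerLeft_tpowMap_comp h0 n (Z ⊗ cokernel (P 1).arrow) φ₁
      fun T x hx => by
        have := MultFiltration.tensor_cokernel_mid_epi Z T (P 1).arrow
        have h2 := h' (zero_add 1) h0' hx
        rw [MonoidalCategory.id_tensorHom] at h2
        rw [← cancel_epi ((Z ◁ cokernel.π (P 1).arrow) ▷ T), comp_zero,
          ← whisker_exchange_assoc, h₁, associator_naturality_right_assoc, h2, comp_zero]
    refine ⟨(α_ _ _ _).inv ≫ ψ, ?_⟩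
    have e := whiskerLeft_tpowMap_succ (cokernel.π (P 1).arrow) Z n
    have e2 : (α_ Z X (tpow X n)).inv ≫ (Z ◁ cokernel.π (P 1).arrow) ▷ tpow X n ≫
        (Z ⊗ cokernel (P 1).arrow) ◁ tpowMap (cokernel.π (P 1).arrow) n ≫ ψ = φ' := by
      rw [hψ, h₁, Iso.inv_hom_id_assoc]
    rw [← hφ', ← e2]
    refine (congrArg (· ≫ (α_ _ _ _).inv ≫ ψ) e).trans ?_
    simp only [Category.assoc, Iso.hom_inv_id_assoc]

theorem exists_tpowMap_comp (h0 : P 0 = ⊤) {W : C} (n : ℕ) (φ : tpow X n ⟶ W)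
    (h : (Fil P n 1).Maps φ (SubRep.zero W)) :
    ∃ ψ : tpow (cokernel (P 1).arrow) n ⟶ W, tpowMap (cokernel.π (P 1).arrow) n ≫ ψ = φ := by
  obtain ⟨ψ, hψ⟩ := exists_whiskerLeft_tpowMap_comp h0 n (𝟙_ C) ((λ_ _).hom ≫ φ) fun T x hx => by
    rw [leftUnitor_naturality_assoc, SubRep.maps_zero_iff.mp h hx.mem, comp_zero]
  refine ⟨(λ_ _).inv ≫ ψ, ?_⟩
  rw [leftUnitor_inv_naturality_assoc, hψ, Iso.inv_hom_id_assoc]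

end Descent

/-! ### Cochains of filtration 1 and the quotient algebra -/

section Descent

variable {C : Type u} [Category.{v} C] [MonoidalCategory C] [SymmetricCategory C] [Preadditive C]
  [MonoidalPreadditive C] [HasCokernels C] [TensorPreservesCokernels C]
  {A : ℕᵒᵖ ⥤ Alg C} (F : MultFiltration A) {W : C}

/-- A tensor of positive total weight has a factor of positive weight, and this factor dies in A/F_1
A. -/
theorem MultFiltration.isGen_comp_quotπ (m : ℕᵒᵖ) : ∀ {n w : ℕ} {T : C} {x : T ⟶ tpow (A.obj m).X n},
    w ≠ 0 → IsGen (F.level m).P n w x → x ≫ tpowMap (F.quotπ m) n = 0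
  | 0, w, T, x, hw, hx => F.factors_quotπ m _ (Subobject.factors_of_le _
      (antitone_nat_of_succ_le (F.level m).anti (Nat.one_le_iff_ne_zero.mpr hw)) hx)
  | n + 1, w, T, x, hw, hx => by
    obtain ⟨T₁, T₂, c, i, j, a, b, hij, ha, hb, rfl⟩ := hx
    have key : (a ⊗ₘ b) ≫ (F.quotπ m ⊗ₘ tpowMap (F.quotπ m) n) = 0 := by
      rw [tensorHom_comp_tensorHom]
      by_cases hi : i = 0
      · rw [MultFiltration.isGen_comp_quotπ m (by omega) hb, MonoidalPreadditive.tensor_zero]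
      · rw [F.factors_quotπ m a (Subobject.factors_of_le _
          (antitone_nat_of_succ_le (F.level m).anti (Nat.one_le_iff_ne_zero.mpr hi)) ha),
          MonoidalPreadditive.zero_tensor]
    exact (Category.assoc _ _ _).trans ((congrArg (c ≫ ·) key).trans comp_zero)

theorem MultFiltration.cochMap_quotHom_mem (m : ℕᵒᵖ) (χ : Coch (F.quotAlg m) W) :
    cochMap W (F.quotHom m) χ ∈ cochFil (F.level m) W 1 := by
  have aux : ∀ n (c : tpow (F.quotX m) n ⟶ W),
      (Fil (F.level m).P n 1).Maps (tpowMap (F.quotπ m) n ≫ c) (SubRep.zero W) := fun n c =>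
    fil_maps_of_gen fun T x hx => by
      change x ≫ tpowMap (F.quotπ m) n ≫ c = 0
      rw [← Category.assoc, F.isGen_comp_quotπ m one_ne_zero hx, zero_comp]
  exact mem_cochFil.mpr ⟨fun n => aux n _, fun n => aux n _⟩

theorem MultFiltration.exists_cochMap_quotHom (m : ℕᵒᵖ) {φ : Coch (A.obj m) W}
    (h : φ ∈ cochFil (F.level m) W 1) : ∃ χ, cochMap W (F.quotHom m) χ = φ := by
  choose χ₁ h₁ using fun n => exists_tpowMap_comp (P := (F.level m).P) (F.zero m) n (φ.1 n)
    ((mem_cochFil.mp h).1 n)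
  choose χ₂ h₂ using fun n => exists_tpowMap_comp (P := (F.level m).P) (F.zero m) n (φ.2 n)
    ((mem_cochFil.mp h).2 n)
  exact ⟨(χ₁, χ₂), Prod.ext (funext h₁) (funext h₂)⟩

theorem MultFiltration.cochMap_quotHom_injective (m : ℕᵒᵖ) :
    Function.Injective (cochMap W (F.quotHom m)) := fun χ χ' h => by
  have h1 := congrFun (congrArg Prod.fst h)
  have h2 := congrFun (congrArg Prod.snd h)
  exact Prod.ext
    (funext fun n => (tpowMap_epi (F.F 1 m).arrow n).left_cancellation _ _ (h1 n))
    (funext fun n => (tpowMap_epi (F.F 1 m).arrow n).left_cancellation _ _ (h2 n))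

variable [HasFiniteBiproducts C]

/-- Used to see that a cochain on the quotient respects the relations of X^n as soon as its pullback
does. -/
theorem OmMap_quotHom_epi (m : ℕᵒᵖ) : ∀ n, Epi (OmMap (F.quotHom m) n)
  | 0 => tpowMap_epi (F.F 1 m).arrow 0
  | n + 1 => by
    have h1 := tpowMap_epi (F.F 1 m).arrow n
    have h2 := tpowMap_epi (F.F 1 m).arrow (n + 1)
    refine ⟨fun g h e => biprod.hom_ext' _ _ ?_ ?_⟩
    · have := congrArg (omInl _ (n + 1) ≫ ·) e
      simp only [← Category.assoc, omInl_OmMap] at this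
      simp only [Category.assoc] at this
      exact h2.left_cancellation _ _ this
    · have := congrArg (omInr _ n ≫ ·) e
      simp only [← Category.assoc, omInr_OmMap] at this
      simp only [Category.assoc] at this
      exact h1.left_cancellation _ _ this

variable {Y : SupComplex C} {i : ZMod 2} {n : ℕ} {m : ℕᵒᵖ}
  {q : XCx (Omega (A.obj m)) n ⟶ XCx (Omega (F.quotAlg m)) n}

theorem gradedPre_quotHom_injective
    (hq : IsInduced (M := Omega (A.obj m)) (N := Omega (F.quotAlg m)) (OmMap (F.quotHom m)) q) :
    Function.Injective (gradedPre q Y i) := fun f g h => by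
  have := congrArg cochOf h
  rw [cochOf_gradedPre hq, cochOf_gradedPre hq] at this
  exact cochOf_injective (F.cochMap_quotHom_injective m this)

theorem cochOf_gradedPre_quotHom_mem
    (hq : IsInduced (M := Omega (A.obj m)) (N := Omega (F.quotAlg m)) (OmMap (F.quotHom m)) q)
    (f : GradedHom (XCx (Omega (F.quotAlg m)) n) Y i) :
    cochOf (gradedPre q Y i f) ∈ cochFil (F.level m) (totObj Y) 1 := by
  rw [cochOf_gradedPre hq]
  exact F.cochMap_quotHom_mem m _

/-- Combined with `cochOf_gradedPre_quotHom_mem` and injectivity, this identifies Hom(X^n(Ω(A/F_1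
A)), Y) with the part of filtration 1 in Hom(X^n(ΩA), Y). -/
theorem exists_gradedPre_quotHom
    (hq : IsInduced (M := Omega (A.obj m)) (N := Omega (F.quotAlg m)) (OmMap (F.quotHom m)) q)
    (f : GradedHom (XCx (Omega (A.obj m)) n) Y i)
    (hf : cochOf f ∈ cochFil (F.level m) (totObj Y) 1) : ∃ f', gradedPre q Y i f' = f := by
  obtain ⟨χ, hχ⟩ := F.exists_cochMap_quotHom m hf
  have e : ∀ k, OmMap (F.quotHom m) k ≫ toForms χ k = formsOf f k := ofForms_injective (by
    rw [ofForms_OmMap, ofForms_toForms, hχ, cochOf_apply])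
  -- The descended cochain kills bΩ^{n+1} and all forms of degree above n, because its pullback f
  -- does and Ω of the projection is an epimorphism.
  obtain ⟨f', hf'⟩ := exists_cochOf_eq (n := n) i χ
    (by
      have := OmMap_quotHom_epi F m (n + 1)
      rw [← cancel_epi (OmMap (F.quotHom m) (n + 1)), comp_zero, ← Category.assoc, OmMap_b,
        Category.assoc, e, ← omE_succ_left]
      exact E_gradedSeq_top f)
    (fun k hk => by
      have := OmMap_quotHom_epi F m k
      rw [← cancel_epi (OmMap (F.quotHom m) k), comp_zero, e]
      exact gradedSeq_eq_zero f hk)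
  refine ⟨f', cochOf_injective ?_⟩
  rw [cochOf_gradedPre hq, hf', ← cochPr_cochMap, hχ, cochPr_cochOf]

end Descent

/-! ### Every cochain has finite filtration -/

section Support

variable {C : Type u} [Category.{v} C] [MonoidalCategory C] [SymmetricCategory C] [Preadditive C]
  [MonoidalPreadditive C]

/-- If φ vanishes on tensor powers with more than K factors and F_N = 0, then it vanishes on weight
KN: on shorter tensor powers there are no nonzero elements of that weight. -/
theorem exists_mem_cochFil {A : Alg C} (P : AlgFil A) {N : ℕ} (hN : IsZero (P.P N : C)) {W : C}
    {φ : Coch A W} (h : φ ∈ bddCoch A W) : ∃ p, φ ∈ cochFil P W (p + 1) := by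
  obtain ⟨⟨K₁, h₁⟩, ⟨K₂, h₂⟩⟩ := mem_bddCoch.mp h
  have aux : ∀ (c : Seq A.X W) (K : ℕ), (∀ k, K ≤ k → c k = 0) → ∀ w, K * N ≤ w →
      c ∈ seqFil P.P W w := fun c K hc w hw k => by
    by_cases hk : K ≤ k
    · rw [hc k hk]
      exact SubRep.maps_zero
    · refine fil_maps_of_gen fun T x hx => ?_
      rw [fil_eq_zero P.anti hN ((Nat.mul_le_mul_right N (by omega)).trans hw) hx, zero_comp]
      exact zero_mem _
  exact ⟨(K₁ + K₂) * N, mem_cochFil.mpr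
    ⟨aux _ K₁ h₁ _ (by nlinarith), aux _ K₂ h₂ _ (by nlinarith)⟩⟩

theorem cochMap_comp {A B D : Alg C} (f : A ⟶ B) (g : B ⟶ D) {W : C} (φ : Coch D W) :
    cochMap W (f ≫ g) φ = cochMap W f (cochMap W g φ) := by
  have aux : ∀ n (c : tpow D.X n ⟶ W),
      tpowMap (f ≫ g).hom n ≫ c = tpowMap f.hom n ≫ tpowMap g.hom n ≫ c := fun n c => by
    rw [Alg.comp_hom, tpowMap_comp, Category.assoc]
  exact Prod.ext (funext fun n => aux n _) (funext fun n => aux n _)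

end Support

/-! ### Lowering the filtration to 1 along the levels of X^∞ -/

section Levels

variable {C : Type u} [Category.{v} C] [MonoidalCategory C] [SymmetricCategory C] [Preadditive C]
  [MonoidalPreadditive C] [HasCokernels C] [HasFiniteBiproducts C] {A : ℕᵒᵖ ⥤ Alg C}

variable (A) in
/-- The level `n` of the pro-supercomplex `X^∞ A`. -/
abbrev XLevel (n : ℕ) : SupComplex C := XCx (Omega (A.obj (op n))) (n + 1)

variable (A) in
/-- The transfer maps of the pro-supercomplex `X^∞ A`. -/
def XTrans {m n : ℕ} (h : m ≤ n) : XLevel A n ⟶ XLevel A m := (Xinf.obj A).map (homOfLE h).op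

theorem isInduced_XTrans {m n : ℕ} (h : m ≤ n) :
    IsInduced (M := Omega (A.obj (op n))) (N := Omega (A.obj (op m)))
      (OmMap (A.map (homOfLE h).op)) (XTrans A h) := fun k p => by
  have h1 := isInduced_tower (M := Omega (A.obj (op n))) h
  have h2 := isInduced_map (OmegaFunctor.map (A.map (homOfLE h).op)) (m + 1)
  exact (h1.comp h2 k p).trans (congrArg (· ≫ toX (Omega (A.obj (op m))) (m + 1) k p)
    (Category.id_comp _))

theorem cochOf_XTrans {m n : ℕ} (h : m ≤ n) {Y : SupComplex C} {i : ZMod 2}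
    (f : GradedHom (XLevel A m) Y i) :
    cochOf (gradedPre (XTrans A h) Y i f) = cochMap _ (A.map (homOfLE h).op) (cochOf f) :=
  cochOf_gradedPre (isInduced_XTrans h) f

theorem gradedPre_XTrans {m n k : ℕ} (h : m ≤ n) (h' : n ≤ k) {Y : SupComplex C} {i : ZMod 2}
    (f : GradedHom (XLevel A m) Y i) : gradedPre (XTrans A h') Y i (gradedPre (XTrans A h) Y i f) =
      gradedPre (XTrans A (h.trans h')) Y i f := by
  have e : XTrans A (h.trans h') = XTrans A h' ≫ XTrans A h :=
    (Xinf.obj A).map_comp (homOfLE h').op (homOfLE h).op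
  funext s
  rw [e]
  exact (Category.assoc _ _ _).symm

/-- Descending induction on the filtration, one application of `exists_cochDiff_sub_mem` for each
step. The coboundary is only required to have filtration 1, not to vanish; this property is stable
under the corrections made. -/
theorem exists_gradedPre_sub_gradedD_mem [Linear ℚ C] (F : MultFiltration A)
    (hcof : ∀ i V, Function.Surjective (proHomMap (F.incl i) V))
    (hbdd : ∀ m : ℕᵒᵖ, ∃ i : ℕ, IsZero (F.F i m : C)) (Y : SupComplex C) {i j : ZMod 2}
    (hji : j + 1 = i) : ∀ (p n : ℕ) (g : GradedHom (XLevel A n) Y i),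
      cochOf g ∈ cochFil (F.level (op n)) (totObj Y) (p + 1) →
      cochDiff _ (totD Y) ((-1) ^ i.val) (cochOf g) ∈ cochFil (F.level (op n)) (totObj Y) 1 →
      ∃ (n' : ℕ) (hn : n ≤ n') (h : GradedHom (XLevel A n') Y j),
        cochOf (gradedPre (XTrans A hn) Y i g - gradedD _ Y j i hji h) ∈
          cochFil (F.level (op n')) (totObj Y) 1
  | 0, n, g, hg, _ => ⟨n, le_rfl, 0, by
      rw [map_zero, sub_zero, cochOf_XTrans]
      exact cochMap_fil (F.factors_map _) hg⟩
  | p + 1, n, g, hg, hd => by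
    set s : ℤ := (-1) ^ i.val with hs
    have hs' : (-1 : ℤ) ^ j.val = -s := by
      have : ∀ j : ZMod 2, ((-1 : ℤ) ^ j.val) = - (-1 : ℤ) ^ (j + 1).val := by decide
      rw [hs, ← hji, this]
    have hss : s * s = 1 := by
      rw [hs, ← mul_pow, neg_one_mul, neg_neg, one_pow]
    have hmono : ∀ q, cochDiff _ (totD Y) s (cochOf g) ∈
        cochFil (F.level (op n)) (totObj Y) (q + 1) := fun q => by
      induction q with
      | zero => exact hd
      | succ q ih => exact cochFil_mono _ ih
    -- Two consecutive weight maps, one for each run of Cartan's formula.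
    obtain ⟨m₁, hm₁, D₁, hD₁⟩ := exists_isWeightMap F hcof hbdd n
    obtain ⟨m₂, hm₂, D₂, hD₂⟩ := exists_isWeightMap F hcof hbdd m₁
    obtain ⟨ψ, hψb, hψ⟩ := exists_cochDiff_sub_mem hD₁ hD₂ (totD_totD Y) hss (Nat.succ_ne_zero p)
      hg (hmono p) (cochOf_bdd g)
    obtain ⟨⟨K₁, hK₁⟩, ⟨K₂, hK₂⟩⟩ := mem_bddCoch.mp hψb
    -- The level is large enough to lie beyond m₂ and, as it also governs the length of X^{n₁+1},
    -- for the primitive ψ to be defined on X^{n₁+1}.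
    set n₁ := m₂ + K₁ + K₂ + 1 with hn₁
    have hmn : m₂ ≤ n₁ := by omega
    have hnn : n ≤ n₁ := by omega
    obtain ⟨h₁, hh₁⟩ := exists_cochOf_eq_of_bdd (A := A.obj (op n₁)) (n := n₁) j
      (φ := cochMap _ (A.map (homOfLE hmn).op) ψ) fun k hk => by
        constructor
        · exact (congrArg (tpowMap _ k ≫ ·) (hK₁ k (by omega))).trans comp_zero
        · exact (congrArg (tpowMap _ k ≫ ·) (hK₂ k (by omega))).trans comp_zero
    have ecomp : A.map (homOfLE hnn).op =
        A.map (homOfLE hmn).op ≫ A.map (homOfLE hm₂).op ≫ A.map (homOfLE hm₁).op := by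
      rw [← A.map_comp, ← A.map_comp]
      rfl
    set g₁ : GradedHom (XLevel A n₁) Y i := gradedPre (XTrans A hnn) Y i g - gradedD _ Y j i hji h₁
    have eg₁ : cochOf g₁ = cochMap _ (A.map (homOfLE hnn).op) (cochOf g) -
        cochDiff _ (totD Y) (-s) (cochOf h₁) := by
      rw [map_sub, cochOf_XTrans, cochOf_gradedD, hs']
    -- The primitive ψ need not be homogeneous; projection to degree i keeps g and replaces ψ by its
    -- part of degree j, which is h₁.
    have hg₁ : cochOf g₁ ∈ cochFil (F.level (op n₁)) (totObj Y) (p + 1) := by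
      have h2 := cochPr_fil (i := i) (cochMap_fil (P := F.level (op n₁)) (Q := F.level (op m₂)) (f := A.map (homOfLE hmn).op)
        (F.factors_map (homOfLE hmn).op) hψ)
      rw [map_sub, map_sub, ← cochMap_comp, ← cochMap_comp, Category.assoc, ← ecomp,
        cochPr_cochMap, cochPr_cochOf] at h2
      rw [eg₁, hh₁, ← cochPr_cochDiff hji, ← cochMap_cochDiff]
      exact h2
    -- Subtracting a coboundary does not change the coboundary, which is therefore the transfer of
    -- that of g.
    have hd₁ : cochDiff _ (totD Y) s (cochOf g₁) ∈ cochFil (F.level (op n₁)) (totObj Y) 1 := by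
      rw [eg₁, map_sub, cochDiff_cochDiff (totD_totD Y), sub_zero, ← cochMap_cochDiff]
      exact cochMap_fil (F.factors_map _) hd
    obtain ⟨n₂, hn₂, h₂, hh₂⟩ :=
      exists_gradedPre_sub_gradedD_mem F hcof hbdd Y hji p n₁ g₁ hg₁ hd₁
    refine ⟨n₂, hnn.trans hn₂, gradedPre (XTrans A hn₂) Y j h₁ + h₂, ?_⟩
    convert hh₂ using 2
    rw [map_add, map_sub, gradedPre_XTrans, gradedPre_gradedD, sub_add_eq_sub_sub]

end Levels

/-! ### A criterion for quasi-isomorphisms of sequential colimits -/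

section Homology

variable {ι : Type*} {c : ComplexShape ι}

theorem homologyπ_surjective (K : HomologicalComplex AddCommGrpCat.{v} c) (j : ι) :
    Function.Surjective (K.homologyπ j) :=
  (AddCommGrpCat.epi_iff_surjective _).mp inferInstance

theorem exists_iCycles_eq (K : HomologicalComplex AddCommGrpCat.{v} c) {j k : ι} (h : c.next j = k)
    (x : K.X j) (hx : K.d j k x = 0) : ∃ z : K.cycles j, K.iCycles j z = x := by
  subst h
  exact ⟨(K.sc j).abCyclesIso.inv ⟨x, hx⟩, ShortComplex.abCyclesIso_inv_apply_iCycles _ _⟩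

theorem iCycles_injective (K : HomologicalComplex AddCommGrpCat.{v} c) (j : ι) :
    Function.Injective (K.iCycles j) :=
  (AddCommGrpCat.mono_iff_injective _).mp inferInstance

theorem d_iCycles (K : HomologicalComplex AddCommGrpCat.{v} c) (j k : ι) (z : K.cycles j) :
    K.d j k (K.iCycles j z) = 0 := by
  rw [← ConcreteCategory.comp_apply, K.iCycles_d]
  rfl

theorem homologyπ_eq_zero_iff (K : HomologicalComplex AddCommGrpCat.{v} c) {i j : ι}
    (h : c.prev j = i) (z : K.cycles j) :
    K.homologyπ j z = 0 ↔ ∃ y : K.X i, K.d i j y = K.iCycles j z := by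
  subst h
  constructor
  · intro h
    have ex : (ShortComplex.mk (K.sc j).toCycles (K.sc j).homologyπ (by simp)).Exact :=
      ShortComplex.exact_of_g_is_cokernel _ (K.sc j).homologyIsCokernel
    obtain ⟨y, hy⟩ := (ShortComplex.ab_exact_iff _).mp ex z h
    refine ⟨y, ?_⟩
    change (K.sc j).toCycles y = z at hy
    rw [← hy]
    change _ = (K.sc j).iCycles ((K.sc j).toCycles y)
    rw [← ConcreteCategory.comp_apply, ShortComplex.toCycles_i]
    rfl
  · rintro ⟨y, hy⟩
    have h : K.toCycles (c.prev j) j y = z := by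
      apply iCycles_injective
      rw [← hy, ← ConcreteCategory.comp_apply, K.toCycles_i]
    rw [← h, ← ConcreteCategory.comp_apply, HomologicalComplex.toCycles_comp_homologyπ]
    rfl

theorem quasiIsoAt_of_cycles {K L : HomologicalComplex AddCommGrpCat.{v} c} (f : K ⟶ L) {i j k : ι}
    (hi : c.prev j = i) (hk : c.next j = k)
    (hinj : ∀ x : K.X j, K.d j k x = 0 → ∀ y : L.X i, L.d i j y = f.f j x → ∃ w, K.d i j w = x)
    (hsurj : ∀ y : L.X j, L.d j k y = 0 → ∃ (x : K.X j) (w : L.X i),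
      K.d j k x = 0 ∧ y - L.d i j w = f.f j x) : QuasiIsoAt f j := by
  have hf : ∀ z : K.cycles j, L.iCycles j (HomologicalComplex.cyclesMap f j z) =
      f.f j (K.iCycles j z) := fun z => by
    rw [← ConcreteCategory.comp_apply, HomologicalComplex.cyclesMap_i, ConcreteCategory.comp_apply]
  have hπ : ∀ z : K.cycles j, HomologicalComplex.homologyMap f j (K.homologyπ j z) =
      L.homologyπ j (HomologicalComplex.cyclesMap f j z) := fun z => by
    rw [← ConcreteCategory.comp_apply, HomologicalComplex.homologyπ_naturality,
      ConcreteCategory.comp_apply]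
  rw [quasiIsoAt_iff_isIso_homologyMap, ConcreteCategory.isIso_iff_bijective]
  constructor
  · rw [injective_iff_map_eq_zero]
    intro a ha
    obtain ⟨z, rfl⟩ := homologyπ_surjective K j a
    rw [hπ, homologyπ_eq_zero_iff L hi] at ha
    obtain ⟨y, hy⟩ := ha
    rw [hf] at hy
    exact (homologyπ_eq_zero_iff K hi z).mpr (hinj _ (d_iCycles K j k z) y hy)
  · intro b
    obtain ⟨z, rfl⟩ := homologyπ_surjective L j b
    obtain ⟨x, w, hx, hw⟩ := hsurj _ (d_iCycles L j k z)
    obtain ⟨z', rfl⟩ := exists_iCycles_eq K hk x hx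
    refine ⟨K.homologyπ j z', ?_⟩
    rw [hπ, eq_comm, ← sub_eq_zero, ← map_sub, homologyπ_eq_zero_iff L hi]
    refine ⟨w, ?_⟩
    rw [map_sub, hf, ← hw, sub_sub_cancel]

variable (F : ℕ ⥤ HomologicalComplex AddCommGrpCat.{v} c)

theorem exists_colimit_rep (j : ι) (x : (colimit F).X j) :
    ∃ (n : ℕ) (y : (F.obj n).X j), (colimit.ι F n).f j y = x :=
  Concrete.isColimit_exists_rep (F ⋙ HomologicalComplex.eval _ _ j)
    (isColimitOfPreserves (HomologicalComplex.eval _ _ j) (colimit.isColimit F)) x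

theorem colimit_ι_map_apply {m n : ℕ} (h : m ≤ n) (j : ι) (x : (F.obj m).X j) :
    (colimit.ι F n).f j ((F.map (homOfLE h)).f j x) = (colimit.ι F m).f j x := by
  rw [← colimit.w F (homOfLE h), HomologicalComplex.comp_f, ConcreteCategory.comp_apply]

theorem exists_map_eq_of_colimit_ι_eq {n : ℕ} {j : ι} {x x' : (F.obj n).X j}
    (h : (colimit.ι F n).f j x = (colimit.ι F n).f j x') : ∃ (m : ℕ) (hm : n ≤ m),
      (F.map (homOfLE hm)).f j x = (F.map (homOfLE hm)).f j x' := by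
  obtain ⟨m, f, g, hm⟩ := Concrete.isColimit_exists_of_rep_eq
    (F ⋙ HomologicalComplex.eval _ _ j)
    (isColimitOfPreserves (HomologicalComplex.eval _ _ j) (colimit.isColimit F)) x x' h
  exact ⟨m, leOfHom f, hm⟩

/-- The hypothesis `hα` says that cocycles relative to the image of F become, at a later level,
elements of that image up to coboundaries. So the cokernel of α is acyclic in the colimit; as α is
injective, the colimit map is a quasi-isomorphism. -/
theorem quasiIso_colimMap {F G : ℕ ⥤ HomologicalComplex AddCommGrpCat.{v} c} (α : F ⟶ G)
    (hprev : ∀ j, c.Rel (c.prev j) j) (hnext : ∀ j, c.Rel j (c.next j))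
    (hinj : ∀ n j, Function.Injective ((α.app n).f j))
    (hα : ∀ (n : ℕ) {i j k : ι}, c.Rel i j → c.Rel j k → ∀ (g : (G.obj n).X j)
      (x : (F.obj n).X k), (G.obj n).d j k g = (α.app n).f k x →
      ∃ (m : ℕ) (hm : n ≤ m) (h : (G.obj m).X i) (w : (F.obj m).X j),
        (G.map (homOfLE hm)).f j g - (G.obj m).d i j h = (α.app m).f j w) :
    QuasiIso (colimMap α) := by
  have hF : ∀ {n m : ℕ} (h : n ≤ m) (i j : ι) (x : (F.obj n).X i),
      (F.obj m).d i j ((F.map (homOfLE h)).f i x) = (F.map (homOfLE h)).f j ((F.obj n).d i j x) :=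
    fun h i j x => ConcreteCategory.congr_hom ((F.map (homOfLE h)).comm i j) x
  have hG : ∀ {n m : ℕ} (h : n ≤ m) (i j : ι) (x : (G.obj n).X i),
      (G.obj m).d i j ((G.map (homOfLE h)).f i x) = (G.map (homOfLE h)).f j ((G.obj n).d i j x) :=
    fun h i j x => ConcreteCategory.congr_hom ((G.map (homOfLE h)).comm i j) x
  have hd : ∀ (n : ℕ) (i j : ι) (x : (F.obj n).X i),
      (G.obj n).d i j ((α.app n).f i x) = (α.app n).f j ((F.obj n).d i j x) :=
    fun n i j x => ConcreteCategory.congr_hom ((α.app n).comm i j) x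
  have hcF : ∀ (n : ℕ) (i j : ι) (x : (F.obj n).X i),
      (colimit F).d i j ((colimit.ι F n).f i x) = (colimit.ι F n).f j ((F.obj n).d i j x) :=
    fun n i j x => ConcreteCategory.congr_hom ((colimit.ι F n).comm i j) x
  have hcG : ∀ (n : ℕ) (i j : ι) (x : (G.obj n).X i),
      (colimit G).d i j ((colimit.ι G n).f i x) = (colimit.ι G n).f j ((G.obj n).d i j x) :=
    fun n i j x => ConcreteCategory.congr_hom ((colimit.ι G n).comm i j) x
  have hαc : ∀ (n : ℕ) (j : ι) (x : (F.obj n).X j),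
      (colimMap α).f j ((colimit.ι F n).f j x) = (colimit.ι G n).f j ((α.app n).f j x) :=
    fun n j x => ConcreteCategory.congr_hom
      (congrArg (fun t => HomologicalComplex.Hom.f t j) (ι_colimMap α n)) x
  have hnat : ∀ {n m : ℕ} (h : n ≤ m) (j : ι) (x : (F.obj n).X j),
      (α.app m).f j ((F.map (homOfLE h)).f j x) = (G.map (homOfLE h)).f j ((α.app n).f j x) :=
    fun h j x => ConcreteCategory.congr_hom
      (congrArg (fun t => HomologicalComplex.Hom.f t j) (α.naturality (homOfLE h))) x
  refine ⟨fun j => quasiIsoAt_of_cycles (colimMap α) rfl rfl (fun x _ y hxy => ?_) fun y hy => ?_⟩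
  · obtain ⟨n₁, x, rfl⟩ := exists_colimit_rep F j x
    obtain ⟨n₂, y, rfl⟩ := exists_colimit_rep G _ y
    obtain ⟨n, h₁, h₂⟩ : ∃ n, n₁ ≤ n ∧ n₂ ≤ n := ⟨max n₁ n₂, le_max_left _ _, le_max_right _ _⟩
    rw [← colimit_ι_map_apply F h₁, ← colimit_ι_map_apply G h₂, hαc, hcG] at hxy
    obtain ⟨m, hm, e⟩ := exists_map_eq_of_colimit_ι_eq G hxy
    rw [← hG, ← hnat] at e
    -- Injectivity on cohomology: from dy = α(x) and y − dh = α(w) follows α(dw) = α(x), hence x =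
    -- dw after transfer.
    obtain ⟨m', hm', h, w, hw⟩ := hα m (hprev _) (hprev j) _ _ e
    refine ⟨(colimit.ι F m').f _ w, ?_⟩
    rw [hcF, ← colimit_ι_map_apply F h₁, ← colimit_ι_map_apply F hm, ← colimit_ι_map_apply F hm']
    congr 1
    apply hinj
    rw [hnat, ← e, ← hG, ← hd, ← hw, map_sub, sub_eq_self, ← ConcreteCategory.comp_apply,
      HomologicalComplex.d_comp_d]
    rfl
  · obtain ⟨n, y, rfl⟩ := exists_colimit_rep G j y
    rw [hcG, ← map_zero ((colimit.ι G n).f (c.next j)).hom] at hy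
    obtain ⟨m, hm, e⟩ := exists_map_eq_of_colimit_ι_eq G hy
    rw [← hG] at e
    -- Surjectivity on cohomology: a cocycle y is the case x = 0, and y − dh = α(w) with w a cocycle
    -- by injectivity of α.
    obtain ⟨m', hm', h, w, hw⟩ := hα m (hprev j) (hnext j) _ 0
      (e.trans ((map_zero _).trans (map_zero _).symm))
    refine ⟨(colimit.ι F m').f j w, (colimit.ι G m').f _ h, ?_, ?_⟩
    · have : (F.obj m').d j (c.next j) w = 0 := by
        apply hinj
        rw [← hd, ← hw, map_sub, hG, e, ← ConcreteCategory.comp_apply ((G.obj m').d _ _),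
          HomologicalComplex.d_comp_d]
        change (G.map (homOfLE hm')).f _ ((G.map (homOfLE hm)).f _ 0) - 0 = (α.app m').f _ 0
        rw [map_zero, map_zero, map_zero, sub_zero]
      rw [hcF, this, map_zero]
    · rw [hαc, ← hw, map_sub, hcG, colimit_ι_map_apply, colimit_ι_map_apply]

end Homology

/-! ### Verification of the criterion for the projection -/

section WeakEquivalence

variable {C : Type u} [Category.{v} C] [Preadditive C]

theorem supHom_d_apply (X Y : SupComplex C) {i j : ZMod 2} (h : i + 1 = j)
    (f : GradedHom X Y i) : (supHom X Y).d i j f = gradedD X Y i j h f := by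
  have : (supHom X Y).d i j = AddCommGrpCat.ofHom (gradedD X Y i j h) := dif_pos h
  rw [this]
  rfl

/-- If dg comes from the quotient it has filtration 1, so g can be moved into filtration 1, and what
has filtration 1 comes from the quotient. -/
theorem exists_gradedPre_sub_gradedD_eq [Linear ℚ C] [HasCokernels C] [HasFiniteBiproducts C]
    [MonoidalCategory C] [SymmetricCategory C] [MonoidalPreadditive C] [TensorPreservesCokernels C]
    {A : ℕᵒᵖ ⥤ Alg C} (F : MultFiltration A)
    (hcof : ∀ i V, Function.Surjective (proHomMap (F.incl i) V))
    (hbdd : ∀ m : ℕᵒᵖ, ∃ i : ℕ, IsZero (F.F i m : C))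
    {q : ∀ n, XLevel A n ⟶ XCx (Omega (F.quotAlg (op n))) (n + 1)}
    (hq : ∀ n, IsInduced (M := Omega (A.obj (op n))) (N := Omega (F.quotAlg (op n)))
      (OmMap (F.quotHom (op n))) (q n)) {Y : SupComplex C} {i j k : ZMod 2} (hij : i + 1 = j)
    (hjk : j + 1 = k) {n : ℕ} (g : GradedHom (XLevel A n) Y j)
    (x : GradedHom (XCx (Omega (F.quotAlg (op n))) (n + 1)) Y k)
    (e : gradedD _ Y j k hjk g = gradedPre (q n) Y k x) :
    ∃ (m : ℕ) (hm : n ≤ m) (h : GradedHom (XLevel A m) Y i)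
      (w : GradedHom (XCx (Omega (F.quotAlg (op m))) (m + 1)) Y j),
      gradedPre (XTrans A hm) Y j g - gradedD _ Y i j hij h = gradedPre (q m) Y j w := by
  obtain ⟨N, hN⟩ := hbdd (op n)
  obtain ⟨p, hp⟩ := exists_mem_cochFil (F.level (op n)) hN (cochOf_bdd g)
  have hd : cochDiff _ (totD Y) ((-1) ^ j.val) (cochOf g) ∈
      cochFil (F.level (op n)) (totObj Y) 1 := by
    rw [← cochOf_gradedD hjk, e]
    exact cochOf_gradedPre_quotHom_mem F (hq n) x
  obtain ⟨m, hm, h, hh⟩ := exists_gradedPre_sub_gradedD_mem F hcof hbdd Y hij p n g hp hd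
  obtain ⟨w, hw⟩ := exists_gradedPre_quotHom F (hq m) _ hh
  exact ⟨m, hm, h, w, hw.symm⟩

end WeakEquivalence

end ProCyclic

end

/-! ### The theorem -/

theorem theorem7p3 {C : Type u} [Category.{v} C] [Preadditive C] [Linear ℚ C]
    [HasFiniteBiproducts C] [HasFiniteLimits C] [HasFiniteColimits C]
    [MonoidalCategory C] [SymmetricCategory C] [MonoidalPreadditive C]
    [TensorPreservesCokernels C]
    (ℑ : ObjectProperty C) (hℑ : ∀ V : C, RelInj ℑ V)
    (A : ℕᵒᵖ ⥤ Alg C) (F : MultFiltration A)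
    (hcof : ∀ i : ℕ, IsProCof ℑ (F.incl i))
    (hbdd : ∀ m : ℕᵒᵖ, ∃ i : ℕ, IsZero (F.F i m : C)) :
    IsProWeakEquiv ℑ (Xinf.map F.quotientMap) := by
  intro Y _
  have hq : ∀ n : ℕ, IsInduced (M := Omega (A.obj (op n))) (N := Omega (F.quotAlg (op n)))
      (OmMap (F.quotHom (op n))) ((Xinf.map F.quotientMap).app (op n)) := fun n =>
    isInduced_map (OmegaFunctor.map (F.quotHom (op n))) (n + 1)
  refine quasiIso_colimMap _ (fun j => ?_) (fun j => ?_) (fun n j => ?_) fun n i j k hij hjk g x e => ?_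
  · rw [ComplexShape.prev_eq' (ComplexShape.up (ZMod 2)) (sub_add_cancel j 1)]
    exact sub_add_cancel j 1
  · rw [ComplexShape.next_eq' (ComplexShape.up (ZMod 2)) (show j + 1 = j + 1 from rfl)]
    rfl
  · exact gradedPre_quotHom_injective F (hq n)
  · change i + 1 = j at hij
    change j + 1 = k at hjk
    -- Relative injectivity of all objects makes pro-maps to every object extend along the
    -- inclusions F_{i+1} → F_i, in particular maps to the pieces F_{i+1} A_m themselves.
    obtain ⟨m, hm, h, w, hw⟩ := exists_gradedPre_sub_gradedD_eq F (fun i V => hcof i V (hℑ V)) hbdd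
      hq hij hjk g x ((supHom_d_apply (XLevel A n) Y hjk g).symm.trans e)
    refine ⟨m, hm, h, w, Eq.trans ?_ hw⟩
    exact congrArg (gradedPre (XTrans A hm) Y j g - ·) (supHom_d_apply (XLevel A m) Y hij h)
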